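/- Let $p$ be an odd positive integer, let $K\subset S^3$ be a $p$-colorable knot, i.e. one whose knot group $\pi_1(S^3\setminus K)$ admits a surjection $\rho$ (a $p$-coloring) onto the dihedral group $D_p$ of order $2p$, and suppose that $K$ can be put in $n$-bridge position, i.e. some sphere splits $S^3$ into two closed balls each of which meets $K$ in a trivial $n$-tangle. Let $f: M\to S^3$ be the $p$-fold irregular dihedral cover branched along $K$ determined by $\rho$, i.e. the branched cover whose unbranched part, over $S^3\setminus K$, is the connected cover corresponding to the conjugacy class of the subgroup $\rho^{-1}(C)$, where $C\subset D_p$ is a subgroup of order $2$. Then the Heegaard genus of $M$ is at most $\frac12(p-1)(n-2)$, and the rank of the singular homology group $H_1(M;\mathbb Z)$ is at most $\frac12(p-1)(n-2)$. -/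

import Mathlib

open CategoryTheory

/-- The standard three-sphere, the unit sphere of `ℝ⁴`. -/
abbrev ThreeSphere : Type := Metric.sphere (0 : EuclideanSpace ℝ (Fin 4)) 1

/-- The unit cube `[0,1]³`, used as the model of the closed 3-ball; its boundary sphere is
`Cube.boundary (Fin 3)`. -/
abbrev Cube3 : Type := Fin 3 → unitInterval

/-- A knot: a subset of the three-sphere that is the image of an embedded circle.
(Tameness is automatic for the knots with a bridge position considered below.) -/
def IsKnot (K : Set ThreeSphere) : Prop :=
  ∃ γ : Circle → ThreeSphere, Topology.IsEmbedding γ ∧ Set.range γ = K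

/-- The standard trivial `n`-tangle in the cube: the `n` parallel vertical arcs
`{((2k+1)/(2n), 1/2)} × [0,1]`, `k = 0, …, n-1`. -/
def trivialTangle (n : ℕ) : Set Cube3 :=
  {y | (∃ k : Fin n, (y 0 : ℝ) = (2 * (k : ℝ) + 1) / (2 * n)) ∧ (y 1 : ℝ) = 1 / 2}

/-- `K` can be put in `n`-bridge position: the three-sphere is the union of two closed balls
`range h₁`, `range h₂` that meet exactly in their common boundary sphere (the bridge sphere),
and each of the two balls meets `K` in a trivial `n`-tangle. -/
def HasBridgePosition (n : ℕ) (K : Set ThreeSphere) : Prop :=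
  ∃ h₁ h₂ : Cube3 → ThreeSphere,
    Topology.IsEmbedding h₁ ∧ Topology.IsEmbedding h₂ ∧
    Set.range h₁ ∪ Set.range h₂ = Set.univ ∧
    Set.range h₁ ∩ Set.range h₂ = h₁ '' Cube.boundary (Fin 3) ∧
    Set.range h₁ ∩ Set.range h₂ = h₂ '' Cube.boundary (Fin 3) ∧
    h₁ ⁻¹' K = trivialTangle n ∧ h₂ ⁻¹' K = trivialTangle n

/-- Branched covers of 3-manifolds along a locally flat 1-dimensional set `B`: `f` is proper, is
a covering map over the complement of `B`, and near every point lying over `B` it is, in suitable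
charts in which `B` is `{0} × ℝ`, the map `(z, t) ↦ (z ^ k, t)` of `ℂ × ℝ` for some branching
index `k ≥ 1`. -/
structure IsBranchedCover {M Y : Type*} [TopologicalSpace M] [TopologicalSpace Y]
    (f : M → Y) (B : Set Y) : Prop where
  proper : IsProperMap f
  covering : IsCoveringMapOn f Bᶜ
  local_model : ∀ x : M, f x ∈ B → ∃ k : ℕ, 1 ≤ k ∧
    ∃ (φ : OpenPartialHomeomorph M (ℂ × ℝ)) (ψ : OpenPartialHomeomorph Y (ℂ × ℝ)),
      x ∈ φ.source ∧ Set.MapsTo f φ.source ψ.source ∧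
      (∀ y ∈ ψ.source, y ∈ B ↔ (ψ y).1 = 0) ∧
      ∀ x' ∈ φ.source, ψ (f x') = ((φ x').1 ^ k, (φ x').2)

/-- A `p`-coloring of `K`: a surjection of the knot group onto the dihedral group of order
`2 * p`. -/
def IsColoring {p : ℕ} {K : Set ThreeSphere} {x₀ : ↥Kᶜ}
    (ρ : FundamentalGroup ↥Kᶜ x₀ →* DihedralGroup p) : Prop :=
  Function.Surjective ρ

/-- `f : M → S³` is the irregular dihedral cover branched along `K` determined by `ρ`: it is a
branched cover whose unbranched part (the part over the complement of `K`) is the connected cover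
corresponding to the conjugacy class of `ρ⁻¹(C)`, where `C` is a subgroup of order two of the
dihedral group. -/
structure IsIrregularDihedralCover {p : ℕ} {K : Set ThreeSphere} {x₀ : ↥Kᶜ}
    (ρ : FundamentalGroup ↥Kᶜ x₀ →* DihedralGroup p)
    {M : Type*} [TopologicalSpace M] (f : C(M, ThreeSphere)) : Prop where
  branched : IsBranchedCover f K
  connected : IsPathConnected (f ⁻¹' Kᶜ)
  subgroup : ∃ C : Subgroup (DihedralGroup p), Nat.card C = 2 ∧
    ∃ (x : ↥(f ⁻¹' Kᶜ)) (hx : f.restrictPreimage Kᶜ x = x₀),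
      (FundamentalGroup.mapOfEq (f.restrictPreimage Kᶜ) hx).range = C.comap ρ

/-- The subset `H` is a (3-dimensional) handlebody of genus `g`: it is connected and is obtained
from `v` disjoint 3-balls by attaching `e` disjoint 1-handles `[0,1] × [0,1]²` along their ends
`{0,1} × [0,1]²` to the boundary spheres of the balls, where `g = e - v + 1`.
(Inside an orientable 3-manifold such an `H` is automatically orientable.) -/
def IsHandlebody {X : Type*} [TopologicalSpace X] (H : Set X) (g : ℕ) : Prop :=
  IsConnected H ∧
  ∃ (v e : ℕ) (ball : Fin v → Cube3 → X) (handle : Fin e → Cube3 → X),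
    g + v = e + 1 ∧
    (∀ i, Topology.IsClosedEmbedding (ball i)) ∧
    (∀ j, Topology.IsClosedEmbedding (handle j)) ∧
    (⋃ i, Set.range (ball i)) ∪ (⋃ j, Set.range (handle j)) = H ∧
    (∀ i i', i ≠ i' → Disjoint (Set.range (ball i)) (Set.range (ball i'))) ∧
    (∀ j j', j ≠ j' → Disjoint (Set.range (handle j)) (Set.range (handle j'))) ∧
    (∀ j y, handle j y ∈ (⋃ i, Set.range (ball i)) ↔ (y 0 = 0 ∨ y 0 = 1)) ∧
    (∀ j y i z, handle j y = ball i z → z ∈ Cube.boundary (Fin 3))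

/-- The closed 3-manifold `X` has a Heegaard splitting of genus `g`: it is the union of two
handlebodies of genus `g` that meet exactly in their common boundary. (In a closed 3-manifold the
boundary of a handlebody is its topological frontier.) -/
def HasHeegaardSplitting (X : Type*) [TopologicalSpace X] (g : ℕ) : Prop :=
  ∃ H₁ H₂ : Set X, IsHandlebody H₁ g ∧ IsHandlebody H₂ g ∧ H₁ ∪ H₂ = Set.univ ∧
    H₁ ∩ H₂ = frontier H₁ ∧ H₁ ∩ H₂ = frontier H₂

/-- The Heegaard genus: the least genus of a Heegaard splitting (`⊤` if there is none). -/
noncomputable def heegaardGenus (X : Type*) [TopologicalSpace X] : ℕ∞ :=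
  ⨅ (g : ℕ) (_ : HasHeegaardSplitting X g), (g : ℕ∞)

universe u

/-- The first singular homology group with integer coefficients. -/
noncomputable abbrev firstHomology (X : Type u) [TopologicalSpace X] : ModuleCat.{u} ℤ :=
  ((AlgebraicTopology.singularHomologyFunctor (ModuleCat.{u} ℤ) 1).obj
    (ModuleCat.of ℤ (ULift.{u} ℤ))).obj (TopCat.of X)

/-!
Lift the bridge position to the branched cover `M`. Each of the two balls is cut into `n` columns
around its arcs and `n - 1` columns between them. A column between two arcs misses the knot, so its
preimage consists of `p` copies of it. A column around an arc is the product of a square and the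
arc, so the components of its preimage are cyclic branched covers of it, balls again, and there are
as many of them as there are points over a point of the arc. Thus the preimage of a ball is a
handlebody, with the components over the columns around arcs as balls and the components over the
columns between arcs as handles (`IsBridgeSplitting.isHandlebody`), and the two preimages form a
Heegaard splitting of `M` (`IsBridgeSplitting.hasHeegaardSplitting`).

The number of points of a fibre is read off from the monodromy. The cover belongs to the stabiliser
of a coset of a subgroup of order two in the dihedral group, so that general fibres have `p` points,
and a loop mapped to a reflection acts on such a fibre as an involution with exactly one fixed point
(`IsCoveringMap.dihedral_monodromy`). Hence a fibre over an arc whose meridian is mapped to a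
reflection has `(p + 1) / 2` points (`TangleColumn.PolarLift.two_mul_card_orbits`). Such an arc
exists, as otherwise the knot group, being generated by meridians, would be mapped to rotations
(`IsBridgeSplitting.exists_meridian_eq_sr`). As the knot is connected, all its fibres have the same
number of points (`IsBridgeSplitting.card_fiber_eq`). The genus is therefore
`(n - 1) * p - n * (p + 1) / 2 + 1 = (p - 1) * (n - 2) / 2`.

Neither van Kampen's theorem nor the Mayer-Vietoris sequence is used. Their part is played by
additive path cocycles, the functors `PathCocycle` from the fundamental groupoid to an abelian
group, and by their primitives, which are glued along finite closed covers
(`PathCocycle.isPrimitive_of_closed_cover`). That meridians generate up to commutators is the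
statement that a cocycle on the knot complement which vanishes on meridians has a primitive
(`IsBridgeSplitting.exists_isPrimitive_compl`). For the homology, singular one-cocycles with
rational values are path cocycles, and the rank of the first homology is at most the number of
linear conditions under which a cocycle has a primitive (`rank_firstHomology_le`). A primitive on
one handlebody extends over the other one, each piece of which is the product of a square and an
interval and can be pushed down to its bottom (`PathCocycle.exists_primitive_extension`). On the
first handlebody, the obstruction is a one-cocycle of the graph of its balls and handles, so that
the bound is the first Betti number of this graph, which is the genus
(`IsBridgeSplitting.rank_le`).
-/

open Topology unitInterval Set Filter

/-! ### Locally path-connected and simply connected spaces -/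

instance : LocallyPathConnectedSpace unitInterval :=
  (convex_Icc (0 : ℝ) 1).locallyPathConnectedSpace

instance Cube3.contractibleSpace : ContractibleSpace Cube3 := by
  rw [contractible_iff_id_nullhomotopic]
  exact ⟨fun _ => 0, ⟨⟨fun q i => σ q.1 * q.2 i, by fun_prop⟩, fun w => by ext; simp,
    fun w => by ext; simp⟩⟩

/-- A space in which every point has an open simply connected neighbourhood. -/
def HasSimplyConnectedNhds (X : Type*) [TopologicalSpace X] : Prop :=
  ∀ x : X, ∃ U : Set X, IsOpen U ∧ x ∈ U ∧ SimplyConnectedSpace U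

theorem HasSimplyConnectedNhds.of_openPartialHomeomorph {X E : Type*} [TopologicalSpace X]
    [NormedAddCommGroup E] [NormedSpace ℝ E] {x : X} (φ : OpenPartialHomeomorph X E)
    (hx : x ∈ φ.source) {V : Set X} (hV : IsOpen V) (hxV : x ∈ V) :
    ∃ U ⊆ V, IsOpen U ∧ x ∈ U ∧ SimplyConnectedSpace U := by
  have h1 : IsOpen (φ.symm ⁻¹' V ∩ φ.target) := by
    rw [inter_comm]; exact φ.isOpen_inter_preimage_symm hV
  obtain ⟨r, hr, hB⟩ := Metric.isOpen_iff.1 h1 (φ x) ⟨by simpa [hx], φ.map_source hx⟩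
  have hsub : Metric.ball (φ x) r ⊆ φ.target := fun y hy => (hB hy).2
  refine ⟨φ.symm '' Metric.ball (φ x) r, ?_, φ.symm.isOpen_image_of_subset_source
    Metric.isOpen_ball hsub, ⟨φ x, Metric.mem_ball_self hr, φ.left_inv hx⟩, ?_⟩
  · rintro _ ⟨y, hy, rfl⟩
    exact (hB hy).1
  · have : ContractibleSpace (Metric.ball (φ x) r) :=
      (convex_ball _ _).contractibleSpace ⟨_, Metric.mem_ball_self hr⟩
    have e : Metric.ball (φ x) r ≃ₜ φ.symm '' Metric.ball (φ x) r :=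
      { toFun := fun y => ⟨φ.symm y, y, y.2, rfl⟩
        invFun := fun z => ⟨φ z, by
          obtain ⟨_, y, hy, rfl⟩ := z
          simpa [φ.right_inv (hsub hy)] using hy⟩
        left_inv := fun y => by simp [φ.right_inv (hsub y.2)]
        right_inv := by
          rintro ⟨_, y, hy, rfl⟩
          simp [φ.right_inv (hsub hy)]
        continuous_toFun := by
          refine Continuous.subtype_mk ?_ _
          exact (φ.symm.continuousOn.mono hsub).comp_continuous continuous_subtype_val
            fun y => y.2
        continuous_invFun := by
          refine Continuous.subtype_mk ?_ _
          refine φ.continuousOn.comp_continuous continuous_subtype_val ?_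
          rintro ⟨_, y, hy, rfl⟩
          exact φ.map_target (hsub hy) }
    have := e.symm.contractibleSpace
    infer_instance

/-! ### Additive path cocycles -/

/-- An additive cocycle on the paths of `X`: a homotopy invariant, additive function on paths, in
other words a functor from the fundamental groupoid of `X` to `A`. -/
structure PathCocycle (X A : Type*) [TopologicalSpace X] [AddCommGroup A] where
  /-- The value of the cocycle on a path. -/
  val : ∀ {x y : X}, Path x y → A
  val_eq_of_homotopic : ∀ {x y : X} {p q : Path x y}, p.Homotopic q → val p = val q
  val_trans : ∀ {x y z : X} (p : Path x y) (q : Path y z), val (p.trans q) = val p + val q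

namespace PathCocycle

variable {X Y A : Type*} [TopologicalSpace X] [TopologicalSpace Y] [AddCommGroup A]

/-- The pull-back of a cocycle along a continuous map. -/
def comap (c : PathCocycle X A) (f : C(Y, X)) : PathCocycle Y A where
  val p := c.val (p.map f.continuous)
  val_eq_of_homotopic h := c.val_eq_of_homotopic (h.map f)
  val_trans p q := by rw [Path.map_trans, c.val_trans]

/-- `h` is a primitive of `c` if `c` is the difference of the values of `h` at the end points. -/
def IsPrimitive (c : PathCocycle X A) (h : X → A) : Prop :=
  ∀ ⦃x y : X⦄ (p : Path x y), c.val p = h y - h x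

variable (c : PathCocycle X A)

theorem val_refl (x : X) : c.val (Path.refl x) = 0 := by
  have := c.val_trans (Path.refl x) (Path.refl x)
  rw [Path.refl_trans_refl] at this
  simpa using this

theorem val_cast {x y x' y' : X} (p : Path x y) (hx : x' = x) (hy : y' = y) :
    c.val (p.cast hx hy) = c.val p := by
  subst hx hy; rfl

theorem val_comap (f : C(Y, X)) {x y : Y} (p : Path x y) :
    (c.comap f).val p = c.val (p.map f.continuous) := rfl

theorem val_congr {x y x' y' : X} {p : Path x y} {q : Path x' y'} (h : ∀ t, p t = q t) :
    c.val p = c.val q := by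
  obtain rfl : x = x' := by simpa using h 0
  obtain rfl : y = y' := by simpa using h 1
  congr 1
  ext t
  exact h t

/-- The primitive of a cocycle normalised to vanish at the base point `x₀`, on a simply connected
space. -/
noncomputable def primitive [PathConnectedSpace X] (x₀ : X) (x : X) : A :=
  c.val (PathConnectedSpace.somePath x₀ x)

theorem isPrimitive_primitive [SimplyConnectedSpace X] (x₀ : X) :
    c.IsPrimitive (c.primitive x₀) := fun x y p => by
  rw [eq_sub_iff_add_eq', primitive, ← c.val_trans]
  exact c.val_eq_of_homotopic (SimplyConnectedSpace.paths_homotopic _ _)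

variable {c}

theorem IsPrimitive.comap {h : X → A} (hc : c.IsPrimitive h) (f : C(Y, X)) :
    (c.comap f).IsPrimitive (h ∘ f) := fun _ _ p => hc (p.map f.continuous)

theorem IsPrimitive.add_const {h : X → A} (hc : c.IsPrimitive h) (a : A) :
    c.IsPrimitive (fun x => h x + a) := fun x y p => by simp [hc p]

/-- Two primitives differ by a constant along paths. -/
theorem IsPrimitive.sub_eq {h k : X → A} (hh : c.IsPrimitive h) (hk : c.IsPrimitive k) {x y : X}
    (hxy : Joined x y) : h x - k x = h y - k y := by
  obtain ⟨p⟩ := hxy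
  have := (hh p).symm.trans (hk p)
  rw [sub_eq_sub_iff_add_eq_add] at this ⊢
  rw [add_comm, ← this, add_comm]

/-- If a function is a primitive along all paths in the members of an open cover, it is a
primitive. -/
theorem isPrimitive_of_local {h : X → A}
    (H : ∀ x : X, ∃ U : Set X, IsOpen U ∧ x ∈ U ∧
      ∀ ⦃y z : X⦄ (p : Path y z), range p ⊆ U → c.val p = h z - h y) : c.IsPrimitive h := by
  intro x y p
  -- The function `F` is locally constant, and its values at the two ends are the two sides.
  set F : I → A := fun t => c.val (p.subpath 0 t) - h (p t) with hF
  have hloc : IsLocallyConstant F := by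
    rw [IsLocallyConstant.iff_eventually_eq]
    intro t
    obtain ⟨U, hU, hxU, hp⟩ := H (p t)
    have h1 : p ⁻¹' U ∈ 𝓝 t := (hU.preimage p.continuous).mem_nhds hxU
    have h2 : ∀ᶠ s in 𝓝 t, uIcc t s ⊆ p ⁻¹' U := by
      have := (tendsto_const_nhds (x := t) (f := 𝓝 t)).uIcc (tendsto_id (α := I) (x := 𝓝 t))
      exact (tendsto_smallSets_iff.1 this) _ h1
    filter_upwards [h2] with s hs
    have h3 := c.val_eq_of_homotopic ⟨Path.Homotopy.subpathTransSubpath p 0 t s⟩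
    rw [c.val_trans, hp (p.subpath t s)] at h3
    · simp only [hF, ← h3]; abel
    · rw [Path.range_subpath]
      exact image_subset_iff.2 hs
  have h01 := hloc.apply_eq_of_preconnectedSpace 0 1
  simp only [hF, Path.subpath_self, val_refl, Path.subpath_zero_one, val_cast, Path.source,
    Path.target] at h01
  rw [← sub_add_cancel (c.val p) (h y), ← h01]; abel

/-- A function that is a primitive on each of finitely many closed, locally path-connected pieces
is a primitive on everything that maps to their union. -/
theorem isPrimitive_comap_of_closed_cover (hX : HasSimplyConnectedNhds X) {ι : Type*} [Finite ι]
    {W : ι → Type*} [∀ i, TopologicalSpace (W i)] [∀ i, LocallyPathConnectedSpace (W i)]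
    (e : ∀ i, C(W i, X)) (he : ∀ i, IsClosedMap (e i))
    {h : X → A} (hh : ∀ i, (c.comap (e i)).IsPrimitive (h ∘ e i)) (g : C(Y, X))
    (hcov : ∀ y, ∃ i w, e i w = g y) : (c.comap g).IsPrimitive (h ∘ g) := by
  refine isPrimitive_of_local fun y₀ => ?_
  obtain ⟨U, hU, hxU, hsc⟩ := hX (g y₀)
  set j : C(U, X) := ⟨Subtype.val, continuous_subtype_val⟩ with hj
  set k := (c.comap j).primitive ⟨g y₀, hxU⟩
  have hk : (c.comap j).IsPrimitive k := isPrimitive_primitive _ _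
  let u : U := ⟨g y₀, hxU⟩
  -- On each piece, `h` differs from the local primitive `k` by the same constant near the point:
  -- as the pieces are closed, all their points over nearby points are joined to points over `u`.
  have h1 : ∀ i, ∀ᶠ y in 𝓝 (u : X), ∀ w ∈ e i ⁻¹' {y}, ∃ hy : e i w ∈ U,
      h (e i w) - k ⟨e i w, hy⟩ = h u - k u := by
    intro i
    refine (he i).eventually_nhds_fiber _ fun w hw => ?_
    rw [mem_preimage, mem_singleton_iff] at hw
    have hwU : w ∈ e i ⁻¹' U := by rw [mem_preimage, hw]; exact u.2
    obtain ⟨O, ⟨hO, hOp⟩, hOU⟩ := (path_connected_basis w).mem_iff.1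
      ((hU.preimage (e i).continuous).mem_nhds hwU)
    filter_upwards [hO] with w' hw'
    refine ⟨hOU hw', ?_⟩
    obtain ⟨q, hq⟩ := hOp.joinedIn w (mem_of_mem_nhds hO) w' hw'
    have h2 : c.val (q.map (e i).continuous) = h (e i w') - h (e i w) := hh i q
    let r : Path (⟨e i w, hwU⟩ : U) ⟨e i w', hOU hw'⟩ :=
      ⟨⟨fun t => ⟨e i (q t), hOU (hq t)⟩, by fun_prop⟩, by simp, by simp⟩
    have h3 : c.val (r.map j.continuous) = _ := hk r
    have h4 : c.val (r.map j.continuous) = c.val (q.map (e i).continuous) :=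
      c.val_congr fun t => rfl
    rw [h4, h2] at h3
    have : u = ⟨e i w, hwU⟩ := Subtype.ext hw.symm
    rw [this]
    rw [sub_eq_sub_iff_add_eq_add] at h3 ⊢
    simp only at h3 ⊢
    rw [h3, add_comm]
  have h2 := (g.continuous.tendsto y₀).eventually (eventually_all.2 h1)
  obtain ⟨V, hV, hVo, hyV⟩ := eventually_nhds_iff.1 h2
  have h3 (y : Y) (hy : y ∈ V) : ∃ hy : g y ∈ U, h (g y) - k ⟨g y, hy⟩ = h u - k u := by
    obtain ⟨i, w, hw⟩ := hcov y
    obtain ⟨hyU, h3⟩ := hV y hy i w hw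
    exact ⟨hw ▸ hyU, by simpa [hw] using h3⟩
  refine ⟨V, hVo, hyV, ?_⟩
  intro y z p hp
  have hpU (t : I) : g (p t) ∈ U := (h3 _ (hp ⟨t, rfl⟩)).1
  let r : Path (⟨g (p 0), hpU 0⟩ : U) ⟨g (p 1), hpU 1⟩ :=
    ⟨⟨fun t => ⟨g (p t), hpU t⟩, by fun_prop⟩, rfl, rfl⟩
  have h4 : c.val (r.map j.continuous) = _ := hk r
  have h5 : c.val (r.map j.continuous) = (c.comap g).val p := c.val_congr fun t => rfl
  have h6 := (h3 _ (hp ⟨0, rfl⟩)).2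
  have h7 := (h3 _ (hp ⟨1, rfl⟩)).2
  have h8 : (h ∘ g) y = h (g (p 0)) := by rw [p.source]; rfl
  have h9 : (h ∘ g) z = h (g (p 1)) := by rw [p.target]; rfl
  rw [← h5, h4, h8, h9]
  rw [← h6, sub_eq_sub_iff_add_eq_add] at h7
  rw [sub_eq_sub_iff_add_eq_add, add_comm, ← h7, add_comm]

/-- A function is a primitive as soon as it is one on each piece of a finite closed cover by
locally path-connected pieces. -/
theorem isPrimitive_of_closed_cover (hX : HasSimplyConnectedNhds X) {ι : Type*} [Finite ι]
    {W : ι → Type*} [∀ i, TopologicalSpace (W i)] [∀ i, LocallyPathConnectedSpace (W i)]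
    (e : ∀ i, C(W i, X)) (he : ∀ i, IsClosedMap (e i)) (hcov : ∀ x, ∃ i w, e i w = x)
    {h : X → A} (hh : ∀ i, (c.comap (e i)).IsPrimitive (h ∘ e i)) : c.IsPrimitive h :=
  isPrimitive_comap_of_closed_cover hX e he hh (ContinuousMap.id X) hcov

end PathCocycle

/-! ### Singular one-cochains as path cocycles -/

section SingularCochains

open Limits Simplicial

variable (X : Type u) [TopologicalSpace X]

/-- The coefficient module `ℤ` in the universe of the space. -/
noncomputable abbrev integerCoeff : ModuleCat.{u} ℤ := ModuleCat.of ℤ (ULift.{u} ℤ)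

/-- The singular simplicial set of a space. -/
noncomputable abbrev singularSet : SSet.{u} := TopCat.toSSet.obj (TopCat.of X)

/-- The integral singular chain complex; its first homology is `firstHomology X` by definition. -/
noncomputable abbrev singularComplex : ChainComplex (ModuleCat.{u} ℤ) ℕ :=
  (singularSet X).chainComplex integerCoeff.{u}

variable {X}

/-- The element of the singular set given by a continuous map from the standard simplex. -/
noncomputable def simplexOf {n : ℕ} (F : C(stdSimplex ℝ (Fin (n + 1)), X)) :
    (singularSet X) _⦋n⦌ :=
  ((TopCat.of X).toSSetObjEquiv (.op ⦋n⦌)).symm F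

/-- The generator of the singular chains given by a continuous map from the standard simplex. -/
noncomputable def chainOf {n : ℕ} (F : C(stdSimplex ℝ (Fin (n + 1)), X)) :
    (singularComplex X).X n :=
  ((singularSet X).ιChainComplex (R := integerCoeff.{u}) (simplexOf F)).hom (ULift.up 1)

theorem simplexOf_surjective {n : ℕ} :
    Function.Surjective (simplexOf : C(stdSimplex ℝ (Fin (n + 1)), X) → _) :=
  ((TopCat.of X).toSSetObjEquiv (.op ⦋n⦌)).symm.surjective

/-- The inclusion of the `i`-th face of the standard simplex. -/
noncomputable def faceMap {n : ℕ} (i : Fin (n + 2)) :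
    C(stdSimplex ℝ (Fin (n + 1)), stdSimplex ℝ (Fin (n + 2))) :=
  ⟨stdSimplex.map (Fin.succAbove i), stdSimplex.continuous_map _⟩

theorem d_chainOf {n : ℕ} (F : C(stdSimplex ℝ (Fin (n + 2)), X)) :
    ((singularComplex X).d (n + 1) n).hom (chainOf F) =
      ∑ i : Fin (n + 2), (-1 : ℤ) ^ (i : ℕ) • chainOf (F.comp (faceMap i)) := by
  have h1 (i : Fin (n + 2)) :
      (singularSet X).δ i (simplexOf F) = simplexOf (F.comp (faceMap i)) := rfl
  have h2 := SSet.ιChainComplex_d (singularSet X) integerCoeff (simplexOf F)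
  have h3 := congrArg (fun f => f.hom (ULift.up 1)) h2
  simp only [h1, ModuleCat.hom_sum, ModuleCat.hom_comp, LinearMap.comp_apply,
    LinearMap.sum_apply] at h3
  exact h3

/-- The singular chain module is generated by the singular simplices. -/
theorem linearMap_eq_zero_of_chainOf {n : ℕ} {φ : (singularComplex X).X n →ₗ[ℤ] ℚ}
    (h : ∀ F, φ (chainOf F) = 0) : φ = 0 := by
  have h : ModuleCat.ofHom ((ULift.moduleEquiv (R := ℤ) (M := ℚ)).symm.toLinearMap ∘ₗ φ) =
      (0 : _ ⟶ ModuleCat.of ℤ (ULift.{u} ℚ)) := by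
    refine SSet.chainComplex_hom_ext fun x => ?_
    obtain ⟨F, rfl⟩ := simplexOf_surjective x
    ext ⟨a⟩
    have : (ULift.up a : ULift.{u} ℤ) = a • ULift.up 1 := by ext; simp
    rw [this, map_smul, map_smul]
    have h0 : (ConcreteCategory.hom ((singularSet X).ιChainComplex (R := integerCoeff.{u})
      (simplexOf F))) (ULift.up 1) = chainOf F := rfl
    simp [h0, h F]
  have h2 := congrArg ModuleCat.Hom.hom h
  ext x
  have h3 := LinearMap.congr_fun h2 x
  exact congrArg ULift.down h3

/-- The singular chain module is free on the singular simplices. -/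
theorem exists_linearMap_chainOf {n : ℕ} (h : C(stdSimplex ℝ (Fin (n + 1)), X) → ℚ) :
    ∃ φ : (singularComplex X).X n →ₗ[ℤ] ℚ, ∀ F, φ (chainOf F) = h F := by
  let T : ModuleCat.{u} ℤ := ModuleCat.of ℤ (ULift.{u} ℚ)
  let j (x : (singularSet X) _⦋n⦌) : integerCoeff.{u} ⟶ T := ModuleCat.ofHom
    ((LinearMap.toSpanSingleton ℤ (ULift.{u} ℚ)
      (ULift.up (h ((TopCat.of X).toSSetObjEquiv (.op ⦋n⦌) x)))).comp
        (ULift.moduleEquiv (R := ℤ) (M := ℤ)).toLinearMap)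
  let φ : (singularComplex X).X n ⟶ T := Sigma.desc j
  have hφ (x) : (singularSet X).ιChainComplex x ≫ φ = j x := Sigma.ι_desc _ _
  refine ⟨(ULift.moduleEquiv (R := ℤ) (M := ℚ)).toLinearMap ∘ₗ φ.hom, fun F => ?_⟩
  have := congrArg (fun f => f.hom (ULift.up 1)) (hφ (simplexOf F))
  simp only [ModuleCat.hom_comp, LinearMap.comp_apply] at this
  simp only [LinearMap.comp_apply, chainOf]
  erw [this]
  simp [j, simplexOf]

variable (X) in
/-- The singular one-cocycles with rational values, as a rational vector space. -/
def rationalCocycles : Submodule ℚ ((singularComplex X).X 1 →ₗ[ℤ] ℚ) where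
  carrier := {φ | ∀ x, φ (((singularComplex X).d 2 1).hom x) = 0}
  add_mem' h1 h2 x := by simp [h1 x, h2 x]
  zero_mem' x := rfl
  smul_mem' a φ h x := by simp [h x]

theorem mem_rationalCocycles_iff {φ : (singularComplex X).X 1 →ₗ[ℤ] ℚ} :
    φ ∈ rationalCocycles X ↔ ∀ F : C(stdSimplex ℝ (Fin 3), X),
      φ (chainOf (F.comp (faceMap 0))) - φ (chainOf (F.comp (faceMap 1))) +
        φ (chainOf (F.comp (faceMap 2))) = 0 := by
  have key (F : C(stdSimplex ℝ (Fin 3), X)) :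
      φ (((singularComplex X).d 2 1).hom (chainOf F)) =
      φ (chainOf (F.comp (faceMap 0))) - φ (chainOf (F.comp (faceMap 1))) +
        φ (chainOf (F.comp (faceMap 2))) := by
    rw [d_chainOf, map_sum, Fin.sum_univ_three]
    simp [sub_eq_add_neg]
  constructor
  · intro h F
    rw [← key, h]
  · intro h
    have : φ ∘ₗ ((singularComplex X).d 2 1).hom = 0 :=
      linearMap_eq_zero_of_chainOf fun F => (key F).trans (h F)
    exact fun x => LinearMap.congr_fun this x

/-- The coordinate `s ↦ s 1`, identifying the standard one-simplex with the unit interval. -/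
noncomputable def edgeParam : C(stdSimplex ℝ (Fin 2), unitInterval) :=
  ⟨fun s => ⟨s 1, stdSimplex.zero_le s 1, stdSimplex.le_one s 1⟩, by
    refine Continuous.subtype_mk ?_ _
    exact (continuous_apply 1).comp continuous_subtype_val⟩

/-- The singular one-chain of a map from the unit interval. -/
noncomputable def edgeChain (f : C(I, X)) : (singularComplex X).X 1 := chainOf (f.comp edgeParam)

theorem faceMap_apply {n : ℕ} (i : Fin (n + 2)) (s : stdSimplex ℝ (Fin (n + 1)))
    (j : Fin (n + 1)) : faceMap i s (i.succAbove j) = s j := by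
  change (stdSimplex.map (Fin.succAbove i) s) (i.succAbove j) = s j
  rw [stdSimplex.map_coe, FunOnFinite.linearMap_apply_apply]
  simp [Finset.filter_eq', (Fin.succAbove_right_injective).eq_iff]

theorem faceMap_apply_self {n : ℕ} (i : Fin (n + 2)) (s : stdSimplex ℝ (Fin (n + 1))) :
    faceMap i s i = 0 := by
  change (stdSimplex.map (Fin.succAbove i) s) i = 0
  rw [stdSimplex.map_coe, FunOnFinite.linearMap_apply_apply]
  simp [Fin.succAbove_ne]

theorem faceMap_zero (s : stdSimplex ℝ (Fin 2)) :
    faceMap 0 s 1 = 1 - s 1 ∧ faceMap 0 s 2 = s 1 := by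
  have h := stdSimplex.add_eq_one s
  exact ⟨(faceMap_apply 0 s 0).trans (by linarith), faceMap_apply 0 s 1⟩

theorem faceMap_one (s : stdSimplex ℝ (Fin 2)) :
    faceMap 1 s 1 = 0 ∧ faceMap 1 s 2 = s 1 :=
  ⟨faceMap_apply_self 1 s, faceMap_apply 1 s 1⟩

theorem faceMap_two (s : stdSimplex ℝ (Fin 2)) :
    faceMap 2 s 1 = s 1 ∧ faceMap 2 s 2 = 0 :=
  ⟨faceMap_apply 2 s 1, faceMap_apply_self 2 s⟩

/-- The cocycle condition for a triangle written in the two last barycentric coordinates. -/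
theorem apply_triangle {φ : (singularComplex X).X 1 →ₗ[ℤ] ℚ} (hφ : φ ∈ rationalCocycles X)
    {G : ℝ → ℝ → X} (hG : Continuous (Function.uncurry G)) {f₀ f₁ f₂ : C(I, X)}
    (h₀ : ∀ t : I, f₀ t = G (1 - t) t) (h₁ : ∀ t : I, f₁ t = G 0 t) (h₂ : ∀ t : I, f₂ t = G t 0) :
    φ (edgeChain f₁) = φ (edgeChain f₂) + φ (edgeChain f₀) := by
  let F : C(stdSimplex ℝ (Fin 3), X) := ⟨fun s => G (s 1) (s 2), by
    have e (i : Fin 3) : Continuous fun s : stdSimplex ℝ (Fin 3) => s i :=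
      (continuous_apply i).comp continuous_subtype_val
    exact hG.comp ((e 1).prodMk (e 2))⟩
  have := mem_rationalCocycles_iff.1 hφ F
  have e0 : F.comp (faceMap 0) = f₀.comp edgeParam := by
    ext s
    change G (faceMap 0 s 1) (faceMap 0 s 2) = f₀ (edgeParam s)
    rw [(faceMap_zero s).1, (faceMap_zero s).2, h₀]
    rfl
  have e1 : F.comp (faceMap 1) = f₁.comp edgeParam := by
    ext s
    change G (faceMap 1 s 1) (faceMap 1 s 2) = f₁ (edgeParam s)
    rw [(faceMap_one s).1, (faceMap_one s).2, h₁]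
    rfl
  have e2 : F.comp (faceMap 2) = f₂.comp edgeParam := by
    ext s
    change G (faceMap 2 s 1) (faceMap 2 s 2) = f₂ (edgeParam s)
    rw [(faceMap_two s).1, (faceMap_two s).2, h₂]
    rfl
  rw [e0, e1, e2] at this
  rw [edgeChain, edgeChain, edgeChain]
  linarith

/-- A singular one-cocycle, restricted to paths, is homotopy invariant and additive. -/
noncomputable def cocycleOnPaths (φ : rationalCocycles X) : PathCocycle X ℚ where
  val p := φ.1 (edgeChain p)
  val_eq_of_homotopic := by
    rintro x y p q ⟨H⟩
    have hconst (x : X) : φ.1 (edgeChain (.const I x)) = 0 := by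
      have := apply_triangle φ.2 (G := fun _ _ => x) (f₀ := .const I x) (f₁ := .const I x)
        (f₂ := .const I x) (by fun_prop) (by simp) (by simp) (by simp)
      linarith
    let pr : ℝ → I := projIcc 0 1 zero_le_one
    have hpr : Continuous pr := continuous_projIcc
    have pr_coe (t : I) : pr t = t := projIcc_val _ t
    have pr0 : pr 0 = 0 := pr_coe 0
    have pr1 : pr 1 = 1 := pr_coe 1
    -- The diagonal cuts the square of the homotopy into two triangles.
    let D : C(I, X) := ⟨fun t => H (t, t), by fun_prop⟩
    have h1 := apply_triangle φ.2 (G := fun a b => H (pr b, pr (a + b))) (f₀ := .const I y)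
      (f₁ := D) (f₂ := p) (by fun_prop) (by simp [pr1]) (by simp [D, pr_coe])
      (by simp [pr_coe, pr0])
    have h2 := apply_triangle φ.2 (G := fun a b => H (pr (a + b), pr b)) (f₀ := q)
      (f₁ := D) (f₂ := .const I x) (by fun_prop) (by simp [pr1, pr_coe]) (by simp [D, pr_coe])
      (by simp [pr_coe, pr0])
    rw [hconst] at h1 h2
    change φ.1 (edgeChain (p : C(I, X))) = φ.1 (edgeChain (q : C(I, X)))
    linarith
  val_trans := by
    intro x y z p q
    -- The triangle is projected to its long edge, whose midpoint is the image of a vertex.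
    refine apply_triangle φ.2 (G := fun a b => (p.trans q).extend (a / 2 + b)) ?_ ?_ ?_ ?_
    · fun_prop
    · intro t
      have h := t.2
      simp only [ContinuousMap.coe_coe]
      rw [Path.extend_apply _ (by constructor <;> linarith [h.1, h.2] ), Path.trans_apply]
      split_ifs with h1
      · have : (t : ℝ) = 0 := by simp only at h1; linarith [h.1]
        have ht : t = 0 := Subtype.ext this
        subst ht
        simp
      · simp only
        congr 1; ext; simp; ring
    · intro t
      simp
    · intro t
      have h := t.2
      simp only [ContinuousMap.coe_coe]
      rw [Path.extend_apply _ (by constructor <;> linarith [h.1, h.2] ), Path.trans_apply]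
      split_ifs with h1
      · congr 1; ext; simp; ring
      · exact absurd (by simp; linarith [h.2]) h1

theorem cocycleOnPaths_val (φ : rationalCocycles X) {x y : X} (p : Path x y) :
    (cocycleOnPaths φ).val p = φ.1 (edgeChain p) := rfl

/-- A cocycle that has a primitive vanishes on the singular one-cycles. -/
theorem apply_eq_zero_of_isPrimitive {φ : rationalCocycles X} {h : X → ℚ}
    (hφ : (cocycleOnPaths φ).IsPrimitive h) {z : (singularComplex X).X 1}
    (hz : ((singularComplex X).d 1 0).hom z = 0) : φ.1 z = 0 := by
  obtain ⟨η, hη⟩ := exists_linearMap_chainOf (X := X) (n := 0) fun F => h (F (stdSimplex.vertex 0))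
  have key : φ.1 - η ∘ₗ ((singularComplex X).d 1 0).hom = 0 := by
    refine linearMap_eq_zero_of_chainOf fun F => ?_
    rw [LinearMap.sub_apply, LinearMap.comp_apply, d_chainOf, Fin.sum_univ_two]
    let e : C(I, stdSimplex ℝ (Fin 2)) := ⟨fun t => ⟨![1 - t, t], by
      have := t.2
      constructor
      · intro i; fin_cases i <;> simp [this.1, this.2]
      · simp⟩, by
      refine Continuous.subtype_mk ?_ _
      refine continuous_pi fun i => ?_
      fin_cases i <;> simp <;> fun_prop⟩
    let p : Path (F (e 0)) (F (e 1)) := ⟨F.comp e, rfl, rfl⟩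
    have h1 : F = (p : C(I, X)).comp edgeParam := by
      ext s
      change F s = F (e (edgeParam s))
      congr 1
      ext i
      have := stdSimplex.add_eq_one s
      fin_cases i
      · change s 0 = 1 - s 1; linarith
      · rfl
    have h2 : φ.1 (chainOf F) = h (F (e 1)) - h (F (e 0)) := by
      rw [← hφ p, cocycleOnPaths_val, edgeChain, ← h1]
    have h3 (s : stdSimplex ℝ (Fin 2)) (i : Fin 2) (hs : s i = 0) :
        s = faceMap i (stdSimplex.vertex 0) := by
      ext j
      by_cases hij : j = i
      · subst hij; rw [faceMap_apply_self, hs]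
      · obtain ⟨k, rfl⟩ := Fin.exists_succAbove_eq hij
        rw [faceMap_apply]
        have := stdSimplex.add_eq_one s
        have hk : k = 0 := Subsingleton.elim _ _
        subst hk
        fin_cases i <;> simp_all
    have h4 : e 1 = faceMap 0 (stdSimplex.vertex 0) :=
      h3 _ _ (by change (1 : ℝ) - (1 : I) = 0; simp)
    have h5 : e 0 = faceMap 1 (stdSimplex.vertex 0) := h3 _ _ (by change ((0 : I) : ℝ) = 0; simp)
    rw [h2, map_add, map_zsmul, map_zsmul, hη, hη, h4, h5]
    simp only [ContinuousMap.comp_apply]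
    simp
    ring
  have := LinearMap.congr_fun key z
  simpa [hz] using this

/-- The rank of the first homology is at most the dimension of any space of linear invariants of
rational cocycles whose vanishing forces the existence of a primitive. -/
theorem rank_firstHomology_le {U : Type*} [AddCommGroup U] [Module ℚ U] [FiniteDimensional ℚ U]
    (Φ : rationalCocycles X →ₗ[ℚ] U)
    (hΦ : ∀ φ, Φ φ = 0 → ∃ h, (cocycleOnPaths φ).IsPrimitive h) :
    Module.rank ℤ (firstHomology X) ≤ (Module.finrank ℚ U : ℕ) := by
  refine rank_le fun s hs => ?_
  let C := singularComplex X
  let ι := (C.homologyι 1).hom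
  have hι : Function.Injective ι := (ModuleCat.mono_iff_injective _).1 inferInstance
  have hs' : LinearIndependent ℤ fun i : s => ι i.1 :=
    hs.map' ι (LinearMap.ker_eq_bot.2 hι)
  have hz (i : s) : ∃ z : C.X 1, (C.d 1 0).hom z = 0 ∧ (C.pOpcycles 1).hom z = ι i.1 := by
    have hπ : Function.Surjective (C.homologyπ 1).hom :=
      (ModuleCat.epi_iff_surjective _).1 inferInstance
    obtain ⟨y, hy⟩ := hπ i.1
    refine ⟨(C.iCycles 1).hom y, ?_, ?_⟩
    · have := congrArg (fun f => f.hom y) (C.iCycles_d 1 0)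
      simpa only [ModuleCat.hom_comp, LinearMap.comp_apply, ModuleCat.hom_zero,
        LinearMap.zero_apply] using this
    · have := congrArg (fun f => f.hom y) (C.homology_π_ι 1)
      simp only [ModuleCat.hom_comp, LinearMap.comp_apply] at this
      rw [← this, hy]
  choose z hz0 hz using hz
  -- Independent classes are separated by cocycles, since `ℚ` is an injective `ℤ`-module.
  let ev : rationalCocycles X →ₗ[ℚ] (s → ℚ) :=
    { toFun := fun φ i => φ.1 (z i), map_add' := fun _ _ => rfl, map_smul' := fun _ _ => rfl }
  have hev : Function.Surjective ev := by
    intro f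
    let g := (Finsupp.lift ℚ ℤ s f) ∘ₗ hs'.repr
    obtain ⟨ψ', hψ'⟩ := (Module.Baer.of_divisible ℚ).extension_property_addMonoidHom
      (Submodule.span ℤ (range fun i : s => ι i.1)).subtype.toAddMonoidHom
      (Submodule.subtype_injective _) g.toAddMonoidHom
    let ψ : C.opcycles 1 →ₗ[ℤ] ℚ :=
      ⟨⟨ψ', ψ'.map_add⟩, fun n x => map_intCast_smul ψ' ℤ ℤ n x⟩
    refine ⟨⟨ψ ∘ₗ (C.pOpcycles 1).hom, fun x => ?_⟩, ?_⟩
    · have := congrArg (fun f => f.hom x) (C.d_pOpcycles 2 1)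
      simp only [ModuleCat.hom_comp, LinearMap.comp_apply] at this
      rw [LinearMap.comp_apply, this]
      simp
    · ext i
      change ψ ((C.pOpcycles 1).hom (z i)) = f i
      rw [hz]
      have h1 := DFunLike.congr_fun hψ' ⟨ι i.1, Submodule.subset_span ⟨i, rfl⟩⟩
      refine h1.trans ?_
      change (Finsupp.lift ℚ ℤ s f) (hs'.repr _) = f i
      rw [hs'.repr_eq_single i _ rfl]
      simp
  -- Evaluation factors through the invariants, as a cocycle with a primitive vanishes on cycles.
  have hker : LinearMap.ker Φ ≤ LinearMap.ker ev := by
    intro φ hφ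
    obtain ⟨h, hh⟩ := hΦ φ hφ
    ext i
    exact apply_eq_zero_of_isPrimitive hh (hz0 i)
  have hsurj : Function.Surjective ((LinearMap.ker Φ).liftQ ev hker) := by
    intro f
    obtain ⟨φ, rfl⟩ := hev f
    exact ⟨Submodule.Quotient.mk φ, rfl⟩
  have e := Φ.quotKerEquivRange
  have : FiniteDimensional ℚ (_ ⧸ LinearMap.ker Φ) := e.symm.finiteDimensional
  have h1 := LinearMap.finrank_le_finrank_of_surjective hsurj
  have h2 : Module.finrank ℚ (_ ⧸ LinearMap.ker Φ) ≤ Module.finrank ℚ U :=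
    e.finrank_eq.trans_le (Submodule.finrank_le _)
  simpa using h1.trans h2

end SingularCochains

/-! ### The monodromy of the irregular dihedral cover -/

section Monodromy

open DihedralGroup

theorem ZMod.two_mul_half {p : ℕ} (hp : Odd p) :
    (2 : ZMod p) * (((p + 1) / 2 : ℕ) : ZMod p) = 1 := by
  have h : 2 * ((p + 1) / 2) = p + 1 := by obtain ⟨k, rfl⟩ := hp; omega
  have := congrArg (Nat.cast (R := ZMod p)) h
  push_cast at this
  simpa using this

/-- A subgroup of order two of a dihedral group `DihedralGroup p` with `p` odd is generated by a
reflection. -/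
theorem DihedralGroup.mem_of_card_eq_two {p : ℕ} (hp : Odd p) {C : Subgroup (DihedralGroup p)}
    (hC : Nat.card C = 2) : ∃ j : ZMod p, (∀ i, r i ∈ C ↔ i = 0) ∧ ∀ k, sr k ∈ C ↔ k = j := by
  have hr (i : ZMod p) (hi : r i ∈ C) : i = 0 := by
    have h := pow_card_eq_one' (x := (⟨r i, hi⟩ : C))
    rw [hC] at h
    have h2 : r i ^ 2 = 1 := congrArg Subtype.val h
    rw [r_pow, one_def] at h2
    injection h2 with h3
    have h4 := ZMod.two_mul_half hp
    calc i = i * (2 * (((p + 1) / 2 : ℕ) : ZMod p)) := by rw [h4, mul_one]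
      _ = (i * ((2 : ℕ) : ZMod p)) * (((p + 1) / 2 : ℕ) : ZMod p) := by push_cast; ring
      _ = 0 := by rw [h3, zero_mul]
  have hne : C ≠ ⊥ := by
    rintro rfl
    simp at hC
  obtain ⟨c, hc, hc1⟩ := C.bot_or_exists_ne_one.resolve_left hne
  obtain ⟨j, rfl⟩ : ∃ j, c = sr j := by
    cases c with
    | r i => exact absurd (by rw [hr i hc, ← one_def]) hc1
    | sr j => exact ⟨j, rfl⟩
  refine ⟨j, fun i => ⟨hr i, ?_⟩, fun k => ⟨fun hk => ?_, ?_⟩⟩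
  · rintro rfl; exact C.one_mem
  · have := C.mul_mem hc hk
    rw [sr_mul_sr] at this
    exact sub_eq_zero.1 (hr _ this)
  · rintro rfl; exact hc

variable {E X : Type*} [TopologicalSpace E] [TopologicalSpace X] {q : E → X}
  (cov : IsCoveringMap q)

/-- The stabiliser of a point of a fibre is the image of the fundamental group of the cover. -/
theorem IsCoveringMap.monodromyPerm_apply_eq_iff {x₀ : X} (x : E) (hx : q x = x₀)
    (γ : FundamentalGroup X x₀) :
    cov.monodromyPerm x₀ γ ⟨x, hx⟩ = ⟨x, hx⟩ ↔
      γ ∈ (FundamentalGroup.mapOfEq ⟨q, cov.continuous⟩ hx).range := by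
  subst hx
  have key (γ : Path.Homotopic.Quotient (q x) (q x)) : cov.monodromy γ ⟨x, rfl⟩ = ⟨x, rfl⟩ ↔
      ∃ Γ : Path.Homotopic.Quotient x x, Γ.map ⟨q, cov.continuous⟩ = γ := by
    constructor
    · intro h1
      refine ⟨(cov.liftPathQuotient γ ⟨x, rfl⟩).cast rfl (congrArg Subtype.val h1).symm, ?_⟩
      rw [Path.Homotopic.Quotient.map_cast, cov.map_liftPathQuotient γ ⟨x, rfl⟩]
      exact (Path.Homotopic.Quotient.cast_cast _ _ _ _ _).trans
        (Path.Homotopic.Quotient.cast_rfl_rfl _)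
    · rintro ⟨Γ, rfl⟩
      exact cov.monodromy_map Γ
  have hmap (Γ : FundamentalGroup E x) :
      FundamentalGroup.mapOfEq ⟨q, cov.continuous⟩ rfl Γ =
        Path.Homotopic.Quotient.map Γ ⟨q, cov.continuous⟩ := by
    rw [FundamentalGroup.mapOfEq_apply]
    exact Path.Homotopic.Quotient.cast_rfl_rfl _
  refine (key γ).trans ⟨fun ⟨Γ, hΓ⟩ => ⟨Γ, (hmap Γ).trans hΓ⟩,
    fun ⟨Γ, hΓ⟩ => ⟨Γ, (hmap Γ).symm.trans hΓ⟩⟩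

theorem IsCoveringMap.exists_monodromyPerm_eq [PathConnectedSpace E] {x₀ : X}
    (e e' : q ⁻¹' {x₀}) : ∃ γ, cov.monodromyPerm x₀ γ e = e' := by
  obtain ⟨x, rfl⟩ := e
  obtain ⟨y, hy⟩ := e'
  have hy' : q y = q x := hy
  let Γ : Path.Homotopic.Quotient x y := .mk (PathConnectedSpace.somePath x y)
  have h : cov.monodromy ((Γ.map ⟨q, cov.continuous⟩).cast rfl hy'.symm) ⟨x, rfl⟩ = ⟨y, hy⟩ := by
    refine cov.monodromy_eq_of_map_eq (ex := ⟨x, rfl⟩) (ey := ⟨y, hy⟩) Γ ?_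
    exact ((Path.Homotopic.Quotient.cast_cast _ _ _ _ _).trans
      (Path.Homotopic.Quotient.cast_rfl_rfl _)).symm
  exact ⟨FundamentalGroup.fromPath ((Γ.map ⟨q, cov.continuous⟩).cast rfl hy'.symm), h⟩

variable [PathConnectedSpace E] {p : ℕ} {x₀ : X} {ρ : FundamentalGroup X x₀ →* DihedralGroup p}
  {C : Subgroup (DihedralGroup p)} {x : E} {hx : q x = x₀}

include cov in
/-- The fibre of the cover of `C.comap ρ` has `p` points; a loop mapped to a reflection acts on it
as an involution with a single fixed point. -/
theorem IsCoveringMap.dihedral_monodromy (hp : Odd p) (hρ : Function.Surjective ρ)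
    (hC : Nat.card C = 2)
    (hrange : (FundamentalGroup.mapOfEq ⟨q, cov.continuous⟩ hx).range = C.comap ρ) :
    Nat.card (q ⁻¹' {x₀}) = p ∧ ∀ γ l, ρ γ = sr l →
      (∀ e, cov.monodromyPerm x₀ γ (cov.monodromyPerm x₀ γ e) = e) ∧
        ∃! e, cov.monodromyPerm x₀ γ e = e := by
  obtain ⟨j, hr, hs⟩ := mem_of_card_eq_two hp hC
  have hstab (γ : FundamentalGroup X x₀) :
      cov.monodromyPerm x₀ γ ⟨x, hx⟩ = ⟨x, hx⟩ ↔ ρ γ ∈ C := by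
    rw [cov.monodromyPerm_apply_eq_iff, hrange, Subgroup.mem_comap]
  have heq (γ γ' : FundamentalGroup X x₀) :
      cov.monodromyPerm x₀ γ ⟨x, hx⟩ = cov.monodromyPerm x₀ γ' ⟨x, hx⟩ ↔
        (ρ γ')⁻¹ * ρ γ ∈ C := by
    rw [← map_inv, ← map_mul, ← hstab, map_mul, map_inv, Equiv.Perm.mul_apply,
      Equiv.Perm.inv_eq_iff_eq, eq_comm]
  -- The rotations represent the cosets of `C`, hence they parametrise the fibre.
  choose γ' hγ' using fun i : ZMod p => hρ (r i)
  let b (i : ZMod p) : q ⁻¹' {x₀} := cov.monodromyPerm x₀ (γ' i) ⟨x, hx⟩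
  have hb : Function.Bijective b := by
    constructor
    · intro i k h
      have := (heq _ _).1 h
      rw [hγ', hγ', inv_r, r_mul_r, hr] at this
      linear_combination this
    · intro e
      obtain ⟨γ, rfl⟩ := cov.exists_monodromyPerm_eq ⟨x, hx⟩ e
      cases hg : ρ γ with
      | r i => exact ⟨i, (heq _ _).2 (by rw [hγ', hg, inv_r, r_mul_r, hr]; ring)⟩
      | sr k => exact ⟨j - k, (heq _ _).2 (by rw [hγ', hg, inv_sr, sr_mul_r, hs]; ring)⟩
  refine ⟨?_, fun γ l hγ => ⟨fun e => ?_, ?_⟩⟩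
  · rw [← Nat.card_eq_of_bijective b hb, Nat.card_zmod]
  · obtain ⟨δ, rfl⟩ := cov.exists_monodromyPerm_eq ⟨x, hx⟩ e
    rw [← Equiv.Perm.mul_apply, ← Equiv.Perm.mul_apply, ← map_mul, ← map_mul, heq, map_mul, map_mul,
      hγ, sr_mul_self, one_mul, inv_mul_cancel]
    exact C.one_mem
  · have key (i : ZMod p) : cov.monodromyPerm x₀ γ (b i) = b i ↔ l + 2 * i = j := by
      rw [← Equiv.Perm.mul_apply, ← map_mul, heq, map_mul, hγ, hγ', sr_mul_r, inv_r, r_mul_sr, hs]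
      constructor <;> intro h <;> linear_combination h
    refine ⟨b ((((p + 1) / 2 : ℕ) : ZMod p) * (j - l)), (key _).2 ?_, fun e he => ?_⟩
    · rw [← mul_assoc, ZMod.two_mul_half hp]; ring
    · obtain ⟨i, rfl⟩ := hb.2 e
      have := (key i).1 he
      congr 1
      linear_combination (((p + 1) / 2 : ℕ) : ZMod p) * this - i * ZMod.two_mul_half hp

/-- `IsCoveringMap.dihedral_monodromy` for a loop at another base point, moved to `x₀` along a
path. -/
theorem IsCoveringMap.dihedral_monodromy_of_path (hp : Odd p) (hρ : Function.Surjective ρ)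
    (hC : Nat.card C = 2)
    (hrange : (FundamentalGroup.mapOfEq ⟨q, cov.continuous⟩ hx).range = C.comap ρ)
    {b : X} (δ : Path.Homotopic.Quotient x₀ b) :
    Nat.card (q ⁻¹' {b}) = p ∧ ∀ (μ : Path.Homotopic.Quotient b b) l,
      ρ ((δ.trans μ).trans δ.symm) = sr l →
        (∀ e, cov.monodromy μ (cov.monodromy μ e) = e) ∧ ∃! e, cov.monodromy μ e = e := by
  obtain ⟨h1, h2⟩ := cov.dihedral_monodromy hp hρ hC hrange
  have hbij := cov.monodromy_bijective δ
  refine ⟨by rw [← h1, Nat.card_eq_of_bijective _ hbij], fun μ l hl => ?_⟩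
  obtain ⟨h3, e₀, h4, h5⟩ := h2 _ l hl
  have hinv (e) : cov.monodromy δ (cov.monodromy δ.symm e) = e := by
    rw [← cov.monodromy_trans_apply]
    have : δ.symm.trans δ = .refl b := by
      obtain ⟨δ⟩ := δ
      exact (Path.Homotopic.Quotient.eq.2 ⟨(Path.Homotopy.reflSymmTrans δ).symm⟩)
    rw [this, cov.monodromy_refl, id]
  have hconj (e) : cov.monodromy δ (cov.monodromyPerm x₀ ((δ.trans μ).trans δ.symm) e) =
      cov.monodromy μ (cov.monodromy δ e) := by
    rw [cov.coe_monodromyPerm, cov.monodromy_trans_apply, cov.monodromy_trans_apply, hinv]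
  refine ⟨fun e => ?_, cov.monodromy δ e₀, ?_, fun e he => ?_⟩
  · obtain ⟨e, rfl⟩ := hbij.2 e
    rw [← hconj, ← hconj, h3]
  · simp only
    rw [← hconj, h4]
  · obtain ⟨e, rfl⟩ := hbij.2 e
    rw [← hconj] at he
    rw [h5 e (hbij.1 he)]

end Monodromy

/-! ### Branched covers near the branch set -/

section LocalModel

variable {M Y : Type*} [TopologicalSpace M] [TopologicalSpace Y] {f : M → Y} {B : Set Y}

theorem isPreconnected_punctured_bidisc (r : ℝ) {t₀ : ℝ} (s : ℝ) :
    _root_.IsPreconnected {w : ℂ × ℝ | w.1 ≠ 0 ∧ ‖w.1‖ < r ∧ |w.2 - t₀| < s} := by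
  have h1 : _root_.IsPreconnected (Ioo 0 r ×ˢ (univ : Set ℝ) ×ˢ Metric.ball t₀ s) :=
    ((convex_Ioo 0 r).isPreconnected).prod (isPreconnected_univ.prod
      (convex_ball t₀ s).isPreconnected)
  convert h1.image (fun q : ℝ × ℝ × ℝ => ((q.1 : ℂ) * Complex.exp (q.2.1 * Complex.I), q.2.2))
    (Continuous.continuousOn (by fun_prop)) using 1
  ext ⟨z, t⟩
  constructor
  · rintro ⟨hz, hr, ht⟩
    exact ⟨(‖z‖, Complex.arg z, t), ⟨⟨norm_pos_iff.2 hz, hr⟩, trivial, ht⟩,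
      Prod.ext (Complex.norm_mul_exp_arg_mul_I z) rfl⟩
  · rintro ⟨⟨ρ, θ, t'⟩, ⟨⟨h1, h2⟩, -, h3⟩, h4⟩
    simp only [Prod.mk.injEq] at h4
    obtain ⟨rfl, rfl⟩ := h4
    simp only at h1 h2 h3
    refine ⟨by simp [h1.ne'], ?_, h3⟩
    simpa [Complex.norm_exp_ofReal_mul_I, abs_of_pos h1] using h2

/-- Near a point over the branch set `B`, the map is injective on the preimage of `B`. -/
theorem IsBranchedCover.exists_injOn (hf : IsBranchedCover f B) {x : M} (hx : f x ∈ B) :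
    ∃ V ∈ 𝓝 x, InjOn f (V ∩ f ⁻¹' B) := by
  obtain ⟨k, hk, φ, ψ, hxφ, hmaps, hB, hloc⟩ := hf.local_model x hx
  refine ⟨φ.source, φ.open_source.mem_nhds hxφ, ?_⟩
  rintro a ⟨ha, haB⟩ b ⟨hb, hbB⟩ hab
  have h1 (a : M) (ha : a ∈ φ.source) (haB : f a ∈ B) : (φ a).1 = 0 := by
    have := (hB _ (hmaps ha)).1 haB
    rw [hloc a ha] at this
    exact pow_eq_zero_iff (by omega) |>.1 this
  refine φ.injOn ha hb (Prod.ext ((h1 a ha haB).trans (h1 b hb hbB).symm) ?_)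
  have h2 := hloc a ha
  rw [hab, hloc b hb] at h2
  exact (congrArg Prod.snd h2).symm

/-- Near a point over the branch set, the branch set lifts. -/
theorem IsBranchedCover.image_mem_nhdsWithin (hf : IsBranchedCover f B) {x : M} (hx : f x ∈ B)
    {V : Set M} (hV : V ∈ 𝓝 x) : f '' (V ∩ f ⁻¹' B) ∈ 𝓝[B] (f x) := by
  obtain ⟨k, hk, φ, ψ, hxφ, hmaps, hB, hloc⟩ := hf.local_model x hx
  have hx0 : (ψ (f x)).1 = 0 := (hB _ (hmaps hxφ)).1 hx
  have hψ : ψ (f x) = φ x := by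
    rw [hloc x hxφ] at hx0 ⊢
    have h0 : (φ x).1 = 0 := pow_eq_zero_iff (by omega) |>.1 hx0
    exact Prod.ext (by simp only [h0]; exact zero_pow (by omega)) rfl
  have h1 : Tendsto ψ (𝓝 (f x)) (𝓝 (φ x)) := hψ ▸ ψ.continuousAt (hmaps hxφ)
  have h2 : Tendsto φ.symm (𝓝 (φ x)) (𝓝 x) := φ.tendsto_symm hxφ
  have h3 : ∀ᶠ a in 𝓝 (f x), a ∈ ψ.source ∧ ψ a ∈ φ.target ∧ φ.symm (ψ a) ∈ V :=
    Filter.Eventually.and (ψ.open_source.mem_nhds (hmaps hxφ))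
      (Filter.Eventually.and (h1 (φ.open_target.mem_nhds (φ.map_source hxφ))) ((h2.comp h1) hV))
  rw [mem_nhdsWithin_iff_eventually]
  filter_upwards [h3] with a ⟨ha1, ha2, ha3⟩ haB
  have h4 : φ.symm (ψ a) ∈ φ.source := φ.map_target ha2
  have h5 : f (φ.symm (ψ a)) = a := by
    refine ψ.injOn (hmaps h4) ha1 ?_
    rw [hloc _ h4, φ.right_inv ha2]
    have h0 : (ψ a).1 = 0 := (hB _ ha1).1 haB
    refine Prod.ext ?_ rfl
    simp only [h0]
    exact zero_pow (by omega)
  exact ⟨φ.symm (ψ a), ⟨ha3, by rwa [mem_preimage, h5]⟩, h5⟩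

/-- A point over the branch set has arbitrarily small neighbourhoods which stay connected when the
preimage of the branch set is removed. -/
theorem IsBranchedCover.exists_isPreconnected (hf : IsBranchedCover f B) {x : M} (hx : f x ∈ B)
    {V : Set M} (hV : V ∈ 𝓝 x) :
    ∃ V' ∈ 𝓝 x, V' ⊆ V ∧ _root_.IsPreconnected (V' ∩ f ⁻¹' Bᶜ) ∧ (V' ∩ f ⁻¹' Bᶜ).Nonempty := by
  obtain ⟨k, hk, φ, ψ, hxφ, hmaps, hB, hloc⟩ := hf.local_model x hx
  have hx0 : (φ x).1 = 0 := by
    have := (hB _ (hmaps hxφ)).1 hx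
    rw [hloc x hxφ] at this
    exact pow_eq_zero_iff (by omega) |>.1 this
  have h2 : Tendsto φ.symm (𝓝 (φ x)) (𝓝 x) := φ.tendsto_symm hxφ
  obtain ⟨r, hr, hball⟩ := Metric.mem_nhds_iff.1
    (inter_mem (φ.open_target.mem_nhds (φ.map_source hxφ)) (h2 hV))
  have hsub : Metric.ball (φ x) r ⊆ φ.target := fun w hw => (hball hw).1
  have hmem (w : ℂ × ℝ) : w ∈ Metric.ball (φ x) r ↔ ‖w.1‖ < r ∧ |w.2 - (φ x).2| < r := by
    rw [Metric.mem_ball, Prod.dist_eq, max_lt_iff, hx0, dist_zero_right, Real.dist_eq]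
  have himage : φ.symm '' Metric.ball (φ x) r ∩ f ⁻¹' Bᶜ =
      φ.symm '' {w | w.1 ≠ 0 ∧ ‖w.1‖ < r ∧ |w.2 - (φ x).2| < r} := by
    have key (w) (hw : w ∈ Metric.ball (φ x) r) : f (φ.symm w) ∈ B ↔ w.1 = 0 := by
      have h4 := φ.map_target (hsub hw)
      rw [hB _ (hmaps h4), hloc _ h4, φ.right_inv (hsub hw)]
      exact pow_eq_zero_iff (by omega)
    ext y
    constructor
    · rintro ⟨⟨w, hw, rfl⟩, hy⟩
      exact ⟨w, ⟨fun h0 => hy ((key w hw).2 h0), (hmem w).1 hw⟩, rfl⟩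
    · rintro ⟨w, ⟨hw0, hw⟩, rfl⟩
      exact ⟨⟨w, (hmem w).2 hw, rfl⟩, fun h => hw0 ((key w ((hmem w).2 hw)).1 h)⟩
  refine ⟨φ.symm '' Metric.ball (φ x) r, ?_, ?_, ?_, ?_⟩
  · exact (φ.symm.isOpen_image_of_subset_source Metric.isOpen_ball hsub).mem_nhds
      ⟨φ x, Metric.mem_ball_self hr, φ.left_inv hxφ⟩
  · rintro _ ⟨w, hw, rfl⟩
    exact (hball hw).2
  · rw [himage]
    refine (isPreconnected_punctured_bidisc r r).image _ (φ.symm.continuousOn.mono ?_)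
    rintro w ⟨-, hw⟩
    exact hsub ((hmem w).2 hw)
  · rw [himage]
    refine Nonempty.image _ ⟨(((r / 2 : ℝ) : ℂ), (φ x).2), ?_, ?_, ?_⟩
    · simp [hr.ne']
    · simp only [Complex.norm_real, Real.norm_eq_abs, abs_of_pos (half_pos hr)]
      linarith
    · simpa using hr

theorem IsBranchedCover.finite_fiber (hf : IsBranchedCover f B) (y : Y) :
    (f ⁻¹' {y}).Finite := by
  have hc : IsCompact (f ⁻¹' {y}) := hf.proper.isCompact_preimage isCompact_singleton
  refine hc.finite ?_
  by_cases hy : y ∈ B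
  · rw [isDiscrete_iff_discreteTopology, discreteTopology_iff_isOpen_singleton]
    rintro ⟨x, hx⟩
    obtain ⟨V, hV, hinj⟩ := hf.exists_injOn (x := x) (by rwa [show f x = y from hx])
    have h1 : Subtype.val ⁻¹' V ∈ 𝓝 (⟨x, hx⟩ : f ⁻¹' {y}) :=
      continuous_subtype_val.continuousAt hV
    have h2 : (Subtype.val ⁻¹' V : Set (f ⁻¹' {y})) ⊆ {⟨x, hx⟩} := by
      rintro ⟨x', hx'⟩ hV'
      refine Subtype.ext (hinj ⟨hV', ?_⟩ ⟨mem_of_mem_nhds hV, ?_⟩ ?_)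
      · rwa [mem_preimage, show f x' = y from hx']
      · rwa [mem_preimage, show f x = y from hx]
      · rw [show f x = y from hx, show f x' = y from hx']
    exact isOpen_singleton_iff_nhds_eq_pure _ |>.2 (le_antisymm
      (le_pure_iff.2 (mem_of_superset h1 h2)) (pure_le_nhds _))
  · exact ⟨(hf.covering y hy).discreteTopology_fiber⟩

theorem IsBranchedCover.compactSpace [CompactSpace Y] (hf : IsBranchedCover f B) :
    CompactSpace M :=
  ⟨by simpa using hf.proper.isCompact_preimage isCompact_univ⟩

theorem IsBranchedCover.hasSimplyConnectedNhds (hf : IsBranchedCover f B)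
    {E : Type*} [NormedAddCommGroup E] [NormedSpace ℝ E] [ChartedSpace E Y] :
    HasSimplyConnectedNhds M := by
  intro x
  by_cases hx : f x ∈ B
  · obtain ⟨k, hk, φ, ψ, hxφ, -⟩ := hf.local_model x hx
    obtain ⟨U, -, h⟩ := HasSimplyConnectedNhds.of_openPartialHomeomorph φ hxφ isOpen_univ trivial
    exact ⟨U, h⟩
  · obtain ⟨e, hxe, rfl⟩ := hf.covering.isLocalHomeomorphOn x hx
    obtain ⟨U, -, h⟩ := HasSimplyConnectedNhds.of_openPartialHomeomorph
      (x := x) (e.trans (chartAt E (e x))) (by simp [hxe]) isOpen_univ trivial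
    exact ⟨U, h⟩

theorem IsOpen.hasSimplyConnectedNhds {U : Set Y} (hU : IsOpen U)
    {E : Type*} [NormedAddCommGroup E] [NormedSpace ℝ E] [ChartedSpace E Y] :
    HasSimplyConnectedNhds U := by
  intro x
  obtain ⟨V, hVU, hV, hxV, h⟩ := HasSimplyConnectedNhds.of_openPartialHomeomorph
    (chartAt E (x : Y)) (mem_chart_source E _) hU x.2
  refine ⟨Subtype.val ⁻¹' V, hV.preimage continuous_subtype_val, hxV, ?_⟩
  let e : (Subtype.val ⁻¹' V : Set U) ≃ₜ V :=
    { toFun := fun y => ⟨y.1.1, y.2⟩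
      invFun := fun y => ⟨⟨y.1, hVU y.2⟩, y.2⟩
      left_inv := fun _ => rfl
      right_inv := fun _ => rfl
      continuous_toFun := by fun_prop
      continuous_invFun := by fun_prop }
  exact e.toHomotopyEquiv.simplyConnectedSpace

/-- A map into a branched cover has a limit at every point around which its domain stays connected,
as soon as its projection has one. -/
theorem IsBranchedCover.exists_tendsto [T2Space M] [T2Space Y] (hf : IsBranchedCover f B)
    {Z : Type*} [TopologicalSpace Z] {A : Set Z} {P : Z → M} (hP : ContinuousOn P A) {z : Z}
    (hz : z ∈ closure A) {y : Y} (hfP : Tendsto (f ∘ P) (𝓝[A] z) (𝓝 y))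
    (hconn : ∀ U ∈ 𝓝 z, ∃ V ∈ 𝓝 z, V ⊆ U ∧ _root_.IsPreconnected (V ∩ A)) :
    ∃ x, Tendsto P (𝓝[A] z) (𝓝 x) := by
  have hne : (𝓝[A] z).NeBot := mem_closure_iff_nhdsWithin_neBot.1 hz
  have hfin := hf.finite_fiber y
  obtain ⟨V, hV, hdisj⟩ := hfin.t2_separation
  -- Any choice of neighbourhoods of the points of the fibre eventually catches `P`.
  have hcatch (W : M → Set M) (hW : ∀ x ∈ f ⁻¹' {y}, W x ∈ 𝓝 x) :
      ∀ᶠ w in 𝓝[A] z, ∃ x ∈ f ⁻¹' {y}, P w ∈ W x := by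
    have h := hf.proper.isClosedMap.eventually_nhds_fiber (p := fun m => ∃ x ∈ f ⁻¹' {y}, m ∈ W x) y
      fun x hx => mem_of_superset (hW x hx) fun m hm => ⟨x, hx, hm⟩
    filter_upwards [hfP.eventually h] with w hw
    exact hw _ rfl
  have h0 := hcatch V fun x _ => (hV x).2.mem_nhds (hV x).1
  obtain ⟨U, hU, hU0⟩ := mem_nhdsWithin_iff_exists_mem_nhds_inter.1 h0
  obtain ⟨O, hO, hOU, hOc⟩ := hconn U hU
  have hOA : O ∩ A ∈ 𝓝[A] z := inter_mem (mem_nhdsWithin_of_mem_nhds hO) self_mem_nhdsWithin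
  obtain ⟨a, ha⟩ := hne.nonempty_of_mem hOA
  obtain ⟨x, hx, hax⟩ := hU0 ⟨hOU ha.1, ha.2⟩
  have hsub : P '' (O ∩ A) ⊆ V x := by
    refine (hOc.image P (hP.mono inter_subset_right)).subset_left_of_subset_union (hV x).2
      (v := ⋃ x' ∈ f ⁻¹' {y} \ {x}, V x') (isOpen_biUnion fun x' _ => (hV x').2) ?_ ?_
      ⟨P a, ⟨a, ha, rfl⟩, hax⟩
    · refine disjoint_iUnion₂_right.2 fun x' hx' => ?_
      exact hdisj hx hx'.1 (fun h => hx'.2 h.symm)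
    · rintro _ ⟨w, hw, rfl⟩
      obtain ⟨x', hx', hw'⟩ := hU0 ⟨hOU hw.1, hw.2⟩
      by_cases h : x' = x
      · exact Or.inl (h ▸ hw')
      · exact Or.inr (mem_biUnion (show x' ∈ f ⁻¹' {y} \ {x} from ⟨hx', h⟩) hw')
  refine ⟨x, fun N hN => ?_⟩
  classical
  have h1 := hcatch (fun x' => if x' = x then V x ∩ N else V x') fun x' hx' => by
    split_ifs with h
    · exact inter_mem ((hV x).2.mem_nhds (h ▸ (hV x).1)) (h ▸ hN)
    · exact (hV x').2.mem_nhds (hV x').1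
  rw [mem_map]
  filter_upwards [h1, hOA] with w ⟨x', hx', hw⟩ hwO
  split_ifs at hw with h
  · exact hw.2
  · exact absurd (hsub ⟨w, hwO, rfl⟩) (disjoint_left.1 (hdisj hx' hx h) hw)

end LocalModel

/-! ### Polar coordinates for the sup norm of the plane -/

section Polar

/-- The point of argument `θ` on the boundary of the square `[-1, 1]²`. -/
noncomputable def squareDir (θ : ℝ) : ℝ × ℝ :=
  ‖(Real.cos θ, Real.sin θ)‖⁻¹ • (Real.cos θ, Real.sin θ)

/-- The argument of a point of the plane. -/
noncomputable def planeArg (z : ℝ × ℝ) : ℝ := Complex.arg ⟨z.1, z.2⟩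

theorem cos_sin_ne_zero (θ : ℝ) : ((Real.cos θ, Real.sin θ) : ℝ × ℝ) ≠ 0 := by
  intro h
  have h1 := Real.cos_sq_add_sin_sq θ
  rw [show Real.cos θ = 0 from congrArg Prod.fst h, show Real.sin θ = 0 from congrArg Prod.snd h]
    at h1
  norm_num at h1

theorem norm_squareDir (θ : ℝ) : ‖squareDir θ‖ = 1 := by
  rw [squareDir, norm_smul, norm_inv, norm_norm, inv_mul_cancel₀]
  exact norm_ne_zero_iff.2 (cos_sin_ne_zero θ)

@[fun_prop]
theorem continuous_squareDir : Continuous squareDir := by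
  unfold squareDir
  have h : Continuous fun θ : ℝ => ((Real.cos θ, Real.sin θ) : ℝ × ℝ) := by fun_prop
  exact (h.norm.inv₀ fun θ => norm_ne_zero_iff.2 (cos_sin_ne_zero θ)).smul h

theorem squareDir_zero : squareDir 0 = (1, 0) := by
  simp [squareDir, Prod.norm_def]

theorem squareDir_add (θ : ℝ) (j : ℤ) : squareDir (θ + 2 * Real.pi * j) = squareDir θ := by
  rw [squareDir, squareDir, mul_comm _ (j : ℝ), Real.cos_add_int_mul_two_pi,
    Real.sin_add_int_mul_two_pi]

theorem squareDir_eq_iff {θ θ' : ℝ} :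
    squareDir θ = squareDir θ' ↔ ∃ j : ℤ, θ' = θ + 2 * Real.pi * j := by
  constructor
  · intro h
    set a := ‖(Real.cos θ, Real.sin θ)‖⁻¹ with ha
    set b := ‖(Real.cos θ', Real.sin θ')‖⁻¹ with hb
    have ha0 : 0 < a := inv_pos.2 (norm_pos_iff.2 (cos_sin_ne_zero θ))
    have hb0 : 0 < b := inv_pos.2 (norm_pos_iff.2 (cos_sin_ne_zero θ'))
    have h1 : a * Real.cos θ = b * Real.cos θ' := congrArg Prod.fst h
    have h2 : a * Real.sin θ = b * Real.sin θ' := congrArg Prod.snd h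
    have h3 : a ^ 2 = b ^ 2 := by
      have e1 := Real.cos_sq_add_sin_sq θ
      have e2 := Real.cos_sq_add_sin_sq θ'
      calc a ^ 2 = (a * Real.cos θ) ^ 2 + (a * Real.sin θ) ^ 2 := by linear_combination -a^2 * e1
        _ = b ^ 2 := by rw [h1, h2]; linear_combination b^2 * e2
    have h4 : a = b := (pow_left_inj₀ ha0.le hb0.le two_ne_zero).1 h3
    rw [h4] at h1 h2
    have h5 := Real.Angle.cos_sin_inj (mul_left_cancel₀ hb0.ne' h1) (mul_left_cancel₀ hb0.ne' h2)
    obtain ⟨k, hk⟩ := Real.Angle.angle_eq_iff_two_pi_dvd_sub.1 h5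
    exact ⟨-k, by push_cast; linarith⟩
  · rintro ⟨j, rfl⟩
    exact (squareDir_add θ j).symm

theorem norm_smul_squareDir_planeArg (z : ℝ × ℝ) : ‖z‖ • squareDir (planeArg z) = z := by
  rcases eq_or_ne z 0 with rfl | hz
  · simp
  set w : ℂ := ⟨z.1, z.2⟩ with hw
  have hw0 : w ≠ 0 := fun h => hz (Prod.ext (congrArg Complex.re h) (congrArg Complex.im h))
  have h1 : ‖w‖ * Real.cos (planeArg z) = z.1 := Complex.norm_mul_cos_arg w
  have h2 : ‖w‖ * Real.sin (planeArg z) = z.2 := Complex.norm_mul_sin_arg w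
  have h3 : z = ‖w‖ • ((Real.cos (planeArg z), Real.sin (planeArg z)) : ℝ × ℝ) :=
    Prod.ext h1.symm h2.symm
  have h4 : ‖z‖ = ‖w‖ * ‖((Real.cos (planeArg z), Real.sin (planeArg z)) : ℝ × ℝ)‖ := by
    conv_lhs => rw [h3]
    rw [norm_smul, norm_norm]
  rw [squareDir, smul_smul, h4, mul_assoc, mul_inv_cancel₀ (norm_ne_zero_iff.2 (cos_sin_ne_zero _)),
    mul_one, ← h3]

theorem squareDir_planeArg {z : ℝ × ℝ} (hz : z ≠ 0) : squareDir (planeArg z) = ‖z‖⁻¹ • z := by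
  conv_rhs => rw [← norm_smul_squareDir_planeArg z]
  rw [norm_smul, norm_squareDir, norm_norm, mul_one, smul_smul,
    inv_mul_cancel₀ (norm_ne_zero_iff.2 hz), one_smul]

theorem squareDir_add_pi (θ : ℝ) : squareDir (θ + Real.pi) = - squareDir θ := by
  have h : ((-Real.cos θ, -Real.sin θ) : ℝ × ℝ) = - (Real.cos θ, Real.sin θ) := rfl
  rw [squareDir, squareDir, Real.cos_add_pi, Real.sin_add_pi, h, norm_neg, smul_neg]

theorem exists_planeArg_smul_squareDir {r : ℝ} (hr : 0 < r) (θ : ℝ) :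
    ∃ j : ℤ, planeArg (r • squareDir θ) = θ + 2 * Real.pi * j := by
  refine squareDir_eq_iff.1 ?_
  have h0 : r • squareDir θ ≠ 0 := by
    rw [← norm_ne_zero_iff, norm_smul, norm_squareDir]
    simp [hr.ne']
  rw [squareDir_planeArg h0, norm_smul, norm_squareDir, Real.norm_eq_abs, abs_of_pos hr, mul_one,
    smul_smul, inv_mul_cancel₀ hr.ne', one_smul]

/-- Multiplication of the argument by `d`: the model of a `d`-fold branched cover of the square. -/
noncomputable def branchMap (d : ℕ) (z : ℝ × ℝ) : ℝ × ℝ := ‖z‖ • squareDir (d * planeArg z)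

theorem norm_branchMap (d : ℕ) (z : ℝ × ℝ) : ‖branchMap d z‖ = ‖z‖ := by
  rw [branchMap, norm_smul, norm_norm, norm_squareDir, mul_one]

theorem branchMap_eq_zero_iff {d : ℕ} {z : ℝ × ℝ} : branchMap d z = 0 ↔ z = 0 := by
  rw [← norm_eq_zero, norm_branchMap, norm_eq_zero]

theorem branchMap_smul (d : ℕ) {s : ℝ} (hs : 0 ≤ s) (z : ℝ × ℝ) :
    branchMap d (s • z) = s • branchMap d z := by
  rcases hs.eq_or_lt with rfl | hs
  · rw [zero_smul, zero_smul, branchMap_eq_zero_iff]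
  have h : planeArg (s • z) = planeArg z := by
    have : (⟨(s • z).1, (s • z).2⟩ : ℂ) = (s : ℂ) * ⟨z.1, z.2⟩ := by
      apply Complex.ext <;> simp
    rw [planeArg, this, Complex.arg_real_mul _ hs, planeArg]
  rw [branchMap, branchMap, h, norm_smul, Real.norm_eq_abs, abs_of_pos hs, smul_smul]

theorem branchMap_surjective {d : ℕ} (hd : 0 < d) (z : ℝ × ℝ) :
    ∃ z', branchMap d z' = z := by
  rcases eq_or_ne z 0 with rfl | hz
  · exact ⟨0, branchMap_eq_zero_iff.2 rfl⟩
  have hpos := norm_pos_iff.2 hz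
  obtain ⟨j, hj⟩ := exists_planeArg_smul_squareDir hpos (planeArg z / d)
  refine ⟨‖z‖ • squareDir (planeArg z / d), ?_⟩
  rw [branchMap, hj, norm_smul, norm_norm, norm_squareDir, mul_one]
  have hd' : (d : ℝ) ≠ 0 := by positivity
  have : (d : ℝ) * (planeArg z / d + 2 * Real.pi * j) =
      planeArg z + 2 * Real.pi * ((d * j : ℤ) : ℝ) := by
    push_cast; field_simp
  rw [this, squareDir_add, norm_smul_squareDir_planeArg]

end Polar

/-! ### Solid columns around an arc and their polar coordinates -/

/-- An embedded solid column `[-1, 1]² × [0, 1]` meeting `K` in its core `{0} × [0, 1]`, given as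
the restriction of a map defined on `(ℝ × ℝ) × ℝ`. -/
structure TangleColumn {Y : Type*} [TopologicalSpace Y] (K : Set Y) where
  /-- The parametrisation of the column. -/
  toFun : C((ℝ × ℝ) × ℝ, Y)
  injOn : InjOn toFun (Metric.closedBall 0 1 ×ˢ Icc 0 1)
  mem_iff : ∀ z t, ‖z‖ ≤ 1 → t ∈ Icc (0 : ℝ) 1 → (toFun (z, t) ∈ K ↔ z = 0)
  image_mem_nhds : ∀ t ∈ Ioo (0 : ℝ) 1,
    toFun '' (Metric.closedBall 0 1 ×ˢ Icc 0 1) ∈ 𝓝 (toFun (0, t))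

namespace TangleColumn

variable {Y : Type*} [TopologicalSpace Y] {K : Set Y} (H : TangleColumn K)

/-- The clamping of a real number to the unit interval. -/
noncomputable def clamp (t : ℝ) : ℝ := projIcc 0 1 zero_le_one t

@[fun_prop]
theorem continuous_clamp : Continuous clamp := continuous_subtype_val.comp continuous_projIcc

theorem clamp_mem (t : ℝ) : clamp t ∈ Icc (0 : ℝ) 1 := (projIcc 0 1 zero_le_one t).2

theorem clamp_of_mem {t : ℝ} (ht : t ∈ Icc (0 : ℝ) 1) : clamp t = t := by
  rw [clamp, projIcc_of_mem _ ht]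

/-- The universal cover of the column minus its core: the polar coordinates `(log r, θ, t)`. -/
noncomputable def polar : C(ℝ × ℝ × ℝ, Y) :=
  ⟨fun q => H.toFun (Real.exp (min q.1 0) • squareDir q.2.1, clamp q.2.2), by fun_prop⟩

theorem norm_exp_smul_squareDir (ρ θ : ℝ) : ‖Real.exp ρ • squareDir θ‖ = Real.exp ρ := by
  rw [norm_smul, norm_squareDir, mul_one, Real.norm_eq_abs, abs_of_pos (Real.exp_pos ρ)]

theorem polar_notMem (q : ℝ × ℝ × ℝ) : H.polar q ∈ Kᶜ := by
  have h : ‖Real.exp (min q.1 0) • squareDir q.2.1‖ = Real.exp (min q.1 0) :=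
    norm_exp_smul_squareDir _ _
  intro hK
  have h2 := (H.mem_iff _ _ (by rw [h, Real.exp_le_one_iff]; exact min_le_right _ _)
    (clamp_mem q.2.2)).1 hK
  rw [← norm_eq_zero, h] at h2
  exact (Real.exp_pos _).ne' h2

theorem polar_add (ρ θ t : ℝ) (j : ℤ) :
    H.polar (ρ, θ + 2 * Real.pi * j, t) = H.polar (ρ, θ, t) := by
  simp [polar, squareDir_add]

theorem polar_log {z : ℝ × ℝ} (hz : z ≠ 0) (hz1 : ‖z‖ ≤ 1) {t : ℝ} (ht : t ∈ Icc (0 : ℝ) 1)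
    (θ : ℝ) : H.polar (Real.log ‖z‖, θ, t) = H.toFun (‖z‖ • squareDir θ, t) := by
  have h : min (Real.log ‖z‖) 0 = Real.log ‖z‖ :=
    min_eq_left (Real.log_nonpos (norm_nonneg z) hz1)
  simp [polar, h, Real.exp_log (norm_pos_iff.2 hz), clamp_of_mem ht]

end TangleColumn

/-! ### Lifts of a column to a branched cover -/

section Lifts

variable {M Y : Type*} [TopologicalSpace M] [TopologicalSpace Y] {f : M → Y} {B : Set Y}
  {A : Type*} [TopologicalSpace A]

theorem IsBranchedCover.continuous (hf : IsBranchedCover f B) : Continuous f := hf.proper.continuous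

theorem IsBranchedCover.isCoveringMap (hf : IsBranchedCover f B) :
    IsCoveringMap (Bᶜ.restrictPreimage f) :=
  isCoveringMap_iff_isCoveringMapOn_univ.2
    (by simpa using hf.covering.restrictPreimage (Bᶜ : Set Y))

theorem IsBranchedCover.exists_lift [SimplyConnectedSpace A] [LocallyPathConnectedSpace A]
    (hf : IsBranchedCover f B) (g : C(A, Y)) (hg : ∀ a, g a ∈ Bᶜ) {a : A} {x : M}
    (hx : f x = g a) : ∃ F : C(A, M), F a = x ∧ ∀ a, f (F a) = g a := by
  obtain ⟨F, ⟨h1, h2⟩, -⟩ := hf.isCoveringMap.existsUnique_continuousMap_lifts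
    (⟨fun a => ⟨g a, hg a⟩, by fun_prop⟩ : C(A, (Bᶜ : Set Y))) a
    ⟨x, by rw [mem_preimage, hx]; exact hg a⟩ (Subtype.ext hx)
  exact ⟨⟨fun a => (F a).1, by fun_prop⟩, congrArg Subtype.val h1,
    fun a => congrArg Subtype.val (congrFun h2 a)⟩

theorem IsBranchedCover.lift_unique [PreconnectedSpace A]
    (hf : IsBranchedCover f B) {F F' : C(A, M)} (h : ∀ a, f (F a) = f (F' a))
    (hB : ∀ a, f (F a) ∈ Bᶜ) {a : A} (ha : F a = F' a) : F = F' := by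
  have h1 := hf.isCoveringMap.eq_of_comp_eq
    (g₁ := fun a => (⟨F a, hB a⟩ : f ⁻¹' Bᶜ))
    (g₂ := fun a => (⟨F' a, by rw [mem_preimage, ← h a]; exact hB a⟩ : f ⁻¹' Bᶜ))
    (by fun_prop) (by fun_prop) (funext fun a => Subtype.ext (h a)) a (Subtype.ext ha)
  exact ContinuousMap.ext fun a => congrArg Subtype.val (congrFun h1 a)

end Lifts

namespace TangleColumn

variable {M Y : Type*} [TopologicalSpace M] [TopologicalSpace Y] {f : M → Y} {K : Set Y}
  (hf : IsBranchedCover f K) {H : TangleColumn K}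

/-- The lifts to the branched cover of the polar coordinates of a column. -/
def PolarLift (f : M → Y) (H : TangleColumn K) : Type _ :=
  {E : C(ℝ × ℝ × ℝ, M) // ∀ q, f (E q) = H.polar q}

namespace PolarLift

/-- The integers act on the lifts of the polar coordinates by turning around the core. -/
noncomputable instance : AddAction ℤ (PolarLift f H) where
  vadd j E := ⟨⟨fun q => E.1 (q.1, q.2.1 + 2 * Real.pi * j, q.2.2), by fun_prop⟩,
    fun q => (E.2 _).trans (H.polar_add _ _ _ _)⟩
  zero_vadd E := Subtype.ext <| ContinuousMap.ext fun q => by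
    change E.1 (q.1, q.2.1 + 2 * Real.pi * (0 : ℤ), q.2.2) = E.1 q
    simp
  add_vadd i j E := Subtype.ext <| ContinuousMap.ext fun q => by
    change E.1 (q.1, q.2.1 + 2 * Real.pi * (i + j : ℤ), q.2.2) =
      E.1 (q.1, q.2.1 + 2 * Real.pi * i + 2 * Real.pi * j, q.2.2)
    push_cast
    ring_nf

theorem vadd_apply (j : ℤ) (E : PolarLift f H) (ρ θ t : ℝ) :
    (j +ᵥ E).1 (ρ, θ, t) = E.1 (ρ, θ + 2 * Real.pi * j, t) := rfl

include hf in
theorem ext_of_apply_eq {E E' : PolarLift f H} {q : ℝ × ℝ × ℝ} (h : E.1 q = E'.1 q) : E = E' :=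
  Subtype.ext <| hf.lift_unique (fun a => (E.2 a).trans (E'.2 a).symm)
    (fun a => by rw [E.2 a]; exact H.polar_notMem a) h

include hf in
theorem exists_apply_eq {x : M} {q : ℝ × ℝ × ℝ} (h : f x = H.polar q) :
    ∃ E : PolarLift f H, E.1 q = x := by
  obtain ⟨F, h1, h2⟩ := hf.exists_lift H.polar H.polar_notMem h
  exact ⟨⟨F, h2⟩, h1⟩

/-- A lift of the polar coordinates is determined by its value at a point. -/
noncomputable def equivFiber (q : ℝ × ℝ × ℝ) : PolarLift f H ≃ f ⁻¹' {H.polar q} :=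
  Equiv.ofBijective (fun E => ⟨E.1 q, E.2 q⟩)
    ⟨fun _ _ h => ext_of_apply_eq hf (congrArg Subtype.val h), fun x => by
      obtain ⟨E, hE⟩ := exists_apply_eq hf x.2
      exact ⟨E, Subtype.ext hE⟩⟩

include hf in
theorem finite : Finite (PolarLift f H) :=
  have := (hf.finite_fiber (H.polar 0)).to_subtype
  Finite.of_equiv _ (equivFiber hf 0).symm

/-- The branching index of a lift: the number of turns after which it closes up. -/
noncomputable def index (E : PolarLift f H) : ℕ := AddAction.period (1 : ℤ) E

theorem vadd_eq_self_iff (E : PolarLift f H) (j : ℤ) : j +ᵥ E = E ↔ (E.index : ℤ) ∣ j := by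
  simpa [index] using AddAction.zsmul_vadd_eq_iff_period_dvd (j := j) (g := (1 : ℤ)) (a := E)

include hf in
theorem index_pos (E : PolarLift f H) : 0 < E.index := by
  have := finite (H := H) hf
  rw [index, AddAction.period_eq_minimalPeriod]
  exact Function.minimalPeriod_pos_of_mem_periodicPts
    ((AddAction.injective (1 : ℤ)).mem_periodicPts E)

theorem apply_add_index (E : PolarLift f H) (ρ θ t : ℝ) (j : ℤ) :
    E.1 (ρ, θ + 2 * Real.pi * (E.index * j : ℤ), t) = E.1 (ρ, θ, t) := by
  rw [← vadd_apply, (E.vadd_eq_self_iff _).2 (dvd_mul_right _ _)]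

/-- The parametrisation of the punctured branched column. -/
noncomputable def punctured (E : PolarLift f H) (w : (ℝ × ℝ) × ℝ) : M :=
  E.1 (Real.log ‖w.1‖, E.index * planeArg w.1, w.2)

theorem punctured_apply (E : PolarLift f H) {r : ℝ} (hr : 0 < r) (θ t : ℝ) :
    E.punctured (r • squareDir θ, t) = E.1 (Real.log r, E.index * θ, t) := by
  obtain ⟨j, hj⟩ := exists_planeArg_smul_squareDir hr θ
  have h2 : (E.index : ℝ) * (θ + 2 * Real.pi * j) =
      E.index * θ + 2 * Real.pi * ((E.index * j : ℤ) : ℝ) := by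
    push_cast; ring
  simp only [punctured]
  rw [hj, h2, apply_add_index, norm_smul, norm_squareDir, mul_one, Real.norm_eq_abs, abs_of_pos hr]

theorem continuousOn_punctured (E : PolarLift f H) :
    ContinuousOn E.punctured {w | w.1 ≠ 0} := by
  rintro ⟨z, t⟩ (hz : z ≠ 0)
  refine ContinuousAt.continuousWithinAt ?_
  have hlog : ContinuousAt (fun w : (ℝ × ℝ) × ℝ => Real.log ‖w.1‖) (z, t) :=
    (continuous_fst.norm.continuousAt).log (norm_ne_zero_iff.2 hz)
  have harg (z : ℝ × ℝ) (t : ℝ) (h : (⟨z.1, z.2⟩ : ℂ) ∈ Complex.slitPlane) :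
      ContinuousAt (fun w : (ℝ × ℝ) × ℝ => planeArg w.1) (z, t) := by
    refine ContinuousAt.comp (f := fun w : (ℝ × ℝ) × ℝ => (⟨w.1.1, w.1.2⟩ : ℂ)) (g := Complex.arg)
      (Complex.continuousAt_arg h) ?_
    refine Continuous.continuousAt ?_
    exact Complex.equivRealProdCLM.symm.continuous.comp continuous_fst
  by_cases h : (⟨z.1, z.2⟩ : ℂ) ∈ Complex.slitPlane
  · exact E.1.continuous.continuousAt.comp
      (hlog.prodMk ((continuousAt_const.mul (harg z t h)).prodMk continuous_snd.continuousAt))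
  · have h' : (⟨(-z).1, (-z).2⟩ : ℂ) ∈ Complex.slitPlane := by
      have hne : (⟨z.1, z.2⟩ : ℂ) ≠ 0 := fun h0 =>
        hz (Prod.ext (congrArg Complex.re h0) (congrArg Complex.im h0))
      have h3 := Complex.mem_slitPlane_or_neg_mem_slitPlane hne
      refine (h3.resolve_left h)
    have hneg : ContinuousAt (fun w : (ℝ × ℝ) × ℝ => planeArg (-w.1)) (z, t) := by
      refine ContinuousAt.comp (f := fun w : (ℝ × ℝ) × ℝ => (-w.1, w.2))
        (g := fun w : (ℝ × ℝ) × ℝ => planeArg w.1) (harg (-z) t h') ?_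
      fun_prop
    have h1 : ContinuousAt (fun w : (ℝ × ℝ) × ℝ =>
        E.1 (Real.log ‖w.1‖, E.index * (planeArg (-w.1) + Real.pi), w.2)) (z, t) :=
      E.1.continuous.continuousAt.comp (hlog.prodMk ((continuousAt_const.mul
        (hneg.add continuousAt_const)).prodMk continuous_snd.continuousAt))
    refine h1.congr ?_
    have h2 : ∀ᶠ w : (ℝ × ℝ) × ℝ in 𝓝 (z, t), w.1 ≠ 0 :=
      continuous_fst.continuousAt.eventually_ne hz
    filter_upwards [h2] with w hw
    have h3 : ‖w.1‖ • squareDir (planeArg (-w.1) + Real.pi) = w.1 := by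
      rw [squareDir_add_pi, smul_neg, ← norm_neg w.1, norm_smul_squareDir_planeArg, neg_neg]
    rw [← punctured_apply E (norm_pos_iff.2 hw), h3]

theorem apply_punctured (E : PolarLift f H) {z : ℝ × ℝ} (hz : z ≠ 0) (t : ℝ) :
    f (E.punctured (z, t)) =
      H.toFun (min ‖z‖ 1 • squareDir (E.index * planeArg z), clamp t) := by
  have hz' := norm_pos_iff.2 hz
  have h : Real.exp (min (Real.log ‖z‖) 0) = min ‖z‖ 1 := by
    rw [Real.exp_monotone.map_min, Real.exp_log hz', Real.exp_zero]
  rw [punctured, E.2]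
  simp [polar, h]

theorem isPreconnected_puncturedBox (r t : ℝ) :
    _root_.IsPreconnected ((Metric.ball (0 : ℝ × ℝ) r ×ˢ Metric.ball t r) ∩ {w | w.1 ≠ 0}) := by
  have h1 : _root_.IsPreconnected (Ioo 0 r ×ˢ (univ : Set ℝ) ×ˢ Metric.ball t r) :=
    ((convex_Ioo 0 r).isPreconnected).prod (isPreconnected_univ.prod
      (convex_ball t r).isPreconnected)
  convert h1.image (fun q : ℝ × ℝ × ℝ => (q.1 • squareDir q.2.1, q.2.2))
    (Continuous.continuousOn (by fun_prop)) using 1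
  ext ⟨z, s⟩
  constructor
  · rintro ⟨⟨h2, h3⟩, h4⟩
    exact ⟨(‖z‖, planeArg z, s), ⟨⟨norm_pos_iff.2 h4, by simpa using h2⟩, trivial, h3⟩,
      Prod.ext (norm_smul_squareDir_planeArg z) rfl⟩
  · rintro ⟨⟨ρ, θ, s'⟩, ⟨⟨h2, h3⟩, -, h4⟩, h⟩
    obtain ⟨rfl, rfl⟩ := Prod.ext_iff.1 h
    have h5 : ‖ρ • squareDir θ‖ = ρ := by
      rw [norm_smul, norm_squareDir, mul_one, Real.norm_eq_abs, abs_of_pos h2]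
    refine ⟨⟨by simpa [h5] using h3, h4⟩, ?_⟩
    exact norm_ne_zero_iff.1 (by rw [h5]; exact h2.ne')

theorem mem_closure_punctured (w : (ℝ × ℝ) × ℝ) :
    w ∈ closure {w : (ℝ × ℝ) × ℝ | w.1 ≠ 0} := by
  have h : {w : (ℝ × ℝ) × ℝ | w.1 ≠ 0} = ({0}ᶜ : Set (ℝ × ℝ)) ×ˢ (univ : Set ℝ) := by
    ext; simp
  rw [h, closure_prod_eq, (dense_compl_singleton (0 : ℝ × ℝ)).closure_eq]
  simp

variable [T2Space M] [T2Space Y]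

include hf in
theorem exists_tendsto_punctured (E : PolarLift f H) (w : (ℝ × ℝ) × ℝ) :
    ∃ x, Tendsto E.punctured (𝓝[{w | w.1 ≠ 0}] w) (𝓝 x) := by
  obtain ⟨z, t⟩ := w
  rcases ne_or_eq z 0 with hz | rfl
  · exact ⟨_, E.continuousOn_punctured (z, t) hz⟩
  refine hf.exists_tendsto E.continuousOn_punctured (mem_closure_punctured _)
    (y := H.toFun (0, clamp t)) ?_ ?_
  · have h1 : Tendsto (fun w : (ℝ × ℝ) × ℝ =>
        (min ‖w.1‖ 1 • squareDir (E.index * planeArg w.1), clamp w.2)) (𝓝 (0, t))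
        (𝓝 (0, clamp t)) := by
      refine Tendsto.prodMk_nhds ?_ ((continuous_clamp.comp continuous_snd).tendsto _)
      rw [tendsto_zero_iff_norm_tendsto_zero]
      have h2 : Tendsto (fun w : (ℝ × ℝ) × ℝ => |min ‖w.1‖ 1|) (𝓝 (0, t)) (𝓝 0) := by
        have : Continuous (fun w : (ℝ × ℝ) × ℝ => |min ‖w.1‖ 1|) := by fun_prop
        simpa using this.tendsto (0, t)
      refine h2.congr fun w => ?_
      rw [norm_smul, norm_squareDir, mul_one, Real.norm_eq_abs]
    refine (((H.toFun.continuous.tendsto _).comp h1).mono_left nhdsWithin_le_nhds).congr' ?_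
    filter_upwards [self_mem_nhdsWithin] with w hw
    exact (E.apply_punctured hw w.2).symm
  · intro U hU
    obtain ⟨r, hr, h⟩ := Metric.mem_nhds_iff.1 hU
    refine ⟨Metric.ball 0 r ×ˢ Metric.ball t r, ?_, ?_, isPreconnected_puncturedBox r t⟩
    · exact prod_mem_nhds (Metric.ball_mem_nhds _ hr) (Metric.ball_mem_nhds _ hr)
    · rwa [ball_prod_same]

variable [CompactSpace M]

/-- The parametrisation of the branched column, with its core filled in. -/
noncomputable def fill (E : PolarLift f H) : C((ℝ × ℝ) × ℝ, M) :=
  ⟨extendFrom {w | w.1 ≠ 0} E.punctured,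
    continuous_extendFrom (fun w => mem_closure_punctured w) (exists_tendsto_punctured hf E)⟩

theorem fill_of_ne (E : PolarLift f H) {z : ℝ × ℝ} (hz : z ≠ 0) (t : ℝ) :
    E.fill hf (z, t) = E.punctured (z, t) :=
  extendFrom_extends E.continuousOn_punctured (z, t) hz

theorem fill_smul (E : PolarLift f H) {r : ℝ} (hr : 0 < r) (θ t : ℝ) :
    E.fill hf (r • squareDir θ, t) = E.1 (Real.log r, E.index * θ, t) := by
  rw [fill_of_ne, punctured_apply _ hr]
  rw [← norm_ne_zero_iff, norm_smul, norm_squareDir]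
  simp [hr.ne']

theorem apply_fill (E : PolarLift f H) {z : ℝ × ℝ} (hz : ‖z‖ ≤ 1) {t : ℝ}
    (ht : t ∈ Icc (0 : ℝ) 1) :
    f (E.fill hf (z, t)) = H.toFun (branchMap E.index z, t) := by
  have h1 (z : ℝ × ℝ) (h0 : z ≠ 0) (hz : ‖z‖ ≤ 1) :
      f (E.fill hf (z, t)) = H.toFun (branchMap E.index z, t) := by
    rw [fill_of_ne hf E h0, apply_punctured E h0, min_eq_left hz, clamp_of_mem ht, branchMap]
  rcases ne_or_eq z 0 with h0 | rfl
  · exact h1 z h0 hz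
  -- Over the core both sides are limits along the ray of argument `0`.
  have hray (s : ℝ) (hs : 0 < s) : branchMap E.index (s • (1, 0)) = s • (1, 0) := by
    rw [branchMap_smul _ hs.le, branchMap, planeArg]
    have : (⟨(1, 0).1, (1, 0).2⟩ : ℂ) = 1 := rfl
    simp [squareDir_zero, this, Prod.norm_def]
  have hl : Tendsto (fun s : ℝ => (s • ((1, 0) : ℝ × ℝ), t)) (𝓝[>] 0) (𝓝 (0, t)) := by
    have : Continuous fun s : ℝ => (s • ((1, 0) : ℝ × ℝ), t) := by fun_prop
    have h := this.tendsto 0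
    rw [zero_smul] at h
    exact h.mono_left nhdsWithin_le_nhds
  have h2 := ((hf.continuous.comp (E.fill hf).continuous).tendsto (0, t)).comp hl
  have h3 := (H.toFun.continuous.tendsto (0, t)).comp hl
  rw [branchMap_eq_zero_iff.2 rfl]
  refine tendsto_nhds_unique h2 (h3.congr' ?_)
  have h4 : ∀ᶠ s : ℝ in 𝓝[>] 0, s ≤ 1 :=
    (eventually_le_nhds zero_lt_one).filter_mono nhdsWithin_le_nhds
  filter_upwards [self_mem_nhdsWithin, h4] with s hs hs1
  have hs : 0 < s := hs
  have hn : ‖s • ((1, 0) : ℝ × ℝ)‖ = s := by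
    simp [Prod.norm_def, abs_of_pos hs, hs.le]
  simp only [Function.comp]
  rw [h1 _ (norm_ne_zero_iff.1 (by rw [hn]; exact hs.ne')) (by rw [hn]; exact hs1), hray s hs]

end PolarLift

end TangleColumn

/-! ### The components of the preimage of a column -/

namespace TangleColumn

variable {M Y : Type*} [TopologicalSpace M] [TopologicalSpace Y] {f : M → Y} {K : Set Y}
  (hf : IsBranchedCover f K) {H : TangleColumn K}

theorem toFun_eq_iff {z z' : ℝ × ℝ} {t t' : ℝ} (hz : ‖z‖ ≤ 1) (hz' : ‖z'‖ ≤ 1)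
    (ht : t ∈ Icc (0 : ℝ) 1) (ht' : t' ∈ Icc (0 : ℝ) 1) :
    H.toFun (z, t) = H.toFun (z', t') ↔ z = z' ∧ t = t' := by
  rw [H.injOn.eq_iff ⟨by simpa using hz, ht⟩ ⟨by simpa using hz', ht'⟩, Prod.mk_inj]

namespace PolarLift

theorem eq_vadd_of_apply_eq (hf : IsBranchedCover f K) {E E' : PolarLift f H} {ρ θ θ' t : ℝ}
    (h : E.1 (ρ, θ, t) = E'.1 (ρ, θ', t)) (hθ : squareDir θ = squareDir θ') :
    ∃ j : ℤ, θ' = θ + 2 * Real.pi * j ∧ E = j +ᵥ E' := by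
  obtain ⟨j, rfl⟩ := squareDir_eq_iff.1 hθ
  exact ⟨j, rfl, ext_of_apply_eq hf (q := (ρ, θ, t)) (by rw [vadd_apply, h])⟩

variable [T2Space M] [T2Space Y] [CompactSpace M]

/-- Points of two branched columns that coincide have the same height and distance to the core. -/
theorem eq_of_fill_eq {E E' : PolarLift f H} {z z' : ℝ × ℝ} {t t' : ℝ} (hz : ‖z‖ ≤ 1)
    (hz' : ‖z'‖ ≤ 1) (ht : t ∈ Icc (0 : ℝ) 1) (ht' : t' ∈ Icc (0 : ℝ) 1)
    (h : E.fill hf (z, t) = E'.fill hf (z', t')) :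
    branchMap E.index z = branchMap E'.index z' ∧ ‖z‖ = ‖z'‖ ∧ t = t' := by
  have h1 := congrArg f h
  rw [apply_fill hf E hz ht, apply_fill hf E' hz' ht', toFun_eq_iff (by rwa [norm_branchMap])
    (by rwa [norm_branchMap]) ht ht'] at h1
  exact ⟨h1.1, by rw [← norm_branchMap E.index, h1.1, norm_branchMap], h1.2⟩

/-- Away from the cores, branched columns meet only if they differ by turns around the core. -/
theorem exists_vadd_of_fill_eq {E E' : PolarLift f H} {z z' : ℝ × ℝ} {t t' : ℝ} (hz : ‖z‖ ≤ 1)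
    (hz' : ‖z'‖ ≤ 1) (ht : t ∈ Icc (0 : ℝ) 1) (ht' : t' ∈ Icc (0 : ℝ) 1) (h0 : z ≠ 0)
    (h : E.fill hf (z, t) = E'.fill hf (z', t')) :
    ∃ j : ℤ, E'.index * planeArg z' = E.index * planeArg z + 2 * Real.pi * j ∧ E = j +ᵥ E' := by
  obtain ⟨h1, h2, rfl⟩ := eq_of_fill_eq hf hz hz' ht ht' h
  have h0' : z' ≠ 0 := by rwa [← norm_ne_zero_iff, ← h2, norm_ne_zero_iff]
  rw [fill_of_ne hf _ h0, fill_of_ne hf _ h0', punctured, punctured, ← h2] at h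
  refine eq_vadd_of_apply_eq hf h ?_
  rw [branchMap, branchMap, ← h2] at h1
  exact smul_right_injective _ (norm_ne_zero_iff.2 h0) h1

theorem fill_injOn (E : PolarLift f H) :
    InjOn (E.fill hf) (Metric.closedBall 0 1 ×ˢ Icc 0 1) := by
  rintro ⟨z, t⟩ ⟨hz, ht⟩ ⟨z', t'⟩ ⟨hz', ht'⟩ h
  rw [mem_closedBall_zero_iff] at hz hz'
  obtain ⟨-, h2, h3⟩ := eq_of_fill_eq hf hz hz' ht ht' h
  rcases eq_or_ne z 0 with rfl | h0
  · rw [norm_zero, eq_comm, norm_eq_zero] at h2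
    exact Prod.ext h2.symm h3
  obtain ⟨j, hj, hE⟩ := exists_vadd_of_fill_eq hf hz hz' ht ht' h0 h
  obtain ⟨i, rfl⟩ := (vadd_eq_self_iff E j).1 hE.symm
  have hpos : (E.index : ℝ) ≠ 0 := by exact_mod_cast (index_pos hf E).ne'
  have h4 : planeArg z' = planeArg z + 2 * Real.pi * i := by
    apply mul_left_cancel₀ hpos
    rw [hj]; push_cast; ring
  refine Prod.ext ?_ h3
  change z = z'
  rw [← norm_smul_squareDir_planeArg z, ← norm_smul_squareDir_planeArg z', h4, squareDir_add, h2]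

/-- The orbits of the lifts of the polar coordinates: they correspond to the components of the
preimage of the column. -/
abbrev Orbits (f : M → Y) (H : TangleColumn K) : Type _ :=
  Quotient (AddAction.orbitRel ℤ (PolarLift f H))

omit [T2Space M] [T2Space Y] [CompactSpace M] in
include hf in
theorem finite_orbits : Finite (Orbits f H) :=
  have := finite (H := H) hf
  inferInstance

/-- The component of the preimage of the column that belongs to an orbit. -/
noncomputable def piece (ω : Orbits f H) : C((ℝ × ℝ) × ℝ, M) := ω.out.fill hf

omit [T2Space M] [T2Space Y] [CompactSpace M] in
theorem orbits_eq_of_vadd {ω ω' : Orbits f H} {j : ℤ} (h : ω.out = j +ᵥ ω'.out) : ω = ω' :=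
  Quotient.out_equiv_out.1 ((AddAction.orbitRel_apply).2 ⟨j, h.symm⟩)

theorem orbits_eq_of_piece_eq_of_ne {ω ω' : Orbits f H} {z z' : ℝ × ℝ} {t t' : ℝ} (hz : ‖z‖ ≤ 1)
    (hz' : ‖z'‖ ≤ 1) (ht : t ∈ Icc (0 : ℝ) 1) (ht' : t' ∈ Icc (0 : ℝ) 1) (h0 : z ≠ 0)
    (h : piece hf ω (z, t) = piece hf ω' (z', t')) : ω = ω' := by
  obtain ⟨j, -, hE⟩ := exists_vadd_of_fill_eq hf hz hz' ht ht' h0 h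
  exact orbits_eq_of_vadd hE

theorem exists_piece_eq_of_ne {y : M} {z : ℝ × ℝ} {t : ℝ} (hz : ‖z‖ ≤ 1)
    (ht : t ∈ Icc (0 : ℝ) 1) (h0 : z ≠ 0) (h : f y = H.toFun (z, t)) :
    ∃ (ω : Orbits f H) (z' : ℝ × ℝ), ‖z'‖ ≤ 1 ∧ piece hf ω (z', t) = y := by
  rw [← norm_smul_squareDir_planeArg z, ← polar_log H h0 hz ht] at h
  obtain ⟨E, hE⟩ := exists_apply_eq hf h
  set ω : Orbits f H := Quotient.mk _ E with hω
  obtain ⟨j, hj⟩ : ∃ j : ℤ, j +ᵥ ω.out = E :=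
    AddAction.orbitRel_apply.1
      ((AddAction.orbitRel ℤ (PolarLift f H)).symm
        (Quotient.mk_out (s := AddAction.orbitRel ℤ _) E))
  have hpos : (ω.out.index : ℝ) ≠ 0 := by exact_mod_cast (index_pos hf ω.out).ne'
  refine ⟨ω, ‖z‖ • squareDir ((planeArg z + 2 * Real.pi * j) / ω.out.index), ?_, ?_⟩
  · rwa [norm_smul, norm_squareDir, mul_one, norm_norm]
  · rw [piece, fill_smul hf _ (norm_pos_iff.2 h0), mul_div_cancel₀ _ hpos, ← vadd_apply, hj, hE]

theorem apply_piece (ω : Orbits f H) {z : ℝ × ℝ} (hz : ‖z‖ ≤ 1) {t : ℝ}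
    (ht : t ∈ Icc (0 : ℝ) 1) :
    f (piece hf ω (z, t)) = H.toFun (branchMap ω.out.index z, t) := apply_fill hf _ hz ht

theorem isClosed_image_piece (ω : Orbits f H) :
    IsClosed (piece hf ω '' (Metric.closedBall 0 1 ×ˢ Icc 0 1)) :=
  (((isCompact_closedBall _ _).prod isCompact_Icc).image (piece hf ω).continuous).isClosed

/-- Every neighbourhood of a point of the core contains unbranched points of the component. -/
theorem inter_piece_nonempty (ω : Orbits f H) {t : ℝ} (ht : t ∈ Icc (0 : ℝ) 1) {V : Set M}
    (hV : V ∈ 𝓝 (piece hf ω (0, t))) :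
    ∃ y ∈ V, y ∈ f ⁻¹' Kᶜ ∧ y ∈ piece hf ω '' (Metric.closedBall 0 1 ×ˢ Icc 0 1) := by
  have h1 : Tendsto (fun s : ℝ => piece hf ω (s • (1, 0), t)) (𝓝 0)
      (𝓝 (piece hf ω (0, t))) := by
    have : Continuous fun s : ℝ => piece hf ω (s • (1, 0), t) := by fun_prop
    have h2 := this.tendsto 0
    rwa [zero_smul] at h2
  have h2 : ∀ᶠ s : ℝ in 𝓝[>] 0, piece hf ω (s • (1, 0), t) ∈ V :=
    (h1.mono_left nhdsWithin_le_nhds) hV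
  have h4 : ∀ᶠ s : ℝ in 𝓝[>] 0, s ≤ 1 :=
    (eventually_le_nhds zero_lt_one).filter_mono nhdsWithin_le_nhds
  obtain ⟨s, ⟨hs2, hs4⟩, hs⟩ := ((h2.and h4).and self_mem_nhdsWithin).exists
  have hs : 0 < s := hs
  have hn : ‖s • ((1, 0) : ℝ × ℝ)‖ = s := by
    simp [Prod.norm_def, abs_of_pos hs, hs.le]
  refine ⟨_, hs2, ?_, ⟨_, ⟨mem_closedBall_zero_iff.2 (hn.trans_le hs4), ht⟩, rfl⟩⟩
  rw [mem_preimage, apply_piece hf ω (by rwa [hn]) ht, mem_compl_iff,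
    H.mem_iff _ _ (by rwa [norm_branchMap, hn]) ht, branchMap_eq_zero_iff, ← norm_eq_zero, hn]
  exact hs.ne'

theorem orbits_eq_of_mem_of_mem {ω ω' : Orbits f H} {y : M} (hy : f y ∉ K)
    (h : y ∈ piece hf ω '' (Metric.closedBall 0 1 ×ˢ Icc 0 1))
    (h' : y ∈ piece hf ω' '' (Metric.closedBall 0 1 ×ˢ Icc 0 1)) : ω = ω' := by
  obtain ⟨⟨z, s⟩, ⟨hz, hs⟩, h⟩ := h
  obtain ⟨⟨z', s'⟩, ⟨hz', hs'⟩, h'⟩ := h'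
  replace hz : ‖z‖ ≤ 1 := mem_closedBall_zero_iff.1 hz
  replace hz' : ‖z'‖ ≤ 1 := mem_closedBall_zero_iff.1 hz'
  replace hs : s ∈ Icc (0 : ℝ) 1 := hs
  refine orbits_eq_of_piece_eq_of_ne hf hz hz' hs hs' ?_ (h.trans h'.symm)
  rintro rfl
  refine hy ?_
  rw [← h, apply_piece hf ω hz hs, branchMap_eq_zero_iff.2 rfl, H.mem_iff _ _ hz hs]

/-- Near an interior point of a core, the complement of the branching set lies in a single
component of the preimage of the column. -/
theorem orbits_eq_of_core_eq {ω ω' : Orbits f H} {t : ℝ} (ht : t ∈ Ioo (0 : ℝ) 1)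
    (h : piece hf ω (0, t) = piece hf ω' (0, t)) : ω = ω' := by
  by_contra hne
  have := finite_orbits (H := H) hf
  have ht' := Ioo_subset_Icc_self ht
  have hx : f (piece hf ω (0, t)) = H.toFun (0, t) := by
    rw [apply_piece hf ω (by simp) ht', branchMap_eq_zero_iff.2 rfl]
  have hxK : f (piece hf ω (0, t)) ∈ K := by
    rw [hx, H.mem_iff _ _ (by simp) ht']
  have hnhds : f ⁻¹' (H.toFun '' (Metric.closedBall 0 1 ×ˢ Icc 0 1)) ∈ 𝓝 (piece hf ω (0, t)) :=
    hf.continuous.continuousAt.preimage_mem_nhds (by rw [hx]; exact H.image_mem_nhds t ht)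
  -- A small neighbourhood minus the branching set is connected and covered by the closed
  -- components, so it cannot meet two of them.
  obtain ⟨V, hV, hVQ, hconn, -⟩ := hf.exists_isPreconnected hxK hnhds
  have hmeet (ω₁ : Orbits f H) (h1 : V ∈ 𝓝 (piece hf ω₁ (0, t))) :
      ((V ∩ f ⁻¹' Kᶜ) ∩ piece hf ω₁ '' (Metric.closedBall 0 1 ×ˢ Icc 0 1)).Nonempty := by
    obtain ⟨y, hyV, hyK, hyQ⟩ := inter_piece_nonempty hf ω₁ ht' h1
    exact ⟨y, ⟨hyV, hyK⟩, hyQ⟩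
  let C : Set M := piece hf ω '' (Metric.closedBall 0 1 ×ˢ Icc 0 1)
  let C' : Set M := ⋃ ω₁ : {ω₁ : Orbits f H // ω₁ ≠ ω},
    piece hf ω₁.1 '' (Metric.closedBall 0 1 ×ˢ Icc 0 1)
  have hC : IsClosed C := isClosed_image_piece hf ω
  have hC' : IsClosed C' := isClosed_iUnion_of_finite fun ω₁ => isClosed_image_piece hf ω₁.1
  have hcov : V ∩ f ⁻¹' Kᶜ ⊆ C ∪ C' := by
    rintro y ⟨hyV, hyK⟩
    obtain ⟨⟨z, s⟩, ⟨hz, hs⟩, hy⟩ := hVQ hyV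
    replace hz : ‖z‖ ≤ 1 := mem_closedBall_zero_iff.1 hz
    have h0 : z ≠ 0 := by
      rintro rfl
      exact hyK (by rw [← hy, H.mem_iff _ _ hz hs])
    obtain ⟨ω₁, z', hz', hy'⟩ := exists_piece_eq_of_ne hf hz hs h0 hy.symm
    have hmem : y ∈ piece hf ω₁ '' (Metric.closedBall 0 1 ×ˢ Icc 0 1) :=
      ⟨(z', s), ⟨mem_closedBall_zero_iff.2 hz', hs⟩, hy'⟩
    rcases eq_or_ne ω₁ ω with hω | hω
    · left
      rwa [hω] at hmem
    · exact Or.inr (mem_iUnion.2 ⟨⟨ω₁, hω⟩, hmem⟩)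
  have h2 : ((V ∩ f ⁻¹' Kᶜ) ∩ C').Nonempty := by
    obtain ⟨y, hy, hy'⟩ := hmeet ω' (h ▸ hV)
    exact ⟨y, hy, mem_iUnion.2 ⟨⟨ω', Ne.symm hne⟩, hy'⟩⟩
  obtain ⟨y, hyW, hy1, hy2⟩ :=
    isPreconnected_closed_iff.1 hconn C C' hC hC' hcov (hmeet ω hV) h2
  obtain ⟨ω₁, hy2⟩ := mem_iUnion.1 hy2
  exact ω₁.2 (orbits_eq_of_mem_of_mem hf hyW.2 hy1 hy2).symm

theorem orbits_eq_of_piece_eq {ω ω' : Orbits f H} {z z' : ℝ × ℝ} {t t' : ℝ} (hz : ‖z‖ ≤ 1)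
    (hz' : ‖z'‖ ≤ 1) (ht : t ∈ Icc (0 : ℝ) 1) (ht' : t' ∈ Icc (0 : ℝ) 1)
    (h : piece hf ω (z, t) = piece hf ω' (z', t')) : ω = ω' := by
  rcases ne_or_eq z 0 with h0 | rfl
  · exact orbits_eq_of_piece_eq_of_ne hf hz hz' ht ht' h0 h
  obtain ⟨-, h1, rfl⟩ := eq_of_fill_eq hf hz hz' ht ht' h
  obtain rfl : z' = 0 := norm_eq_zero.1 (by rw [← h1, norm_zero])
  have hK (ω : Orbits f H) (s : ℝ) (hs : s ∈ Icc (0 : ℝ) 1) : f (piece hf ω (0, s)) ∈ K := by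
    rw [apply_piece hf ω hz hs, branchMap_eq_zero_iff.2 rfl, H.mem_iff _ _ (by simp) hs]
  -- The branching set is locally injected, so the cores agree at nearby interior heights.
  obtain ⟨V, hV, hinj⟩ := hf.exists_injOn (hK ω t ht)
  have hcont (ω : Orbits f H) : Continuous fun s : ℝ => piece hf ω (0, s) := by fun_prop
  have h1 : ∀ᶠ s in 𝓝[Ioo 0 1] t, piece hf ω (0, s) ∈ V :=
    (((hcont ω).tendsto t).mono_left nhdsWithin_le_nhds) hV
  have h2 : ∀ᶠ s in 𝓝[Ioo 0 1] t, piece hf ω' (0, s) ∈ V :=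
    (((hcont ω').tendsto t).mono_left nhdsWithin_le_nhds) (by rw [← h]; exact hV)
  have : (𝓝[Ioo 0 1] t).NeBot := by
    rw [← mem_closure_iff_nhdsWithin_neBot, closure_Ioo zero_ne_one]
    exact ht
  obtain ⟨s, ⟨hs1, hs2⟩, hs⟩ := ((h1.and h2).and self_mem_nhdsWithin).exists
  have hs' := Ioo_subset_Icc_self hs
  refine orbits_eq_of_core_eq hf hs (hinj ⟨hs1, hK ω s hs'⟩ ⟨hs2, hK ω' s hs'⟩ ?_)
  rw [apply_piece hf ω hz hs', apply_piece hf ω' hz hs', branchMap_eq_zero_iff.2 rfl,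
    branchMap_eq_zero_iff.2 rfl]

theorem exists_piece_eq {y : M} {z : ℝ × ℝ} {t : ℝ} (hz : ‖z‖ ≤ 1)
    (ht : t ∈ Icc (0 : ℝ) 1) (h : f y = H.toFun (z, t)) :
    ∃ (ω : Orbits f H) (z' : ℝ × ℝ), ‖z'‖ ≤ 1 ∧ piece hf ω (z', t) = y := by
  rcases ne_or_eq z 0 with h0 | rfl
  · exact exists_piece_eq_of_ne hf hz ht h0 h
  have := finite_orbits (H := H) hf
  set Q : Set ((ℝ × ℝ) × ℝ) := Metric.closedBall 0 1 ×ˢ Icc 0 1 with hQ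
  set C := ⋃ ω : Orbits f H, piece hf ω '' Q with hC
  have hCclosed : IsClosed C := isClosed_iUnion_of_finite fun ω => isClosed_image_piece hf ω
  -- The components fill the preimage of the interior of the core, by density.
  have hint (y : M) (t : ℝ) (ht : t ∈ Ioo (0 : ℝ) 1) (h : f y = H.toFun (0, t)) : y ∈ C := by
    by_contra hy
    have h1 : Cᶜ ∩ f ⁻¹' (H.toFun '' Q) ∈ 𝓝 y :=
      inter_mem (hCclosed.isOpen_compl.mem_nhds hy) (hf.continuous.continuousAt.preimage_mem_nhds
        (by rw [h]; exact H.image_mem_nhds t ht))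
    obtain ⟨V, hV, hVC, -, ⟨x, hxV, hxK⟩⟩ := hf.exists_isPreconnected
      (by rw [h, H.mem_iff _ _ hz (Ioo_subset_Icc_self ht)]) h1
    obtain ⟨hxC, ⟨⟨z, s⟩, ⟨hz, hs⟩, hx⟩⟩ := hVC hxV
    replace hz : ‖z‖ ≤ 1 := mem_closedBall_zero_iff.1 hz
    have h0 : z ≠ 0 := by
      rintro rfl
      exact hxK (by rw [← hx, H.mem_iff _ _ hz hs])
    obtain ⟨ω, z', hz', hx'⟩ := exists_piece_eq_of_ne hf hz hs h0 hx.symm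
    exact hxC (mem_iUnion.2 ⟨ω, ⟨(z', s), ⟨by simpa using hz', hs⟩, hx'⟩⟩)
  -- At an end of the core, the branch set lifts to points at interior heights near `y`.
  have hyC : y ∈ C := by
    by_contra hy
    have hyK : f y ∈ K := by rw [h, H.mem_iff _ _ hz ht]
    have h1 := hf.image_mem_nhdsWithin hyK (hCclosed.isOpen_compl.mem_nhds hy)
    have h2 : Tendsto (fun s : ℝ => H.toFun (0, s)) (𝓝[Ioo 0 1] t) (𝓝[K] (f y)) := by
      rw [h]
      refine tendsto_nhdsWithin_of_tendsto_nhds_of_eventually_within _ ?_ ?_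
      · have : Continuous fun s : ℝ => H.toFun (0, s) := by fun_prop
        exact (this.tendsto t).mono_left nhdsWithin_le_nhds
      · filter_upwards [self_mem_nhdsWithin] with s hs
        rw [H.mem_iff _ _ hz (Ioo_subset_Icc_self hs)]
    have : (𝓝[Ioo 0 1] t).NeBot := by
      rw [← mem_closure_iff_nhdsWithin_neBot, closure_Ioo zero_ne_one]
      exact ht
    obtain ⟨s, ⟨x, ⟨hxC, -⟩, hx⟩, hs⟩ := ((h2.eventually h1).and self_mem_nhdsWithin).exists
    exact hxC (hint x s hs hx)
  obtain ⟨ω, ⟨⟨z', t'⟩, ⟨hz', ht'⟩, rfl⟩⟩ := mem_iUnion.1 hyC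
  replace hz' : ‖z'‖ ≤ 1 := mem_closedBall_zero_iff.1 hz'
  replace ht' : t' ∈ Icc (0 : ℝ) 1 := ht'
  rw [apply_piece hf ω hz' ht', toFun_eq_iff (by rwa [norm_branchMap]) hz ht' ht] at h
  exact ⟨ω, z', hz', by rw [h.2]⟩

include hf in
/-- The components of the preimage of the column correspond to the points over any point of its
core. -/
theorem card_orbits {t : ℝ} (ht : t ∈ Icc (0 : ℝ) 1) :
    Nat.card (Orbits f H) = Nat.card (f ⁻¹' {H.toFun (0, t)}) := by
  refine Nat.card_congr (Equiv.ofBijective (fun ω => ⟨piece hf ω (0, t), ?_⟩) ⟨?_, ?_⟩)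
  · rw [mem_preimage, apply_piece hf ω (by simp) ht, branchMap_eq_zero_iff.2 rfl, mem_singleton_iff]
  · intro ω ω' h
    exact orbits_eq_of_piece_eq hf (by simp) (by simp) ht ht (congrArg Subtype.val h)
  · rintro ⟨y, hy⟩
    obtain ⟨ω, z, hz, rfl⟩ := exists_piece_eq hf (by simp) ht hy
    rw [mem_preimage, mem_singleton_iff, apply_piece hf ω hz ht,
      toFun_eq_iff (by rwa [norm_branchMap]) (by simp) ht ht, branchMap_eq_zero_iff] at hy
    obtain ⟨rfl, -⟩ := hy
    exact ⟨ω, rfl⟩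

omit [T2Space M] [T2Space Y] [CompactSpace M] in
include hf in
/-- If a turn around the core is an involution with a single fixed point, the components of the
preimage consist of one unbranched column and of columns of branching index two. -/
theorem two_mul_card_orbits (h2 : ∀ E : PolarLift f H, (1 : ℤ) +ᵥ ((1 : ℤ) +ᵥ E) = E)
    (h1 : ∃! E : PolarLift f H, (1 : ℤ) +ᵥ E = E) :
    2 * Nat.card (Orbits f H) = Nat.card (PolarLift f H) + 1 := by
  classical
  have := finite (H := H) hf
  have := Fintype.ofFinite (PolarLift f H)
  have := Fintype.ofFinite (Orbits f H)
  obtain ⟨E₀, h0, hu⟩ := h1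
  have hvadd (E : PolarLift f H) (j : ℤ) : j +ᵥ E = E ∨ j +ᵥ E = (1 : ℤ) +ᵥ E := by
    have h3 (i : ℤ) : (i + i) +ᵥ E = E := by
      induction i with
      | zero => simp
      | succ i hi => rw [show (i + 1 + (i + 1) : ℤ) = (1 + (1 + (i + i))) by ring, add_vadd,
          add_vadd, hi, h2]
      | pred i hi =>
        have := h2 ((-(i : ℤ) - 1 + (-i - 1)) +ᵥ E)
        rw [← add_vadd, ← add_vadd] at this
        rw [← this, show (1 + 1 + (-(i : ℤ) - 1 + (-i - 1)) : ℤ) = -i + -i by ring, hi]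
    rcases Int.even_or_odd' j with ⟨i, rfl | rfl⟩
    · exact Or.inl (by rw [two_mul]; exact h3 i)
    · exact Or.inr (by rw [two_mul, add_comm, add_vadd, h3])
  -- The orbits have two elements, except for the orbit of the fixed point.
  have hfib (E : PolarLift f H) : (Finset.univ.filter
      fun E' => (Quotient.mk _ E' : Orbits f H) = Quotient.mk _ E) = {E, (1 : ℤ) +ᵥ E} := by
    ext E'
    simp only [Finset.mem_filter, Finset.mem_univ, true_and, Finset.mem_insert,
      Finset.mem_singleton]
    rw [Quotient.eq, AddAction.orbitRel_apply]
    constructor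
    · rintro ⟨j, rfl⟩
      exact hvadd E j
    · rintro (rfl | rfl)
      exacts [⟨0, zero_vadd _ _⟩, ⟨1, rfl⟩]
  have hcard : ∀ ω : Orbits f H, (Finset.univ.filter
      fun E' => (Quotient.mk _ E' : Orbits f H) = ω).card +
        (if ω = Quotient.mk _ E₀ then 1 else 0) = 2 := by
    intro ω
    induction ω using Quotient.inductionOn with
    | h E =>
      rw [hfib]
      by_cases hE : (1 : ℤ) +ᵥ E = E
      · rw [hE, hu E hE]
        simp
      · rw [Finset.card_pair (Ne.symm hE), if_neg]
        rw [Quotient.eq, AddAction.orbitRel_apply]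
        rintro ⟨j, rfl⟩
        refine hE ?_
        change (1 : ℤ) +ᵥ (j +ᵥ E₀) = j +ᵥ E₀
        rw [vadd_comm, h0]
  have hsum : ∑ ω : Orbits f H, ((Finset.univ.filter
      fun E' => (Quotient.mk _ E' : Orbits f H) = ω).card +
        (if ω = Quotient.mk _ E₀ then 1 else 0)) = 2 * Fintype.card (Orbits f H) := by
    rw [Finset.sum_congr rfl fun ω _ => hcard ω]
    simp [mul_comm]
  rw [Finset.sum_add_distrib, ← Finset.card_eq_sum_card_fiberwise (fun _ _ => by simp)] at hsum
  simp only [Finset.sum_ite_eq', Finset.mem_univ, if_true] at hsum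
  rw [Nat.card_eq_fintype_card, Nat.card_eq_fintype_card, ← hsum, Finset.card_univ]

end PolarLift

end TangleColumn

/-! ### Extending primitives over vertically fibred pieces -/

section Extension

variable {X A : Type*} [TopologicalSpace X] [AddCommGroup A] (c : PathCocycle X A)

open PathCocycle in
/-- A primitive on a union `H` of cubes extends to the whole space if the remainder is covered by
cubes whose vertical segments match on overlaps and which meet `H` in their bottom, their top, and
at least one vertical segment: the value at a point is determined by pushing the point down to the
bottom of a cube. -/
theorem PathCocycle.exists_primitive_extension [T2Space X] (hX : HasSimplyConnectedNhds X)
    {ι₁ ι₂ : Type*} [Finite ι₁] [Finite ι₂] (e₁ : ι₁ → C(Cube3, X)) (e₂ : ι₂ → C(Cube3, X))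
    (hcov : ∀ x, x ∈ (⋃ i, range (e₁ i)) ∨ ∃ i w, e₂ i w = x)
    (hvert : ∀ i j w w', e₂ i w = e₂ j w' → w 2 = w' 2 ∧ ∀ s,
      e₂ i (Function.update w 2 s) = e₂ j (Function.update w' 2 s))
    (hbot : ∀ i w, w 2 = 0 → e₂ i w ∈ ⋃ i, range (e₁ i))
    (htop : ∀ i w, w 2 = 1 → e₂ i w ∈ ⋃ i, range (e₁ i))
    (hside : ∀ i w, e₂ i w ∈ ⋃ i, range (e₁ i) →
      w 2 = 0 ∨ w 2 = 1 ∨ ∀ s, e₂ i (Function.update w 2 s) ∈ ⋃ i, range (e₁ i))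
    (hhit : ∀ i, ∃ w, ∀ s, e₂ i (Function.update w 2 s) ∈ ⋃ i, range (e₁ i))
    {h : X → A} (hh : ∀ i, (c.comap (e₁ i)).IsPrimitive (h ∘ e₁ i)) :
    ∃ h' : X → A, c.IsPrimitive h' ∧ ∀ x ∈ ⋃ i, range (e₁ i), h' x = h x := by
  classical
  set H := ⋃ i, range (e₁ i) with hH
  let P (i : ι₂) : Cube3 → A := (c.comap (e₂ i)).primitive 0
  have hP (i : ι₂) : (c.comap (e₂ i)).IsPrimitive (P i) := PathCocycle.isPrimitive_primitive _ _
  have : PathConnectedSpace I := isPathConnected_iff_pathConnectedSpace.1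
    ((convex_Icc (0 : ℝ) 1).isPathConnected ⟨0, by simp⟩)
  have hclosed (e : C(Cube3, X)) : IsClosedMap e := e.continuous.isClosedMap
  -- Primitives on `H` are primitives on everything that maps to `H`.
  have hglue {Z : Type} [TopologicalSpace Z] [PathConnectedSpace Z] (i : ι₂) (g : C(Z, Cube3))
      (hg : ∀ z, e₂ i (g z) ∈ H) (z z' : Z) :
      h (e₂ i (g z)) - P i (g z) = h (e₂ i (g z')) - P i (g z') := by
    have h1 := isPrimitive_comap_of_closed_cover hX e₁ (fun i => hclosed _) hh ((e₂ i).comp g)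
      (fun z => by simpa [hH] using hg z)
    have h2 : (c.comap ((e₂ i).comp g)).IsPrimitive (P i ∘ g) := (hP i).comap g
    exact h1.sub_eq h2 (PathConnectedSpace.joined z z')
  let vert (w : Cube3) : C(I, Cube3) := ⟨fun s => Function.update w 2 s, by fun_prop⟩
  let level (s : I) : C(Cube3, Cube3) := ⟨fun w => Function.update w 2 s, by fun_prop⟩
  have hself (w : Cube3) : Function.update w 2 (w 2) = w := Function.update_eq_self _ _
  -- On the part of a cube that lies in `H`, the primitive of the cube differs from `h` by a
  -- constant: the bottom and the top are connected, and `hhit` links them.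
  let k (i : ι₂) : A := h (e₂ i 0) - P i 0
  have hk (i : ι₂) (w : Cube3) (hw : e₂ i w ∈ H) : h (e₂ i w) = P i w + k i := by
    rw [← sub_eq_iff_eq_add']
    have h0 (w : Cube3) (hw : w 2 = 0) : h (e₂ i w) - P i w = k i := by
      have := hglue i (level 0) (fun z => hbot i _ (by simp [level])) w 0
      simp only [level, ContinuousMap.coe_mk] at this
      rwa [← hw, hself, hw, show Function.update (0 : Cube3) 2 0 = 0 from hself 0] at this
    have hv (w : Cube3) (hw : ∀ s, e₂ i (Function.update w 2 s) ∈ H) (s : I) :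
        h (e₂ i (Function.update w 2 s)) - P i (Function.update w 2 s) = k i := by
      rw [← h0 (Function.update w 2 0) (by simp)]
      exact hglue i (vert w) hw s 0
    rcases hside i w hw with h1 | h1 | h1
    · exact h0 w h1
    · obtain ⟨w₁, hw₁⟩ := hhit i
      rw [← hv w₁ hw₁ 1]
      have := hglue i (level 1) (fun z => htop i _ (by simp [level])) w w₁
      simp only [level, ContinuousMap.coe_mk] at this
      rwa [← h1, hself, h1] at this
    · rw [← hv w h1 (w 2), hself]
  -- Overlapping cubes share the vertical segment down to the bottom, which lies in `H`.
  have hval (i j : ι₂) (w w' : Cube3) (hww : e₂ i w = e₂ j w') : P i w + k i = P j w' + k j := by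
    let seg (w : Cube3) : Path (Function.update w 2 (w 2)) (Function.update w 2 0) :=
      ⟨(vert w).comp ⟨fun s : I => ⟨(w 2 : ℝ) * (1 - s), by
        constructor
        · exact mul_nonneg (w 2).2.1 (by linarith [s.2.2])
        · exact mul_le_one₀ (w 2).2.2 (by linarith [s.2.2]) (by linarith [s.2.1])⟩, by fun_prop⟩,
        by simp [vert], by simp [vert]⟩
    have hc (i : ι₂) (w : Cube3) : c.val ((seg w).map (e₂ i).continuous) =
        P i (Function.update w 2 0) - P i w := by
      have h0 : P i w = P i (Function.update w 2 (w 2)) := by rw [hself]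
      rw [h0]
      exact hP i (seg w)
    obtain ⟨hht, hww'⟩ := hvert i j w w' hww
    have h1 : c.val ((seg w).map (e₂ i).continuous) = c.val ((seg w').map (e₂ j).continuous) := by
      refine c.val_congr fun s => ?_
      simp only [seg, Path.map_coe, Function.comp, vert, hht]
      exact hww' _
    have h3 := hk i (Function.update w 2 0) (hbot i _ (by simp))
    rw [hww' 0, hk j _ (hbot j _ (by simp))] at h3
    rw [hc, hc] at h1
    rw [← sub_sub_cancel (P i (Function.update w 2 0)) (P i w), h1]
    rw [show P j w' + k j = (P j (Function.update w' 2 0) + k j) -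
      (P j (Function.update w' 2 0) - P j w') by abel, h3]
    abel
  -- The value on a point outside `H` is read off from any cube that contains it.
  have hdef (x : X) : ∃ a : A, (x ∈ H → a = h x) ∧ ∀ i w, e₂ i w = x → a = P i w + k i := by
    by_cases hx : x ∈ H
    · exact ⟨h x, fun _ => rfl, fun i w hw => by rw [← hw] at hx ⊢; exact hk i w hx⟩
    · obtain ⟨j, w', hw'⟩ := (hcov x).resolve_left hx
      exact ⟨P j w' + k j, fun h => absurd h hx, fun i w hw => hval j i w' w (hw'.trans hw.symm)⟩
  choose h' h1 h2 using hdef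
  refine ⟨h', isPrimitive_of_closed_cover hX (ι := ι₁ ⊕ ι₂) (W := fun _ => Cube3)
    (Sum.elim e₁ e₂) (fun i => hclosed _) (fun x => ?_) (fun i => ?_), h1⟩
  · rcases hcov x with hx | ⟨i, w, hw⟩
    · obtain ⟨i, w, hw⟩ := mem_iUnion.1 hx
      exact ⟨Sum.inl i, w, hw⟩
    · exact ⟨Sum.inr i, w, hw⟩
  · rcases i with i | i
    · have : h' ∘ e₁ i = h ∘ e₁ i := funext fun w => h1 _ (mem_iUnion.2 ⟨i, w, rfl⟩)
      simp only [Sum.elim_inl]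
      rw [this]
      exact hh i
    · have : h' ∘ e₂ i = fun w => P i w + k i := funext fun w => h2 _ i w rfl
      simp only [Sum.elim_inr]
      rw [this]
      exact (hP i).add_const _

end Extension

/-! ### The columns of a trivial tangle -/

/-- The piecewise linear homeomorphism from `[-1, 1]` to `[a, b]` that maps `0` to `x`. -/
noncomputable def stretch (a x b u : ℝ) : ℝ := x + (b - x) * max u 0 - (x - a) * max (-u) 0

section Stretch

variable {a x b : ℝ}

theorem continuous_stretch (a x b : ℝ) : Continuous (stretch a x b) := by
  unfold stretch; fun_prop

theorem stretch_zero : stretch a x b 0 = x := by simp [stretch]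

theorem stretch_one : stretch a x b 1 = b := by simp [stretch]

theorem stretch_neg_one : stretch a x b (-1) = a := by simp [stretch]

theorem strictMono_stretch (ha : a < x) (hb : x < b) : StrictMono (stretch a x b) := by
  intro u v huv
  unfold stretch
  have h1 : 0 < b - x := by linarith
  have h2 : 0 < x - a := by linarith
  rcases le_total 0 u with hu | hu
  · rw [max_eq_left hu, max_eq_left (hu.trans huv.le), max_eq_right (by linarith),
      max_eq_right (by linarith)]
    nlinarith
  · rcases le_total 0 v with hv | hv
    · rw [max_eq_right hu, max_eq_left hv, max_eq_left (by linarith), max_eq_right (by linarith)]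
      rcases hu.lt_or_eq with hu | rfl
      · nlinarith [mul_nonneg h1.le hv, mul_pos h2 (neg_pos.2 hu)]
      · nlinarith [mul_pos h1 huv]
    · rw [max_eq_right hu, max_eq_right hv, max_eq_left (by linarith), max_eq_left (by linarith)]
      nlinarith

theorem stretch_mem_Icc (ha : a < x) (hb : x < b) {u : ℝ} (hu : |u| ≤ 1) :
    stretch a x b u ∈ Icc a b := by
  rw [abs_le] at hu
  have h1 := (strictMono_stretch ha hb).monotone hu.1
  have h2 := (strictMono_stretch ha hb).monotone hu.2
  rw [stretch_neg_one] at h1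
  rw [stretch_one] at h2
  exact ⟨h1, h2⟩

theorem stretch_mem_Ioo (ha : a < x) (hb : x < b) {u : ℝ} (hu : |u| < 1) :
    stretch a x b u ∈ Ioo a b := by
  rw [abs_lt] at hu
  have h1 := strictMono_stretch ha hb hu.1
  have h2 := strictMono_stretch ha hb hu.2
  rw [stretch_neg_one] at h1
  rw [stretch_one] at h2
  exact ⟨h1, h2⟩

theorem exists_stretch_eq {y : ℝ} (hy : y ∈ Icc a b) :
    ∃ u, |u| ≤ 1 ∧ stretch a x b u = y := by
  have h := intermediate_value_Icc (show (-1 : ℝ) ≤ 1 by norm_num)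
    (continuous_stretch a x b).continuousOn
  rw [stretch_neg_one, stretch_one] at h
  obtain ⟨u, hu, h⟩ := h hy
  exact ⟨u, abs_le.2 hu, h⟩

end Stretch

/-- The position of the `k`-th arc of the trivial tangle. -/
noncomputable def arcPos (n k : ℕ) : ℝ := (2 * k + 1) / (2 * n)

/-- The left end of the column around the `k`-th arc. -/
noncomputable def colLeft (n k : ℕ) : ℝ := if k = 0 then 0 else (4 * k + 1) / (4 * n)

/-- The right end of the column around the `k`-th arc. -/
noncomputable def colRight (n k : ℕ) : ℝ := if k + 1 = n then 1 else (4 * k + 3) / (4 * n)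

section Positions

variable {n k : ℕ}

theorem colLeft_lt_arcPos (hk : k < n) : colLeft n k < arcPos n k := by
  have hn : (0 : ℝ) < n := by exact_mod_cast (by omega : 0 < n)
  unfold colLeft arcPos
  split_ifs with h
  · positivity
  · rw [div_lt_div_iff₀ (by positivity) (by positivity)]
    nlinarith

theorem arcPos_lt_colRight (hk : k < n) : arcPos n k < colRight n k := by
  have hn : (0 : ℝ) < n := by exact_mod_cast (by omega : 0 < n)
  unfold colRight arcPos
  split_ifs with h
  · rw [div_lt_one (by positivity), ← h]
    push_cast; linarith
  · rw [div_lt_div_iff₀ (by positivity) (by positivity)]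
    nlinarith

theorem colLeft_nonneg : 0 ≤ colLeft n k := by
  unfold colLeft; split_ifs <;> positivity

theorem colRight_le_one (hk : k < n) : colRight n k ≤ 1 := by
  have hn : (0 : ℝ) < n := by exact_mod_cast (by omega : 0 < n)
  unfold colRight
  split_ifs with h
  · exact le_rfl
  · rw [div_le_one (by positivity)]
    have : (k : ℝ) + 1 ≤ n := by exact_mod_cast hk
    linarith

theorem le_mul_colLeft (hn : 0 < n) (hk : k ≠ 0) : 4 * n * colLeft n k = 4 * k + 1 := by
  have hn : (0 : ℝ) < n := by exact_mod_cast hn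
  rw [colLeft, if_neg hk]
  field_simp

theorem mul_colRight (hn : 0 < n) (hk : k + 1 ≠ n) : 4 * n * colRight n k = 4 * k + 3 := by
  have hn : (0 : ℝ) < n := by exact_mod_cast hn
  rw [colRight, if_neg hk]
  field_simp

theorem mul_arcPos (hn : 0 < n) : 4 * n * arcPos n k = 4 * k + 2 := by
  have hn : (0 : ℝ) < n := by exact_mod_cast hn
  rw [arcPos]
  field_simp
  ring

/-- The columns around distinct arcs are disjoint. -/
theorem eq_of_mem_column {k' : ℕ} (hk : k < n) (hk' : k' < n) {x : ℝ}
    (hx : x ∈ Icc (colLeft n k) (colRight n k)) (hx' : x ∈ Icc (colLeft n k') (colRight n k')) :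
    k = k' := by
  wlog h : k < k' generalizing k k'
  · rcases (not_lt.1 h).lt_or_eq with h | h
    · exact (this hk' hk hx' hx h).symm
    · exact h.symm
  have hn : (0 : ℝ) < n := by exact_mod_cast (by omega : 0 < n)
  have h1 := mul_colRight (n := n) (k := k) (by omega) (by omega)
  have h2 := le_mul_colLeft (n := n) (k := k') (by omega) (by omega)
  have h3 : (k : ℝ) + 1 ≤ k' := by exact_mod_cast h
  have h4 : 4 * n * colLeft n k' ≤ 4 * n * colRight n k :=
    mul_le_mul_of_nonneg_left (hx'.1.trans hx.2) (by positivity)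
  linarith

/-- The position in the cube of a point of the `j`-th column between two arcs. -/
noncomputable def gapPos (n j : ℕ) (s : ℝ) : ℝ := (4 * j + 3 + 2 * s) / (4 * n)

theorem mul_gapPos (hn : 0 < n) (j : ℕ) (s : ℝ) : 4 * n * gapPos n j s = 4 * j + 3 + 2 * s := by
  have hn : (0 : ℝ) < n := by exact_mod_cast hn
  rw [gapPos]
  field_simp

theorem gapPos_mem_Ioo {j : ℕ} (hj : j + 1 < n) {s : ℝ} (hs : s ∈ Icc (0 : ℝ) 1) :
    gapPos n j s ∈ Ioo (0 : ℝ) 1 := by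
  have hn : (0 : ℝ) < n := by exact_mod_cast (by omega : 0 < n)
  have h3 : (j : ℝ) + 1 + 1 ≤ n := by exact_mod_cast hj
  have h0 := hs.1
  have h1 := hs.2
  rw [gapPos]
  refine ⟨by positivity, ?_⟩
  rw [div_lt_one (by positivity)]
  linarith

theorem gapPos_ne_arcPos {j : ℕ} (hn : 0 < n) {s : ℝ} (hs : s ∈ Icc (0 : ℝ) 1) :
    gapPos n j s ≠ arcPos n k := by
  intro h
  have h1 := mul_gapPos hn j s
  rw [h, mul_arcPos hn] at h1
  have h2 := hs.1
  have h3 := hs.2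
  have h4 : (j : ℝ) < k := by linarith
  have h5 : (k : ℝ) < j + 1 := by linarith
  have h6 : j < k := by exact_mod_cast h4
  have h7 : k < j + 1 := by exact_mod_cast h5
  omega

theorem gapPos_eq_iff {j j' : ℕ} (hn : 0 < n) {s s' : ℝ} (hs : s ∈ Icc (0 : ℝ) 1)
    (hs' : s' ∈ Icc (0 : ℝ) 1) : gapPos n j s = gapPos n j' s' ↔ j = j' ∧ s = s' := by
  refine ⟨fun h => ?_, by rintro ⟨rfl, rfl⟩; rfl⟩
  have h1 := mul_gapPos hn j s
  rw [h, mul_gapPos hn] at h1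
  have h2 := hs.1
  have h3 := hs.2
  have h2' := hs'.1
  have h3' := hs'.2
  have h4 : (j : ℝ) < j' + 1 := by linarith
  have h5 : (j' : ℝ) < j + 1 := by linarith
  have h6 : j < j' + 1 := by exact_mod_cast h4
  have h7 : j' < j + 1 := by exact_mod_cast h5
  obtain rfl : j = j' := by omega
  exact ⟨rfl, by linarith⟩

/-- A column between two arcs meets the columns around the arcs only in the common walls. -/
theorem gapPos_mem_column {j : ℕ} (hj : j + 1 < n) (hk : k < n) {s : ℝ} (hs : s ∈ Icc (0 : ℝ) 1)
    (h : gapPos n j s ∈ Icc (colLeft n k) (colRight n k)) :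
    (s = 0 ∧ k = j ∧ gapPos n j s = colRight n k) ∨
      (s = 1 ∧ k = j + 1 ∧ gapPos n j s = colLeft n k) := by
  have hn : (0 : ℝ) < n := by exact_mod_cast (by omega : 0 < n)
  have hn' : 0 < n := by omega
  have h1 := mul_gapPos hn' j s
  have h2 := hs.1
  have h3 := hs.2
  rcases le_or_gt k j with hkj | hkj
  · have h4 := mul_colRight (n := n) (k := k) (by omega) (by omega)
    have h5 : 4 * n * gapPos n j s ≤ 4 * n * colRight n k :=
      mul_le_mul_of_nonneg_left h.2 (by positivity)
    have h6 : (k : ℝ) ≤ j := by exact_mod_cast hkj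
    have h7 : s = 0 := by linarith
    have h8 : (k : ℝ) = j := by linarith
    refine Or.inl ⟨h7, by exact_mod_cast h8, ?_⟩
    apply mul_left_cancel₀ (show (4 * n : ℝ) ≠ 0 by positivity)
    linarith
  · have h4 := le_mul_colLeft (n := n) (k := k) (by omega) (by omega)
    have h5 : 4 * n * colLeft n k ≤ 4 * n * gapPos n j s :=
      mul_le_mul_of_nonneg_left h.1 (by positivity)
    have h6 : (j : ℝ) + 1 ≤ k := by exact_mod_cast hkj
    have h7 : s = 1 := by linarith
    have h8 : (k : ℝ) = (j + 1 : ℕ) := by push_cast; linarith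
    refine Or.inr ⟨h7, by exact_mod_cast h8, ?_⟩
    apply mul_left_cancel₀ (show (4 * n : ℝ) ≠ 0 by positivity)
    linarith

theorem gapPos_zero {j : ℕ} (hj : j + 1 < n) : gapPos n j 0 = colRight n j := by
  rw [gapPos, colRight, if_neg (by omega), mul_zero, add_zero]

theorem gapPos_one {j : ℕ} : gapPos n j 1 = colLeft n (j + 1) := by
  rw [gapPos, colLeft, if_neg (by omega)]
  push_cast; ring_nf

/-- The columns cover the cube. -/
theorem exists_column (hn : 0 < n) {x : ℝ} (hx : x ∈ Icc (0 : ℝ) 1) :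
    (∃ k < n, x ∈ Icc (colLeft n k) (colRight n k)) ∨
      ∃ j s, j + 1 < n ∧ s ∈ Icc (0 : ℝ) 1 ∧ x = gapPos n j s := by
  have hn' : (0 : ℝ) < n := by exact_mod_cast hn
  obtain ⟨k, hk, h1, h2⟩ : ∃ k < n, 4 * k ≤ 4 * n * x ∧ 4 * n * x ≤ 4 * k + 4 := by
    rcases hx.2.lt_or_eq with h | rfl
    · have h0 : 0 ≤ n * x := mul_nonneg hn'.le hx.1
      refine ⟨⌊n * x⌋₊, (Nat.floor_lt h0).2 (by nlinarith), ?_, ?_⟩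
      · linarith [Nat.floor_le h0]
      · linarith [(Nat.lt_floor_add_one (n * x)).le]
    · refine ⟨n - 1, by omega, ?_, ?_⟩ <;> rw [Nat.cast_sub hn] <;> push_cast <;> linarith
  have key (j : ℕ) (hj : j + 1 < n) (hl : 4 * j + 3 ≤ 4 * n * x) (hr : 4 * n * x ≤ 4 * j + 5) :
      ∃ j s, j + 1 < n ∧ s ∈ Icc (0 : ℝ) 1 ∧ x = gapPos n j s := by
    refine ⟨j, (4 * n * x - (4 * j + 3)) / 2, hj, ⟨by linarith, by linarith⟩, ?_⟩
    rw [gapPos]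
    field_simp
    ring
  rcases le_or_gt (4 * n * x) (4 * k + 1) with h3 | h3
  · rcases Nat.eq_zero_or_pos k with rfl | hk0
    · refine Or.inl ⟨0, hk, by simpa [colLeft] using hx.1, ?_⟩
      by_cases hn1 : 0 + 1 = n
      · rw [colRight, if_pos hn1]; exact hx.2
      · rw [colRight, if_neg hn1, le_div_iff₀ (by positivity)]
        push_cast at h3 ⊢
        linarith
    · refine Or.inr (key (k - 1) (by omega) ?_ ?_) <;> rw [Nat.cast_sub hk0] <;> push_cast <;>
        linarith
  rcases le_or_gt (4 * n * x) (4 * k + 3) with h4 | h4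
  · refine Or.inl ⟨k, hk, ?_, ?_⟩
    · rw [colLeft]
      split_ifs
      · exact hx.1
      · rw [div_le_iff₀ (by positivity)]; linarith
    · rw [colRight]
      split_ifs
      · exact hx.2
      · rw [le_div_iff₀ (by positivity)]; linarith
  · by_cases hn1 : k + 1 = n
    · refine Or.inl ⟨k, hk, ?_, ?_⟩
      · rw [colLeft]
        split_ifs
        · exact hx.1
        · rw [div_le_iff₀ (by positivity)]; linarith
      · rw [colRight, if_pos hn1]; exact hx.2
    · exact Or.inr (key k (by omega) h4.le (by linarith))

end Positions

/-! ### The pieces of the preimage of a ball with a trivial tangle -/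

section TangleBall

variable {Y : Type*} [TopologicalSpace Y]

/-- `h` parametrises a closed ball that meets `K` in a trivial `n`-tangle. -/
structure IsTangleBall (n : ℕ) (K : Set Y) (h : Cube3 → Y) : Prop where
  isEmbedding : Topology.IsEmbedding h
  preimage_eq : h ⁻¹' K = trivialTangle n
  range_mem_nhds : ∀ w ∉ Cube.boundary (Fin 3), range h ∈ 𝓝 (h w)

/-- The point of the cube with the given coordinates, clamped to the unit interval. -/
noncomputable def cubePoint (x y t : ℝ) : Cube3 :=
  ![projIcc 0 1 zero_le_one x, projIcc 0 1 zero_le_one y, projIcc 0 1 zero_le_one t]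

@[fun_prop]
theorem continuous_cubePoint {Z : Type*} [TopologicalSpace Z] {x y t : Z → ℝ} (hx : Continuous x)
    (hy : Continuous y) (ht : Continuous t) : Continuous fun z => cubePoint (x z) (y z) (t z) := by
  refine continuous_pi fun i => ?_
  fin_cases i
  · exact (continuous_projIcc (h := zero_le_one)).comp hx
  · exact (continuous_projIcc (h := zero_le_one)).comp hy
  · exact (continuous_projIcc (h := zero_le_one)).comp ht

theorem cubePoint_zero {x : ℝ} (y t : ℝ) (hx : x ∈ Icc (0 : ℝ) 1) :
    (cubePoint x y t 0 : ℝ) = x := by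
  simp [cubePoint, projIcc_of_mem _ hx]

theorem cubePoint_one (x : ℝ) {y : ℝ} (t : ℝ) (hy : y ∈ Icc (0 : ℝ) 1) :
    (cubePoint x y t 1 : ℝ) = y := by
  simp [cubePoint, projIcc_of_mem _ hy]

theorem cubePoint_two (x y : ℝ) {t : ℝ} (ht : t ∈ Icc (0 : ℝ) 1) :
    (cubePoint x y t 2 : ℝ) = t := by
  simp [cubePoint, projIcc_of_mem _ ht]

theorem cubePoint_two_coe (x y : ℝ) (t : I) : cubePoint x y t 2 = t := by
  simp [cubePoint]

theorem cubePoint_coe (w : Cube3) : cubePoint (w 0) (w 1) (w 2) = w := by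
  ext i; fin_cases i <;> simp [cubePoint]

theorem update_cubePoint (x y : ℝ) (t : ℝ) (s : I) :
    Function.update (cubePoint x y t) 2 s = cubePoint x y s := by
  ext i; fin_cases i <;> simp [cubePoint]

theorem mem_trivialTangle_cubePoint {n : ℕ} {x y : ℝ} (t : ℝ) (hx : x ∈ Icc (0 : ℝ) 1)
    (hy : y ∈ Icc (0 : ℝ) 1) :
    cubePoint x y t ∈ trivialTangle n ↔ (∃ k < n, x = arcPos n k) ∧ y = 1 / 2 := by
  rw [trivialTangle, mem_ofPred_eq, cubePoint_zero _ _ hx, cubePoint_one _ _ hy]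
  refine and_congr_left fun _ => ⟨fun ⟨k, hk⟩ => ⟨k, k.2, hk⟩, fun ⟨k, hk, h⟩ => ⟨⟨k, hk⟩, h⟩⟩

theorem cubePoint_injOn : InjOn (fun q : (ℝ × ℝ) × ℝ => cubePoint q.1.1 q.1.2 q.2)
    ((Icc 0 1 ×ˢ Icc 0 1) ×ˢ Icc 0 1) := by
  rintro ⟨⟨x, y⟩, t⟩ ⟨⟨hx, hy⟩, ht⟩ ⟨⟨x', y'⟩, t'⟩ ⟨⟨hx', hy'⟩, ht'⟩ h
  have h0 := congrArg (fun w : Cube3 => (w 0 : ℝ)) h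
  have h1 := congrArg (fun w : Cube3 => (w 1 : ℝ)) h
  have h2 := congrArg (fun w : Cube3 => (w 2 : ℝ)) h
  simp only [cubePoint_zero _ _ hx, cubePoint_zero _ _ hx'] at h0
  simp only [cubePoint_one _ _ hy, cubePoint_one _ _ hy'] at h1
  simp only [cubePoint_two _ _ ht, cubePoint_two _ _ ht'] at h2
  rw [h0, h1, h2]

theorem cubePoint_notMem_boundary {x y t : ℝ} (hx : x ∈ Ioo (0 : ℝ) 1) (hy : y ∈ Ioo (0 : ℝ) 1)
    (ht : t ∈ Ioo (0 : ℝ) 1) : cubePoint x y t ∉ Cube.boundary (Fin 3) := by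
  have h0 := cubePoint_zero y t (Ioo_subset_Icc_self hx)
  have h1 := cubePoint_one x t (Ioo_subset_Icc_self hy)
  have h2 := cubePoint_two x y (Ioo_subset_Icc_self ht)
  have key (i : Fin 3) (r : ℝ) (hr : r ∈ Ioo (0 : ℝ) 1) (h : (cubePoint x y t i : ℝ) = r) :
      ¬ (cubePoint x y t i = 0 ∨ cubePoint x y t i = 1) := by
    rintro (h' | h') <;> rw [h'] at h <;> simp at h <;> rw [← h] at hr <;> simp at hr
  rintro ⟨i, hi⟩
  fin_cases i
  exacts [key 0 x hx h0 hi, key 1 y hy h1 hi, key 2 t ht h2 hi]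

theorem IsTangleBall.image_mem_nhds {n : ℕ} {K : Set Y} {h : Cube3 → Y} (hT : IsTangleBall n K h)
    {w : Cube3} (hw : w ∉ Cube.boundary (Fin 3)) {U : Set Cube3} (hU : U ∈ 𝓝 w) :
    h '' U ∈ 𝓝 (h w) := by
  rw [← hT.isEmbedding.isInducing.map_nhds_of_mem _ (hT.range_mem_nhds w hw)]
  exact image_mem_map hU

/-- The horizontal coordinates of a point of the column around the `k`-th arc. -/
noncomputable def columnPos (n k : ℕ) (z : ℝ × ℝ) : ℝ × ℝ :=
  (stretch (colLeft n k) (arcPos n k) (colRight n k) z.1, 1 / 2 + z.2 / 2)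

theorem continuous_columnPos (n k : ℕ) : Continuous (columnPos n k) := by
  have := continuous_stretch (colLeft n k) (arcPos n k) (colRight n k)
  unfold columnPos; fun_prop

variable {n k : ℕ}

theorem columnPos_fst_mem (hk : k < n) {z : ℝ × ℝ} (hz : ‖z‖ ≤ 1) :
    (columnPos n k z).1 ∈ Icc (colLeft n k) (colRight n k) :=
  stretch_mem_Icc (colLeft_lt_arcPos hk) (arcPos_lt_colRight hk) ((norm_fst_le z).trans hz)

theorem columnPos_mem (hk : k < n) {z : ℝ × ℝ} (hz : ‖z‖ ≤ 1) :
    columnPos n k z ∈ Icc (0 : ℝ) 1 ×ˢ Icc (0 : ℝ) 1 := by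
  have h1 := columnPos_fst_mem hk hz
  refine ⟨⟨colLeft_nonneg.trans h1.1, h1.2.trans (colRight_le_one hk)⟩, ?_⟩
  have := abs_le.1 ((norm_snd_le z).trans hz)
  constructor <;> simp only [columnPos] <;> linarith

theorem columnPos_mem_Ioo (hk : k < n) {z : ℝ × ℝ} (hz : ‖z‖ < 1) :
    columnPos n k z ∈ Ioo (0 : ℝ) 1 ×ˢ Ioo (0 : ℝ) 1 := by
  have h1 := stretch_mem_Ioo (colLeft_lt_arcPos hk) (arcPos_lt_colRight hk)
    ((norm_fst_le z).trans_lt hz)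
  refine ⟨⟨colLeft_nonneg.trans_lt h1.1, h1.2.trans_le (colRight_le_one hk)⟩, ?_⟩
  have := abs_lt.1 ((norm_snd_le z).trans_lt hz)
  constructor <;> simp only [columnPos] <;> linarith

theorem columnPos_injective (hk : k < n) : Function.Injective (columnPos n k) := by
  rintro ⟨a, b⟩ ⟨a', b'⟩ h
  have h1 := (strictMono_stretch (colLeft_lt_arcPos hk) (arcPos_lt_colRight hk)).injective
    (congrArg Prod.fst h)
  have h2 := congrArg Prod.snd h
  simp only [columnPos] at h2
  exact Prod.ext h1 (by simp only; linarith)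

theorem columnPos_zero : columnPos n k 0 = (arcPos n k, 1 / 2) := by
  simp [columnPos, stretch_zero]

theorem arcPos_mem (hk : k < n) : arcPos n k ∈ Ioo (0 : ℝ) 1 :=
  ⟨colLeft_nonneg.trans_lt (colLeft_lt_arcPos hk),
    (arcPos_lt_colRight hk).trans_le (colRight_le_one hk)⟩

theorem exists_columnPos_eq {x y : ℝ} (hx : x ∈ Icc (colLeft n k) (colRight n k))
    (hy : y ∈ Icc (0 : ℝ) 1) : ∃ z, ‖z‖ ≤ 1 ∧ columnPos n k z = (x, y) := by
  obtain ⟨u, hu, h⟩ := exists_stretch_eq (x := arcPos n k) hx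
  refine ⟨(u, 2 * y - 1), ?_, Prod.ext h ?_⟩
  · rw [Prod.norm_def, max_le_iff]
    exact ⟨hu, abs_le.2 ⟨by simp only; linarith [hy.1], by simp only; linarith [hy.2]⟩⟩
  · simp only [columnPos]; ring

theorem columnPos_fst_eq_arcPos_iff {k' : ℕ} (hk : k < n) (hk' : k' < n) {z : ℝ × ℝ}
    (hz : ‖z‖ ≤ 1) (h2 : (columnPos n k z).2 = 1 / 2) :
    (columnPos n k z).1 = arcPos n k' ↔ k = k' ∧ z = 0 := by
  constructor
  · intro h
    have h1 := columnPos_fst_mem hk hz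
    rw [h] at h1
    obtain rfl := eq_of_mem_column hk hk' h1
      ⟨(colLeft_lt_arcPos hk').le, (arcPos_lt_colRight hk').le⟩
    refine ⟨rfl, columnPos_injective hk ?_⟩
    rw [columnPos_zero]
    exact Prod.ext h h2
  · rintro ⟨rfl, rfl⟩
    rw [columnPos_zero]

namespace IsTangleBall

variable {K : Set Y} {h : Cube3 → Y} (hT : IsTangleBall n K h)

include hT in
theorem mem_iff (w : Cube3) : h w ∈ K ↔ w ∈ trivialTangle n := by
  rw [← hT.preimage_eq, mem_preimage]

/-- The column around the `k`-th arc of a trivial tangle. -/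
noncomputable def column (k : Fin n) : TangleColumn K where
  toFun := ⟨fun q => h (cubePoint (columnPos n k q.1).1 (columnPos n k q.1).2 q.2), by
    have := hT.isEmbedding.continuous
    have h2 : Continuous fun q : (ℝ × ℝ) × ℝ => columnPos n k q.1 :=
      (continuous_columnPos n k).comp continuous_fst
    exact this.comp (continuous_cubePoint h2.fst h2.snd continuous_snd)⟩
  injOn := by
    rintro ⟨z, t⟩ ⟨hz, ht⟩ ⟨z', t'⟩ ⟨hz', ht'⟩ heq
    replace hz : ‖z‖ ≤ 1 := mem_closedBall_zero_iff.1 hz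
    replace hz' : ‖z'‖ ≤ 1 := mem_closedBall_zero_iff.1 hz'
    have h1 := cubePoint_injOn (x₁ := (columnPos n k z, t)) (x₂ := (columnPos n k z', t'))
      ⟨columnPos_mem k.2 hz, ht⟩ ⟨columnPos_mem k.2 hz', ht'⟩ (hT.isEmbedding.injective heq)
    have h2 : t = t' := congrArg Prod.snd h1
    exact Prod.ext (columnPos_injective k.2 (congrArg Prod.fst h1)) h2
  mem_iff := by
    intro z t hz ht
    have hmem := columnPos_mem k.2 hz
    rw [ContinuousMap.coe_mk, hT.mem_iff, mem_trivialTangle_cubePoint _ hmem.1 hmem.2]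
    constructor
    · rintro ⟨⟨k', hk', h1⟩, h2⟩
      exact ((columnPos_fst_eq_arcPos_iff k.2 hk' hz h2).1 h1).2
    · rintro rfl
      rw [columnPos_zero]
      exact ⟨⟨k, k.2, rfl⟩, rfl⟩
  image_mem_nhds := by
    intro t ht
    have hnb : cubePoint (arcPos n k) (1 / 2) t ∉ Cube.boundary (Fin 3) :=
      cubePoint_notMem_boundary (arcPos_mem k.2) (by norm_num) ht
    have hU : {w : Cube3 | (w 0 : ℝ) ∈ Ioo (colLeft n k) (colRight n k)} ∈
        𝓝 (cubePoint (arcPos n k) (1 / 2) t) := by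
      refine (isOpen_Ioo.preimage (by fun_prop : Continuous fun w : Cube3 => (w 0 : ℝ))).mem_nhds ?_
      rw [mem_preimage, cubePoint_zero _ _ (Ioo_subset_Icc_self (arcPos_mem k.2))]
      exact ⟨colLeft_lt_arcPos k.2, arcPos_lt_colRight k.2⟩
    have h1 := hT.image_mem_nhds hnb hU
    simp only [ContinuousMap.coe_mk, columnPos_zero]
    refine mem_of_superset h1 ?_
    rintro _ ⟨w, hw, rfl⟩
    obtain ⟨z, hz, hz'⟩ := exists_columnPos_eq (n := n) (k := k) (Ioo_subset_Icc_self hw) (w 1).2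
    refine ⟨(z, w 2), ⟨mem_closedBall_zero_iff.2 hz, (w 2).2⟩, ?_⟩
    simp only
    rw [hz', cubePoint_coe]

theorem column_apply (k : Fin n) (z : ℝ × ℝ) (t : ℝ) : (hT.column k).toFun (z, t) =
    h (cubePoint (columnPos n k z).1 (columnPos n k z).2 t) := rfl

end IsTangleBall

end TangleBall

section SquareCoord

/-- The horizontal coordinates of a point of the cube, rescaled to `[-1, 1]²`. -/
noncomputable def squareCoord (w : Cube3) : ℝ × ℝ := (2 * w 0 - 1, 2 * w 1 - 1)

@[fun_prop]
theorem continuous_squareCoord : Continuous squareCoord := by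
  unfold squareCoord; fun_prop

theorem norm_squareCoord_le (w : Cube3) : ‖squareCoord w‖ ≤ 1 := by
  have h0 := (w 0).2
  have h1 := (w 1).2
  rw [squareCoord, Prod.norm_def, max_le_iff]
  exact ⟨abs_le.2 ⟨by linarith [h0.1], by linarith [h0.2]⟩,
    abs_le.2 ⟨by linarith [h1.1], by linarith [h1.2]⟩⟩

theorem abs_two_mul_sub_one_lt {s : I} (h0 : s ≠ 0) (h1 : s ≠ 1) : |2 * (s : ℝ) - 1| < 1 := by
  have h2 : (0 : ℝ) < s := lt_of_le_of_ne s.2.1 fun h => h0 (Subtype.ext h.symm)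
  have h3 : (s : ℝ) < 1 := lt_of_le_of_ne s.2.2 fun h => h1 (Subtype.ext h)
  exact abs_lt.2 ⟨by linarith, by linarith⟩

theorem norm_squareCoord_lt {w : Cube3} (h0 : w 0 ≠ 0) (h0' : w 0 ≠ 1) (h1 : w 1 ≠ 0)
    (h1' : w 1 ≠ 1) : ‖squareCoord w‖ < 1 := by
  rw [squareCoord, Prod.norm_def, max_lt_iff]
  exact ⟨abs_two_mul_sub_one_lt h0 h0', abs_two_mul_sub_one_lt h1 h1'⟩

theorem mem_boundary_of_norm_squareCoord {w : Cube3} (h : ‖squareCoord w‖ = 1) :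
    w ∈ Cube.boundary (Fin 3) := by
  by_contra hw
  simp only [Cube.boundary, mem_ofPred_eq, not_exists, not_or] at hw
  exact (norm_squareCoord_lt (hw 0).1 (hw 0).2 (hw 1).1 (hw 1).2).ne h

theorem squareCoord_injective {w w' : Cube3} (h : squareCoord w = squareCoord w')
    (h2 : (w 2 : ℝ) = w' 2) : w = w' := by
  have h0 := congrArg Prod.fst h
  have h1 := congrArg Prod.snd h
  simp only [squareCoord] at h0 h1
  ext i
  fin_cases i
  · change (w 0 : ℝ) = w' 0; linarith
  · change (w 1 : ℝ) = w' 1; linarith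
  · exact h2

theorem exists_squareCoord_eq {z : ℝ × ℝ} (hz : ‖z‖ ≤ 1) (t : I) :
    ∃ w : Cube3, squareCoord w = z ∧ w 2 = t := by
  have h0 := abs_le.1 ((norm_fst_le z).trans hz)
  have h1 := abs_le.1 ((norm_snd_le z).trans hz)
  refine ⟨cubePoint ((z.1 + 1) / 2) ((z.2 + 1) / 2) t, ?_, cubePoint_two_coe _ _ _⟩
  rw [squareCoord, cubePoint_zero _ _ ⟨by linarith, by linarith⟩,
    cubePoint_one _ _ ⟨by linarith, by linarith⟩]
  ext <;> simp only <;> ring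

theorem squareCoord_update (w : Cube3) (s : I) :
    squareCoord (Function.update w 2 s) = squareCoord w := by
  simp [squareCoord]

end SquareCoord

namespace IsTangleBall

open TangleColumn.PolarLift

variable {Y : Type*} [TopologicalSpace Y] {n : ℕ} {K : Set Y} {h : Cube3 → Y}
  (hT : IsTangleBall n K h) {M : Type*} [TopologicalSpace M] {f : M → Y}

/-- The column between the arcs `j` and `j + 1` of a trivial tangle. -/
noncomputable def gapMap (j : Fin (n - 1)) : C(Cube3, Y) :=
  ⟨fun w => h (cubePoint (gapPos n j (w 0)) (w 1) (w 2)), by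
    have h1 := hT.isEmbedding.continuous
    unfold gapPos
    fun_prop⟩

theorem gapMap_apply (j : Fin (n - 1)) (w : Cube3) :
    hT.gapMap j w = h (cubePoint (gapPos n j (w 0)) (w 1) (w 2)) := rfl

theorem gapPos_notMem (j : Fin (n - 1)) (w : Cube3) (t : ℝ) :
    cubePoint (gapPos n j (w 0)) (w 1) t ∉ trivialTangle n := by
  have hj := j.2
  rw [mem_trivialTangle_cubePoint _ (Ioo_subset_Icc_self (gapPos_mem_Ioo (by omega) (w 0).2))
    (w 1).2]
  rintro ⟨⟨k, -, h1⟩, -⟩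
  exact gapPos_ne_arcPos (by omega) (w 0).2 h1

theorem gapMap_notMem (j : Fin (n - 1)) (w : Cube3) : hT.gapMap j w ∈ Kᶜ := by
  rw [mem_compl_iff, gapMap_apply, hT.mem_iff]
  exact gapPos_notMem j w _

/-- The lifts to the branched cover of a column between two arcs. -/
def GapLift (f : M → Y) (hT : IsTangleBall n K h) (j : Fin (n - 1)) : Type _ :=
  {E : C(Cube3, M) // ∀ w, f (E w) = hT.gapMap j w}

theorem exists_gapLift_eq (hf : IsBranchedCover f K) {j : Fin (n - 1)} {x : M} {w : Cube3}
    (hx : f x = hT.gapMap j w) : ∃ E : GapLift f hT j, E.1 w = x := by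
  obtain ⟨F, h1, h2⟩ := hf.exists_lift (hT.gapMap j) (hT.gapMap_notMem j) hx
  exact ⟨⟨F, h2⟩, h1⟩

theorem gapLift_ext (hf : IsBranchedCover f K) {j : Fin (n - 1)} {E E' : GapLift f hT j}
    {w : Cube3} (hw : E.1 w = E'.1 w) : E = E' :=
  Subtype.ext <| hf.lift_unique (fun a => (E.2 a).trans (E'.2 a).symm)
    (fun a => by rw [E.2 a]; exact hT.gapMap_notMem j a) hw

/-- A lift of a column between two arcs is determined by its value at a point. -/
noncomputable def gapLiftEquivFiber (hf : IsBranchedCover f K) (j : Fin (n - 1)) (w : Cube3) :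
    GapLift f hT j ≃ f ⁻¹' {hT.gapMap j w} :=
  Equiv.ofBijective (fun E => ⟨E.1 w, E.2 w⟩)
    ⟨fun _ _ h => gapLift_ext hT hf (congrArg Subtype.val h), fun x => by
      obtain ⟨E, hE⟩ := exists_gapLift_eq hT hf x.2
      exact ⟨E, Subtype.ext hE⟩⟩

theorem finite_gapLift (hf : IsBranchedCover f K) (j : Fin (n - 1)) : Finite (GapLift f hT j) :=
  have := (hf.finite_fiber (hT.gapMap j 0)).to_subtype
  Finite.of_equiv _ (gapLiftEquivFiber hT hf j 0).symm

/-- The index set of the balls of the handlebody over a tangle ball. -/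
abbrev BallIndex (f : M → Y) (hT : IsTangleBall n K h) : Type _ :=
  Σ k : Fin n, Orbits f (hT.column k)

/-- The index set of the handles of the handlebody over a tangle ball. -/
abbrev HandleIndex (f : M → Y) (hT : IsTangleBall n K h) : Type _ :=
  Σ j : Fin (n - 1), GapLift f hT j

theorem finite_ballIndex (hf : IsBranchedCover f K) : Finite (BallIndex f hT) :=
  have (k : Fin n) : Finite (Orbits f (hT.column k)) := finite_orbits hf
  inferInstance

theorem finite_handleIndex (hf : IsBranchedCover f K) : Finite (HandleIndex f hT) :=
  have (j : Fin (n - 1)) : Finite (GapLift f hT j) := hT.finite_gapLift hf j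
  inferInstance

/-- The handles of the handlebody over a tangle ball. -/
def handleMap (a : HandleIndex f hT) : C(Cube3, M) := a.2.1

/-- The projection of a handle to the tangle ball. -/
noncomputable def handleShadow (a : HandleIndex f hT) (w : Cube3) : Cube3 :=
  cubePoint (gapPos n a.1 (w 0)) (w 1) (w 2)

theorem apply_handleMap (a : HandleIndex f hT) (w : Cube3) :
    f (hT.handleMap a w) = h (hT.handleShadow a w) := a.2.2 w

theorem handleMap_eq (hf : IsBranchedCover f K) {a a' : HandleIndex f hT} {w w' : Cube3}
    (heq : hT.handleMap a w = hT.handleMap a' w') : a = a' ∧ w = w' := by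
  obtain ⟨j, E⟩ := a
  obtain ⟨j', E'⟩ := a'
  have h1 : (⟨j, E⟩ : HandleIndex f hT).1 = j := rfl
  have hs := hT.isEmbedding.injective
    ((hT.apply_handleMap ⟨j, E⟩ w).symm.trans
      ((congrArg f heq).trans (hT.apply_handleMap ⟨j', E'⟩ w')))
  have hj := j.2
  have hj' := j'.2
  have h2 := cubePoint_injOn (x₁ := ((gapPos n j (w 0), w 1), w 2))
    (x₂ := ((gapPos n j' (w' 0), w' 1), w' 2))
    ⟨⟨Ioo_subset_Icc_self (gapPos_mem_Ioo (by omega) (w 0).2), (w 1).2⟩, (w 2).2⟩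
    ⟨⟨Ioo_subset_Icc_self (gapPos_mem_Ioo (by omega) (w' 0).2), (w' 1).2⟩, (w' 2).2⟩ hs
  simp only [Prod.mk.injEq] at h2
  obtain ⟨⟨h3, h4⟩, h5⟩ := h2
  obtain ⟨h6, h7⟩ := (gapPos_eq_iff (by omega) (w 0).2 (w' 0).2).1 h3
  have hw : w = w' := by
    ext i; fin_cases i
    exacts [h7, h4, h5]
  obtain rfl : j = j' := Fin.ext h6
  subst hw
  obtain rfl : E = E' := hT.gapLift_ext hf heq
  exact ⟨rfl, rfl⟩

variable [T2Space M] [T2Space Y] [CompactSpace M] (hf : IsBranchedCover f K)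

/-- The balls of the handlebody over a tangle ball. -/
noncomputable def ballMap (b : BallIndex f hT) : C(Cube3, M) :=
  ⟨fun w => piece hf b.2 (squareCoord w, w 2), by fun_prop⟩

/-- The projection of a ball to the tangle ball. -/
noncomputable def ballShadow (b : BallIndex f hT) (w : Cube3) : Cube3 :=
  let z := columnPos n b.1 (branchMap b.2.out.index (squareCoord w))
  cubePoint z.1 z.2 (w 2)

theorem apply_ballMap (b : BallIndex f hT) (w : Cube3) :
    f (hT.ballMap hf b w) = h (hT.ballShadow b w) :=
  (apply_piece hf b.2 (norm_squareCoord_le w) (w 2).2).trans rfl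

theorem ballMap_eq {b b' : BallIndex f hT} {w w' : Cube3}
    (heq : hT.ballMap hf b w = hT.ballMap hf b' w') : b = b' ∧ w = w' := by
  obtain ⟨k, ω⟩ := b
  obtain ⟨k', ω'⟩ := b'
  have hs := hT.isEmbedding.injective
    ((hT.apply_ballMap hf ⟨k, ω⟩ w).symm.trans
      ((congrArg f heq).trans (hT.apply_ballMap hf ⟨k', ω'⟩ w')))
  have hn (d : ℕ) (w : Cube3) : ‖branchMap d (squareCoord w)‖ ≤ 1 := by
    rw [norm_branchMap]; exact norm_squareCoord_le w
  have h2 := cubePoint_injOn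
    (x₁ := (columnPos n k (branchMap ω.out.index (squareCoord w)), w 2))
    (x₂ := (columnPos n k' (branchMap ω'.out.index (squareCoord w')), w' 2))
    ⟨columnPos_mem k.2 (hn _ _), (w 2).2⟩ ⟨columnPos_mem k'.2 (hn _ _), (w' 2).2⟩ hs
  simp only [Prod.mk.injEq] at h2
  have h3 := columnPos_fst_mem k.2 (hn ω.out.index w)
  rw [h2.1] at h3
  obtain rfl : k = k' := Fin.ext (eq_of_mem_column k.2 k'.2 h3 (columnPos_fst_mem k'.2 (hn _ _)))
  obtain rfl : ω = ω' := orbits_eq_of_piece_eq hf (norm_squareCoord_le w) (norm_squareCoord_le w')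
    (w 2).2 (w' 2).2 heq
  have h4 := fill_injOn hf ω.out (x₁ := (squareCoord w, w 2)) (x₂ := (squareCoord w', w' 2))
    ⟨mem_closedBall_zero_iff.2 (norm_squareCoord_le w), (w 2).2⟩
    ⟨mem_closedBall_zero_iff.2 (norm_squareCoord_le w'), (w' 2).2⟩ heq
  exact ⟨rfl, squareCoord_injective (congrArg Prod.fst h4) (congrArg Prod.snd h4)⟩

theorem exists_ballMap_eq {x : M} {v : Cube3} (hx : f x = h v) {k : ℕ} (hk : k < n)
    (hv : (v 0 : ℝ) ∈ Icc (colLeft n k) (colRight n k)) : ∃ b w, hT.ballMap hf b w = x := by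
  obtain ⟨z, hz, hz'⟩ := exists_columnPos_eq (n := n) (k := k) hv (v 1).2
  have h1 : f x = (hT.column ⟨k, hk⟩).toFun (z, v 2) := by
    rw [hx, column_apply, hz', cubePoint_coe]
  obtain ⟨ω, z', hz', rfl⟩ := exists_piece_eq hf hz (v 2).2 h1
  obtain ⟨w, rfl, hw⟩ := exists_squareCoord_eq hz' (v 2)
  refine ⟨⟨⟨k, hk⟩, ω⟩, w, ?_⟩
  rw [ballMap, ContinuousMap.coe_mk, hw]

/-- The balls and handles over a tangle ball. -/
noncomputable def pieceMap : BallIndex f hT ⊕ HandleIndex f hT → C(Cube3, M) :=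
  Sum.elim (hT.ballMap hf) hT.handleMap

/-- The projections of the balls and handles to the tangle ball. -/
noncomputable def shadow : BallIndex f hT ⊕ HandleIndex f hT → Cube3 → Cube3 :=
  Sum.elim hT.ballShadow hT.handleShadow

theorem apply_pieceMap (i : BallIndex f hT ⊕ HandleIndex f hT) (w : Cube3) :
    f (hT.pieceMap hf i w) = h (hT.shadow i w) := by
  rcases i with b | a
  exacts [hT.apply_ballMap hf b w, hT.apply_handleMap a w]

theorem pieceMap_injective (i : BallIndex f hT ⊕ HandleIndex f hT) :
    Function.Injective (hT.pieceMap hf i) := by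
  intro w w' h
  rcases i with b | a
  exacts [(hT.ballMap_eq hf h).2, (hT.handleMap_eq hf h).2]

theorem isClosedEmbedding_pieceMap (i : BallIndex f hT ⊕ HandleIndex f hT) :
    Topology.IsClosedEmbedding (hT.pieceMap hf i) :=
  (hT.pieceMap hf i).continuous.isClosedEmbedding (hT.pieceMap_injective hf i)

theorem exists_pieceMap_eq (hn : 0 < n) {x : M} (hx : f x ∈ range h) :
    ∃ i w, hT.pieceMap hf i w = x := by
  obtain ⟨v, hv⟩ := hx
  rcases exists_column hn (v 0).2 with ⟨k, hk, hkv⟩ | ⟨j, s, hj, hs, hjs⟩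
  · obtain ⟨b, w, hw⟩ := hT.exists_ballMap_eq hf hv.symm hk hkv
    exact ⟨Sum.inl b, w, hw⟩
  · have h1 : f x = hT.gapMap ⟨j, by omega⟩ ![⟨s, hs⟩, v 1, v 2] := by
      rw [← hv, gapMap_apply]
      simp only [Matrix.cons_val_zero, Matrix.cons_val_one, Matrix.cons_val]
      rw [← hjs, cubePoint_coe]
    obtain ⟨E, hE⟩ := hT.exists_gapLift_eq hf h1
    exact ⟨Sum.inr ⟨_, E⟩, _, hE⟩

omit [T2Space M] [T2Space Y] [CompactSpace M] in
/-- Vertical segments of a piece are mapped to vertical segments of the tangle ball. -/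
theorem shadow_update (i : BallIndex f hT ⊕ HandleIndex f hT) (w : Cube3) (s : I) :
    hT.shadow i (Function.update w 2 s) = Function.update (hT.shadow i w) 2 s := by
  rcases i with b | a
  · simp [shadow, ballShadow, squareCoord_update, update_cubePoint]
  · simp [shadow, handleShadow, update_cubePoint]

omit [T2Space M] [T2Space Y] [CompactSpace M] in
theorem shadow_two (i : BallIndex f hT ⊕ HandleIndex f hT) (w : Cube3) :
    hT.shadow i w 2 = w 2 := by
  rcases i with b | a <;> simp [shadow, ballShadow, handleShadow, cubePoint_two_coe]

omit [T2Space M] [T2Space Y] [CompactSpace M] in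
theorem handleShadow_notMem (a : HandleIndex f hT) (w : Cube3) (s : I) :
    Function.update (hT.handleShadow a w) 2 s ∉ trivialTangle n := by
  rw [handleShadow, update_cubePoint]
  exact gapPos_notMem _ _ _

/-- Two pieces that share a point share the vertical segment through it. -/
theorem pieceMap_update_eq {i i' : BallIndex f hT ⊕ HandleIndex f hT} {w w' : Cube3}
    (heq : hT.pieceMap hf i w = hT.pieceMap hf i' w') :
    w 2 = w' 2 ∧ ∀ s, hT.pieceMap hf i (Function.update w 2 s) =
      hT.pieceMap hf i' (Function.update w' 2 s) := by
  have hsh : hT.shadow i w = hT.shadow i' w' := hT.isEmbedding.injective (by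
    rw [← hT.apply_pieceMap hf, ← hT.apply_pieceMap hf, heq])
  have h2 : w 2 = w' 2 := by rw [← hT.shadow_two i w, ← hT.shadow_two i' w', hsh]
  refine ⟨h2, ?_⟩
  by_cases hK : ∀ s, Function.update (hT.shadow i w) 2 s ∉ trivialTangle n
  -- Away from the arcs the vertical segments are lifts of the same path.
  · let F (i : BallIndex f hT ⊕ HandleIndex f hT) (w : Cube3) : C(I, M) :=
      ⟨fun s => hT.pieceMap hf i (Function.update w 2 s), by fun_prop⟩
    have hF (i : BallIndex f hT ⊕ HandleIndex f hT) (w : Cube3) (s : I) :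
        f (F i w s) = h (Function.update (hT.shadow i w) 2 s) := by
      simp only [F, ContinuousMap.coe_mk]
      rw [hT.apply_pieceMap hf, shadow_update]
    have hFF : F i w = F i' w' := by
      refine hf.lift_unique (a := w 2) (fun s => ?_) (fun s => ?_) ?_
      · rw [hF, hF, hsh]
      · rw [hF, mem_compl_iff, hT.mem_iff]
        exact hK s
      · simp only [F, ContinuousMap.coe_mk, Function.update_eq_self]
        rw [h2, Function.update_eq_self, heq]
    exact fun s => DFunLike.congr_fun hFF s
  -- Otherwise both pieces are balls, hence they coincide.
  · rcases i with b | a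
    · rcases i' with b' | a'
      · obtain ⟨rfl, rfl⟩ := hT.ballMap_eq hf heq
        exact fun s => rfl
      · refine absurd (fun s => ?_) hK
        rw [hsh]
        exact hT.handleShadow_notMem a' w' s
    · exact absurd (fun s => hT.handleShadow_notMem a w s) hK

/-- A handle meets the balls exactly in its ends. -/
theorem handleMap_mem_iff (a : HandleIndex f hT) (w : Cube3) :
    hT.handleMap a w ∈ (⋃ b, range (hT.ballMap hf b)) ↔ w 0 = 0 ∨ w 0 = 1 := by
  have hj := a.1.2
  have hsh : (hT.handleShadow a w 0 : ℝ) = gapPos n a.1 (w 0) :=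
    cubePoint_zero _ _ (Ioo_subset_Icc_self (gapPos_mem_Ioo (by omega) (w 0).2))
  constructor
  · intro hmem
    obtain ⟨b, w', hw'⟩ := mem_iUnion.1 hmem
    have hs : hT.ballShadow b w' = hT.handleShadow a w := hT.isEmbedding.injective (by
      rw [← hT.apply_ballMap hf, ← hT.apply_handleMap, hw'])
    have hn : ‖branchMap b.2.out.index (squareCoord w')‖ ≤ 1 := by
      rw [norm_branchMap]; exact norm_squareCoord_le w'
    have h1 : gapPos n a.1 (w 0) =
        (columnPos n b.1 (branchMap b.2.out.index (squareCoord w'))).1 := by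
      rw [← hsh, ← hs]
      exact cubePoint_zero _ _ (columnPos_mem b.1.2 hn).1
    rcases gapPos_mem_column (k := b.1) (by omega) b.1.2 (w 0).2
      (h1 ▸ columnPos_fst_mem b.1.2 hn) with h | h
    · exact Or.inl (Subtype.ext h.1)
    · exact Or.inr (Subtype.ext h.1)
  · have key (k : ℕ) (hk : k < n)
        (h : gapPos n a.1 (w 0) ∈ Icc (colLeft n k) (colRight n k)) :
        hT.handleMap a w ∈ (⋃ b, range (hT.ballMap hf b)) := by
      obtain ⟨b, w', h'⟩ := hT.exists_ballMap_eq hf (hT.apply_handleMap a w) hk (hsh ▸ h)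
      exact mem_iUnion.2 ⟨b, w', h'⟩
    rintro (h0 | h1)
    · refine key a.1 (by omega) ?_
      rw [h0, Icc.coe_zero, gapPos_zero (by omega)]
      have := (colLeft_lt_arcPos (n := n) (k := a.1) (by omega)).trans
        (arcPos_lt_colRight (n := n) (k := a.1) (by omega))
      exact ⟨this.le, le_rfl⟩
    · refine key (a.1 + 1) (by omega) ?_
      rw [h1, Icc.coe_one, gapPos_one]
      have := (colLeft_lt_arcPos (n := n) (k := a.1 + 1) (by omega)).trans
        (arcPos_lt_colRight (n := n) (k := a.1 + 1) (by omega))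
      exact ⟨le_rfl, this.le⟩

theorem mem_boundary_of_handleMap_eq {a : HandleIndex f hT} {b : BallIndex f hT} {w w' : Cube3}
    (heq : hT.handleMap a w = hT.ballMap hf b w') : w' ∈ Cube.boundary (Fin 3) := by
  have hj := a.1.2
  have hsh : (hT.handleShadow a w 0 : ℝ) = gapPos n a.1 (w 0) :=
    cubePoint_zero _ _ (Ioo_subset_Icc_self (gapPos_mem_Ioo (by omega) (w 0).2))
  have hs : hT.ballShadow b w' = hT.handleShadow a w := hT.isEmbedding.injective (by
    rw [← hT.apply_ballMap hf, ← hT.apply_handleMap, heq])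
  have hn : ‖branchMap b.2.out.index (squareCoord w')‖ ≤ 1 := by
    rw [norm_branchMap]; exact norm_squareCoord_le w'
  have h1 : gapPos n a.1 (w 0) =
      (columnPos n b.1 (branchMap b.2.out.index (squareCoord w'))).1 := by
    rw [← hsh, ← hs]
    exact cubePoint_zero _ _ (columnPos_mem b.1.2 hn).1
  refine mem_boundary_of_norm_squareCoord ((norm_squareCoord_le w').eq_of_not_lt fun hlt => ?_)
  rw [← norm_branchMap b.2.out.index] at hlt
  have h2 := stretch_mem_Ioo (colLeft_lt_arcPos b.1.2) (arcPos_lt_colRight b.1.2)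
    ((norm_fst_le _).trans_lt hlt)
  change (columnPos n b.1 (branchMap b.2.out.index (squareCoord w'))).1 ∈ _ at h2
  rw [← h1] at h2
  rcases gapPos_mem_column (k := b.1) (by omega) b.1.2 (w 0).2 (Ioo_subset_Icc_self h2) with h | h
  · exact h2.2.ne h.2.2
  · exact h2.1.ne' h.2.2

omit [T2Space M] [T2Space Y] [CompactSpace M] in
theorem shadow_notMem_boundary (i : BallIndex f hT ⊕ HandleIndex f hT) {w : Cube3}
    (hw : w ∉ Cube.boundary (Fin 3)) : hT.shadow i w ∉ Cube.boundary (Fin 3) := by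
  simp only [Cube.boundary, mem_ofPred_eq, not_exists, not_or] at hw
  have key (s : I) (h0 : s ≠ 0) (h1 : s ≠ 1) : (s : ℝ) ∈ Ioo (0 : ℝ) 1 :=
    ⟨lt_of_le_of_ne s.2.1 fun h => h0 (Subtype.ext h.symm),
      lt_of_le_of_ne s.2.2 fun h => h1 (Subtype.ext h)⟩
  have h1 := key _ (hw 1).1 (hw 1).2
  have h2 := key _ (hw 2).1 (hw 2).2
  rcases i with b | a
  · have h3 : ‖branchMap b.2.out.index (squareCoord w)‖ < 1 := by
      rw [norm_branchMap]
      exact norm_squareCoord_lt (hw 0).1 (hw 0).2 (hw 1).1 (hw 1).2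
    have h4 := columnPos_mem_Ioo b.1.2 h3
    exact cubePoint_notMem_boundary h4.1 h4.2 h2
  · have hj := a.1.2
    exact cubePoint_notMem_boundary (gapPos_mem_Ioo (by omega) (w 0).2) h1 h2

omit [T2Space M] [T2Space Y] [CompactSpace M] in
include hf in
/-- Every piece meets the preimage of the back wall of the tangle ball. -/
theorem exists_shadow_one_eq (i : BallIndex f hT ⊕ HandleIndex f hT) :
    ∃ w, hT.shadow i w 1 = 1 := by
  rcases i with b | a
  · obtain ⟨z, hz⟩ := branchMap_surjective (index_pos hf b.2.out) (0, 1)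
    have hn : ‖z‖ = 1 := by
      rw [← norm_branchMap b.2.out.index, hz]; simp [Prod.norm_def]
    obtain ⟨w, rfl, -⟩ := exists_squareCoord_eq hn.le 0
    refine ⟨w, Subtype.ext ?_⟩
    simp only [shadow, Sum.elim_inl, ballShadow, hz]
    refine (cubePoint_one _ _ ?_).trans ?_ <;> norm_num [columnPos]
  · refine ⟨1, Subtype.ext ?_⟩
    exact cubePoint_one (gapPos n a.1 ((1 : Cube3) 0)) ((1 : Cube3) 2) (1 : I).2

end IsTangleBall

/-! ### The handlebodies over the two balls of a bridge position -/

/-- The two closed balls `range h₁` and `range h₂` cover the space, meet in their common boundary,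
and each of them meets `K` in a trivial `n`-tangle. -/
structure IsBridgeSplitting {Y : Type*} [TopologicalSpace Y] (n : ℕ) (K : Set Y)
    (h₁ h₂ : Cube3 → Y) : Prop where
  ball₁ : IsTangleBall n K h₁
  ball₂ : IsTangleBall n K h₂
  union_eq : range h₁ ∪ range h₂ = univ
  inter_eq₁ : range h₁ ∩ range h₂ = h₁ '' Cube.boundary (Fin 3)
  inter_eq₂ : range h₁ ∩ range h₂ = h₂ '' Cube.boundary (Fin 3)

theorem HasBridgePosition.exists_isBridgeSplitting {n : ℕ} {K : Set ThreeSphere}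
    (hn : HasBridgePosition n K) : ∃ h₁ h₂, IsBridgeSplitting n K h₁ h₂ := by
  obtain ⟨h₁, h₂, e₁, e₂, hu, hi₁, hi₂, hK₁, hK₂⟩ := hn
  have key (h h' : Cube3 → ThreeSphere) (he : Topology.IsEmbedding h)
      (he' : Topology.IsEmbedding h') (hu : range h ∪ range h' = univ)
      (hi : range h ∩ range h' = h '' Cube.boundary (Fin 3)) (w : Cube3)
      (hw : w ∉ Cube.boundary (Fin 3)) : range h ∈ 𝓝 (h w) := by
    have hc : IsClosed (range h') := (isCompact_range he'.continuous).isClosed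
    refine mem_of_superset (hc.isOpen_compl.mem_nhds fun hmem => ?_) fun y hy => ?_
    · have : h w ∈ h '' Cube.boundary (Fin 3) := hi ▸ ⟨⟨w, rfl⟩, hmem⟩
      exact hw ((he.injective.mem_set_image).1 this)
    · have : y ∈ range h ∪ range h' := hu ▸ mem_univ y
      exact this.resolve_right hy
  exact ⟨h₁, h₂, ⟨e₁, hK₁, key h₁ h₂ e₁ e₂ hu hi₁⟩,
    ⟨e₂, hK₂, key h₂ h₁ e₂ e₁ (by rwa [union_comm]) (by rwa [inter_comm])⟩, hu, hi₁, hi₂⟩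

namespace IsBridgeSplitting

variable {Y : Type*} [TopologicalSpace Y] {n : ℕ} {K : Set Y} {h₁ h₂ : Cube3 → Y}

theorem symm (S : IsBridgeSplitting n K h₁ h₂) : IsBridgeSplitting n K h₂ h₁ :=
  ⟨S.ball₂, S.ball₁, by rw [union_comm, S.union_eq], by rw [inter_comm, S.inter_eq₂],
    by rw [inter_comm, S.inter_eq₁]⟩

variable (S : IsBridgeSplitting n K h₁ h₂)

include S in
theorem mem_range_iff (w : Cube3) : h₂ w ∈ range h₁ ↔ w ∈ Cube.boundary (Fin 3) := by
  rw [← S.ball₂.isEmbedding.injective.mem_set_image (s := Cube.boundary (Fin 3)), ← S.inter_eq₂]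
  exact ⟨fun h => ⟨h, w, rfl⟩, fun h => h.1⟩

end IsBridgeSplitting

section

variable {Y : Type*} [TopologicalSpace Y] {n : ℕ} {K : Set Y} {h₁ h₂ : Cube3 → Y}
  {M : Type*} [TopologicalSpace M] [T2Space M] [T2Space Y] [CompactSpace M] {f : M → Y}
  (hf : IsBranchedCover f K)

theorem IsTangleBall.iUnion_range_pieceMap (hT : IsTangleBall n K h₁) (hn : 0 < n) :
    ⋃ i, range (hT.pieceMap hf i) = f ⁻¹' range h₁ := by
  ext x
  rw [mem_iUnion, mem_preimage]
  constructor
  · rintro ⟨i, w, rfl⟩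
    exact ⟨_, (hT.apply_pieceMap hf i w).symm⟩
  · intro hx
    obtain ⟨i, w, h⟩ := hT.exists_pieceMap_eq hf hn hx
    exact ⟨i, w, h⟩

/-- Values on the pieces that agree on overlaps define a function. -/
theorem IsTangleBall.exists_eq_on_pieces (hT : IsTangleBall n K h₁) {A : Type*} [Inhabited A]
    (g : hT.BallIndex f ⊕ hT.HandleIndex f → Cube3 → A)
    (hg : ∀ b a w w', hT.ballMap hf b w = hT.handleMap a w' →
      g (Sum.inl b) w = g (Sum.inr a) w') :
    ∃ u : M → A, ∀ i w, u (hT.pieceMap hf i w) = g i w := by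
  have hcompat (i i' w w') (h : hT.pieceMap hf i w = hT.pieceMap hf i' w') : g i w = g i' w' := by
    rcases i with b | a <;> rcases i' with b' | a'
    · obtain ⟨rfl, rfl⟩ := hT.ballMap_eq hf h; rfl
    · exact hg b a' w w' h
    · exact (hg b' a w' w h.symm).symm
    · obtain ⟨rfl, rfl⟩ := hT.handleMap_eq hf h; rfl
  have (x : M) : ∃ a : A, ∀ i w, hT.pieceMap hf i w = x → g i w = a := by
    by_cases hx : ∃ i w, hT.pieceMap hf i w = x
    · obtain ⟨i, w, hw⟩ := hx
      exact ⟨g i w, fun i' w' h => hcompat i' i w' w (h.trans hw.symm)⟩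
    · exact ⟨default, fun i w h => absurd ⟨i, w, h⟩ hx⟩
  choose u hu using this
  exact ⟨u, fun i w => (hu _ i w rfl).symm⟩

variable (S : IsBridgeSplitting n K h₁ h₂)

/-- Primitives on the handlebody over one ball extend to the whole branched cover. -/
theorem IsBridgeSplitting.exists_primitive_extension (hn : 0 < n) (hX : HasSimplyConnectedNhds M)
    {A : Type*} [AddCommGroup A] (c : PathCocycle M A) {u : M → A}
    (hu : ∀ i, (c.comap (S.ball₁.pieceMap hf i)).IsPrimitive (u ∘ S.ball₁.pieceMap hf i)) :
    ∃ u' : M → A, c.IsPrimitive u' ∧ ∀ x, f x ∈ range h₁ → u' x = u x := by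
  have := S.ball₁.finite_ballIndex hf
  have := S.ball₁.finite_handleIndex hf
  have := S.ball₂.finite_ballIndex hf
  have := S.ball₂.finite_handleIndex hf
  have hmem (i) (w) : S.ball₂.pieceMap hf i w ∈ (⋃ i, range (S.ball₁.pieceMap hf i)) ↔
      S.ball₂.shadow i w ∈ Cube.boundary (Fin 3) := by
    rw [S.ball₁.iUnion_range_pieceMap hf hn, mem_preimage, S.ball₂.apply_pieceMap hf,
      S.mem_range_iff]
  suffices h : ∃ u' : M → A, c.IsPrimitive u' ∧
      ∀ x ∈ ⋃ i, range (S.ball₁.pieceMap hf i), u' x = u x by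
    obtain ⟨u', h1, h2⟩ := h
    exact ⟨u', h1, fun x hx => h2 x (by rwa [S.ball₁.iUnion_range_pieceMap hf hn])⟩
  refine c.exists_primitive_extension hX (S.ball₁.pieceMap hf) (S.ball₂.pieceMap hf)
    (fun x => ?_) (fun i j w w' h => S.ball₂.pieceMap_update_eq hf h)
    (fun i w hw => ?_) (fun i w hw => ?_) (fun i w hw => ?_) (fun i => ?_) hu
  · rw [S.ball₁.iUnion_range_pieceMap hf hn]
    have : f x ∈ range h₁ ∪ range h₂ := S.union_eq ▸ mem_univ _
    exact this.imp id fun h => S.ball₂.exists_pieceMap_eq hf hn h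
  · rw [hmem]
    exact ⟨2, Or.inl (by rw [S.ball₂.shadow_two, hw])⟩
  · rw [hmem]
    exact ⟨2, Or.inr (by rw [S.ball₂.shadow_two, hw])⟩
  · rw [hmem] at hw
    obtain ⟨j, hj⟩ := hw
    by_cases hj2 : j = 2
    · subst hj2
      rw [S.ball₂.shadow_two] at hj
      exact hj.imp id Or.inl
    · refine Or.inr (Or.inr fun s => ?_)
      rw [hmem, S.ball₂.shadow_update]
      exact ⟨j, by rwa [Function.update_of_ne hj2]⟩
  · obtain ⟨w, hw⟩ := S.ball₂.exists_shadow_one_eq hf i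
    refine ⟨w, fun s => ?_⟩
    rw [hmem, S.ball₂.shadow_update]
    exact ⟨1, Or.inr (by rwa [Function.update_of_ne (by decide)])⟩

/-- The zero cocycle. -/
def PathCocycle.zero (X A : Type*) [TopologicalSpace X] [AddCommGroup A] : PathCocycle X A :=
  ⟨fun _ => 0, fun _ => rfl, fun _ _ => (add_zero 0).symm⟩

include hf S

/-- The branched cover is path connected as soon as its unbranched part is. -/
theorem IsBridgeSplitting.pathConnectedSpace (hn : 0 < n) (hc : IsPathConnected (f ⁻¹' Kᶜ)) :
    PathConnectedSpace M := by
  obtain ⟨x₀, hx₀, hj⟩ := hc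
  have key {h : Cube3 → Y} (hT : IsTangleBall n K h) {x : M} (hx : f x ∈ range h) :
      Joined x₀ x := by
    obtain ⟨i, w, rfl⟩ := hT.exists_pieceMap_eq hf hn hx
    -- The back wall of the tangle ball misses the arcs.
    obtain ⟨w', hw'⟩ := hT.exists_shadow_one_eq hf i
    have h1 : hT.pieceMap hf i w' ∈ f ⁻¹' Kᶜ := by
      rw [mem_preimage, hT.apply_pieceMap hf, mem_compl_iff, hT.mem_iff]
      rintro ⟨-, h2⟩
      rw [hw'] at h2
      norm_num at h2
    exact (hj h1).joined.trans
      ⟨(PathConnectedSpace.somePath w' w).map (hT.pieceMap hf i).continuous⟩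
  have h (x : M) : Joined x₀ x := by
    have : f x ∈ range h₁ ∪ range h₂ := S.union_eq ▸ mem_univ _
    exact this.elim (key S.ball₁) (key S.ball₂)
  exact ⟨⟨x₀⟩, fun x y => (h x).symm.trans (h y)⟩

/-- Functions that are constant on the pieces of the handlebody over one ball are constant on the
handlebody. -/
theorem IsBridgeSplitting.eq_of_const_on_pieces (hn : 0 < n) (hX : HasSimplyConnectedNhds M)
    [PathConnectedSpace M] {A : Type*} [AddCommGroup A] {u : M → A}
    (hu : ∀ i w w', u (S.ball₁.pieceMap hf i w) = u (S.ball₁.pieceMap hf i w')) {x y : M}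
    (hx : f x ∈ range h₁) (hy : f y ∈ range h₁) : u x = u y := by
  obtain ⟨u', h1, h2⟩ := S.exists_primitive_extension hf hn hX (PathCocycle.zero M A) (u := u)
    (fun i w w' p => (sub_eq_zero.2 (hu i w' w)).symm)
  rw [← h2 x hx, ← h2 y hy]
  exact (sub_eq_zero.1 (h1 (PathConnectedSpace.somePath x y)).symm).symm

/-- The handlebody over one ball is connected: a separation would be a function that is constant on
its pieces. -/
theorem IsBridgeSplitting.isConnected_preimage (hn : 0 < n) (hX : HasSimplyConnectedNhds M)
    [PathConnectedSpace M] (hne : (f ⁻¹' range h₁).Nonempty) : IsConnected (f ⁻¹' range h₁) := by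
  classical
  refine ⟨hne, isPreconnected_iff_subset_of_disjoint.2 fun U V hU hV hUV hdisj => ?_⟩
  obtain ⟨x₀, hx₀⟩ := hne
  let u : M → ℤ := fun x => if x ∈ U then 1 else 0
  have h1 (i w w') : u (S.ball₁.pieceMap hf i w) = u (S.ball₁.pieceMap hf i w') := by
    have hsub : range (S.ball₁.pieceMap hf i) ⊆ f ⁻¹' range h₁ := by
      rw [← S.ball₁.iUnion_range_pieceMap hf hn]
      exact subset_iUnion_of_subset i Subset.rfl
    have hpre : _root_.IsPreconnected (range (S.ball₁.pieceMap hf i)) :=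
      isPreconnected_range (S.ball₁.pieceMap hf i).continuous
    have hnot {x : M} (hx : f x ∈ range h₁) (hxV : x ∈ V) : x ∉ U := fun hxU =>
      (hdisj ▸ (⟨hx, hxU, hxV⟩ : x ∈ f ⁻¹' range h₁ ∩ (U ∩ V)) : x ∈ (∅ : Set M))
    rcases isPreconnected_iff_subset_of_disjoint.1 hpre U V hU hV (hsub.trans hUV)
      (subset_eq_empty (inter_subset_inter_left _ hsub) hdisj) with h | h
    · simp only [u, if_pos (h ⟨w, rfl⟩), if_pos (h ⟨w', rfl⟩)]
    · simp only [u, if_neg (hnot (hsub ⟨w, rfl⟩) (h ⟨w, rfl⟩)),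
        if_neg (hnot (hsub ⟨w', rfl⟩) (h ⟨w', rfl⟩))]
  have h2 (x) (hx : x ∈ f ⁻¹' range h₁) : u x = u x₀ :=
    S.eq_of_const_on_pieces hf hn hX h1 hx hx₀
  by_cases h0 : x₀ ∈ U
  · refine Or.inl fun x hx => ?_
    by_contra hxU
    have := h2 x hx
    simp [u, h0, hxU] at this
  · refine Or.inr fun x hx => (hUV hx).resolve_left fun hxU => ?_
    have := h2 x hx
    simp [u, h0, hxU] at this

/-- The frontier of the handlebody over one ball is the preimage of the bridge sphere. -/
theorem IsBridgeSplitting.frontier_preimage (hn : 0 < n) :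
    f ⁻¹' range h₁ ∩ f ⁻¹' range h₂ = frontier (f ⁻¹' range h₁) := by
  have hcl {h : Cube3 → Y} (hT : IsTangleBall n K h) : IsClosed (f ⁻¹' range h) :=
    ((isCompact_range hT.isEmbedding.continuous).isClosed).preimage hf.continuous
  have hcover (x : M) : f x ∈ range h₁ ∪ range h₂ := S.union_eq ▸ mem_univ _
  rw [frontier_eq_closure_inter_closure, (hcl S.ball₁).closure_eq]
  apply subset_antisymm
  · rintro x ⟨hx1, hx2⟩
    refine ⟨hx1, ?_⟩
    obtain ⟨i, w, rfl⟩ := S.ball₂.exists_pieceMap_eq hf hn hx2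
    -- The points off the boundary are dense in a piece over the other ball.
    have hd : w ∈ closure (Cube.boundary (Fin 3))ᶜ := by
      have h1 : (Cube.boundary (Fin 3))ᶜ = univ.pi fun _ : Fin 3 => Ioo (0 : I) 1 := by
        ext w
        simp only [Cube.boundary, mem_compl_iff, mem_ofPred_eq, not_exists, not_or, Set.mem_pi,
          mem_univ, true_implies, mem_Ioo, unitInterval.pos_iff_ne_zero,
          unitInterval.lt_one_iff_ne_one]
      rw [h1, closure_pi_set]
      intro j _
      rw [closure_Ioo zero_ne_one]
      exact ⟨unitInterval.nonneg', unitInterval.le_one'⟩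
    refine map_mem_closure (S.ball₂.pieceMap hf i).continuous hd fun w' hw' => ?_
    rw [mem_compl_iff, mem_preimage, S.ball₂.apply_pieceMap hf, S.mem_range_iff]
    exact S.ball₂.shadow_notMem_boundary i hw'
  · rintro x ⟨hx1, hx2⟩
    refine ⟨hx1, ?_⟩
    have : (f ⁻¹' range h₁)ᶜ ⊆ f ⁻¹' range h₂ := fun y hy => (hcover y).resolve_left hy
    exact (hcl S.ball₂).closure_subset_iff.2 this hx2

end

/-! ### The rank of the homology of the branched cover -/

section Graph

variable {B J : Type*} (β : J → Bool → B)

/-- The coboundary of the graph whose vertices are the elements of `B` and of `J`, with an edge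
between `a : J` and each of its two end points `β a s`. -/
def graphCoboundary : ((B → ℚ) × (J → ℚ)) →ₗ[ℚ] (J × Bool → ℚ) where
  toFun q e := q.2 e.1 - q.1 (β e.1 e.2)
  map_add' q q' := by ext e; simp; ring
  map_smul' r q := by ext e; simp; ring

/-- The first Betti number of a connected graph. -/
theorem finrank_quotient_graphCoboundary [Fintype B] [Fintype J] [Nonempty B]
    (h : ∀ q, graphCoboundary β q = 0 → ∃ r, (∀ b, q.1 b = r) ∧ ∀ a, q.2 a = r) :
    Module.finrank ℚ ((J × Bool → ℚ) ⧸ LinearMap.range (graphCoboundary β)) + Fintype.card B =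
      Fintype.card J + 1 := by
  let v : (B → ℚ) × (J → ℚ) := (fun _ => 1, fun _ => 1)
  have hv : v ≠ 0 := fun hv => by
    obtain ⟨b⟩ := ‹Nonempty B›
    exact one_ne_zero (congrFun (congrArg Prod.fst hv) b)
  have hker : LinearMap.ker (graphCoboundary β) = ℚ ∙ v := by
    ext q
    rw [LinearMap.mem_ker, Submodule.mem_span_singleton]
    constructor
    · intro hq
      obtain ⟨r, h1, h2⟩ := h q hq
      exact ⟨r, Prod.ext (funext fun b => by simp [v, h1]) (funext fun a => by simp [v, h2])⟩
    · rintro ⟨r, rfl⟩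
      ext e
      simp [graphCoboundary, v]
  have h1 := Submodule.finrank_quotient_add_finrank (LinearMap.range (graphCoboundary β))
  have h2 := LinearMap.finrank_range_add_finrank_ker (graphCoboundary β)
  rw [hker, finrank_span_singleton hv, Module.finrank_prod, Module.finrank_fintype_fun_eq_card,
    Module.finrank_fintype_fun_eq_card] at h2
  rw [Module.finrank_fintype_fun_eq_card, Fintype.card_prod, Fintype.card_bool] at h1
  omega

end Graph

section Rank

variable {Y : Type*} [TopologicalSpace Y] {n : ℕ} {K : Set Y} {h₁ h₂ : Cube3 → Y}
  {M : Type u} [TopologicalSpace M] [T2Space M] [T2Space Y] [CompactSpace M] {f : M → Y}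
  (hf : IsBranchedCover f K) (S : IsBridgeSplitting n K h₁ h₂)

/-- The two ends of the unit interval. -/
def endPoint (s : Bool) : I := if s then 1 else 0

theorem exists_endPoint_iff (s : I) : (∃ b, s = endPoint b) ↔ s = 0 ∨ s = 1 := by
  simp [endPoint]

/-- The ball that contains an end of a handle. -/
theorem IsTangleBall.exists_ballMap_eq_end (hT : IsTangleBall n K h₁) (a : hT.HandleIndex f)
    (s : Bool) : ∃ b w, hT.ballMap hf b w = hT.handleMap a fun _ => endPoint s := by
  have := (hT.handleMap_mem_iff hf a fun _ => endPoint s).2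
    ((exists_endPoint_iff _).1 ⟨s, rfl⟩)
  simpa using this

/-- A choice of the ball that contains an end of a handle. -/
noncomputable def IsTangleBall.endBall (hT : IsTangleBall n K h₁) (a : hT.HandleIndex f)
    (s : Bool) : hT.BallIndex f := (hT.exists_ballMap_eq_end hf a s).choose

/-- The coordinates, in the ball that contains an end of a handle, of the corner of that end. -/
noncomputable def IsTangleBall.endCoord (hT : IsTangleBall n K h₁) (a : hT.HandleIndex f)
    (s : Bool) : Cube3 := (hT.exists_ballMap_eq_end hf a s).choose_spec.choose

theorem IsTangleBall.ballMap_endCoord (hT : IsTangleBall n K h₁) (a : hT.HandleIndex f)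
    (s : Bool) : hT.ballMap hf (hT.endBall hf a s) (hT.endCoord hf a s) =
      hT.handleMap a fun _ => endPoint s :=
  (hT.exists_ballMap_eq_end hf a s).choose_spec.choose_spec

/-- Primitives on the balls and on a handle differ by a constant on each end of the handle. -/
theorem IsTangleBall.sub_eq_on_end (hT : IsTangleBall n K h₁) (hX : HasSimplyConnectedNhds M)
    {A : Type*} [AddCommGroup A] (c : PathCocycle M A) {u : M → A}
    (hu : ∀ b, (c.comap (hT.ballMap hf b)).IsPrimitive (u ∘ hT.ballMap hf b))
    (a : hT.HandleIndex f) {q : Cube3 → A} (hq : (c.comap (hT.handleMap a)).IsPrimitive q)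
    {w w' : Cube3} (s : Bool) (hw : w 0 = endPoint s) (hw' : w' 0 = endPoint s) :
    u (hT.handleMap a w) - q w = u (hT.handleMap a w') - q w' := by
  have := hT.finite_ballIndex hf
  let face : C(Cube3, Cube3) := ⟨fun w => Function.update w 0 (endPoint s), by fun_prop⟩
  have h1 := PathCocycle.isPrimitive_comap_of_closed_cover hX (hT.ballMap hf)
    (fun b => (hT.ballMap hf b).continuous.isClosedMap) hu ((hT.handleMap a).comp face)
    (fun w => by
      have := (hT.handleMap_mem_iff hf a (face w)).2
        ((exists_endPoint_iff _).1 ⟨s, by simp [face]⟩)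
      simpa using this)
  have h2 : (c.comap ((hT.handleMap a).comp face)).IsPrimitive (q ∘ face) := hq.comap face
  have h3 := h1.sub_eq h2 (PathConnectedSpace.joined w w')
  have h4 (w : Cube3) (hw : w 0 = endPoint s) : face w = w := by
    simp only [face, ContinuousMap.coe_mk]
    rw [← hw, Function.update_eq_self]
  simpa [h4 w hw, h4 w' hw'] using h3

/-- Primitives on the balls and the handles that agree at a corner of each end of each handle fit
together. -/
theorem IsTangleBall.exists_glued (hT : IsTangleBall n K h₁) (hX : HasSimplyConnectedNhds M)
    {A : Type*} [AddCommGroup A] (c : PathCocycle M A) {P : hT.BallIndex f → Cube3 → A}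
    (hP : ∀ b, (c.comap (hT.ballMap hf b)).IsPrimitive (P b)) {Q : hT.HandleIndex f → Cube3 → A}
    (hQ : ∀ a, (c.comap (hT.handleMap a)).IsPrimitive (Q a))
    (hend : ∀ a s, P (hT.endBall hf a s) (hT.endCoord hf a s) = Q a fun _ => endPoint s) :
    ∃ u : M → A, (∀ b w, u (hT.ballMap hf b w) = P b w) ∧
      ∀ a w, u (hT.handleMap a w) = Q a w := by
  have hinj : Function.Injective fun p : hT.BallIndex f × Cube3 => hT.ballMap hf p.1 p.2 :=
    fun p p' h => Prod.ext (hT.ballMap_eq hf h).1 (hT.ballMap_eq hf h).2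
  let u₀ : M → A := Function.extend (fun p : hT.BallIndex f × Cube3 => hT.ballMap hf p.1 p.2)
    (fun p => P p.1 p.2) 0
  have hu₀ (b w) : u₀ (hT.ballMap hf b w) = P b w := hinj.extend_apply _ _ (b, w)
  have hu₀' (b) : (c.comap (hT.ballMap hf b)).IsPrimitive (u₀ ∘ hT.ballMap hf b) := by
    rw [show u₀ ∘ hT.ballMap hf b = P b from funext fun w => hu₀ b w]
    exact hP b
  have : Inhabited A := ⟨0⟩
  obtain ⟨u, hu⟩ := hT.exists_eq_on_pieces hf (Sum.elim P Q) fun b a w w' h => by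
    obtain ⟨s, hs⟩ := (exists_endPoint_iff _).2 ((hT.handleMap_mem_iff hf a w').1
      (mem_iUnion.2 ⟨b, w, h⟩))
    have h1 := hT.sub_eq_on_end hf hX c hu₀' a (hQ a) (w' := fun _ => endPoint s) s hs rfl
    rw [← hT.ballMap_endCoord hf, hu₀, hend, sub_self, ← h, hu₀, sub_eq_zero] at h1
    exact h1
  exact ⟨u, fun b => hu (Sum.inl b), fun a => hu (Sum.inr a)⟩

/-- A cocycle has a primitive if its periods around the ends of the handles form a coboundary. -/
theorem IsBridgeSplitting.exists_isPrimitive (hn : 0 < n) (hX : HasSimplyConnectedNhds M)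
    (c : PathCocycle M ℚ)
    (q : (S.ball₁.BallIndex f → ℚ) × (S.ball₁.HandleIndex f → ℚ))
    (hq : ∀ e : S.ball₁.HandleIndex f × Bool,
      (c.comap (S.ball₁.ballMap hf (S.ball₁.endBall hf e.1 e.2))).primitive 0
          (S.ball₁.endCoord hf e.1 e.2) -
        (c.comap (S.ball₁.handleMap e.1)).primitive 0 (fun _ => endPoint e.2) =
      graphCoboundary (S.ball₁.endBall hf) q e) : ∃ u, c.IsPrimitive u := by
  obtain ⟨u, h1, h2⟩ := S.ball₁.exists_glued hf hX c
    (fun b => (PathCocycle.isPrimitive_primitive (c.comap (S.ball₁.ballMap hf b)) 0).add_const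
      (q.1 b))
    (fun a => (PathCocycle.isPrimitive_primitive (c.comap (S.ball₁.handleMap a)) 0).add_const
      (q.2 a))
    (fun a s => by
      have := hq (a, s)
      simp only [graphCoboundary, LinearMap.coe_mk, AddHom.coe_mk] at this
      linarith)
  obtain ⟨u', h3, -⟩ := S.exists_primitive_extension hf hn hX c (u := u) fun i => by
    rcases i with b | a
    · rw [show u ∘ S.ball₁.pieceMap hf (Sum.inl b) = _ from funext fun w => h1 b w]
      exact (PathCocycle.isPrimitive_primitive (c.comap (S.ball₁.ballMap hf b)) 0).add_const _
    · rw [show u ∘ S.ball₁.pieceMap hf (Sum.inr a) = _ from funext fun w => h2 a w]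
      exact (PathCocycle.isPrimitive_primitive (c.comap (S.ball₁.handleMap a)) 0).add_const _
  exact ⟨u', h3⟩

include hf in
/-- The first Betti number of the handlebody over a ball bounds the rank of the homology. -/
theorem IsBridgeSplitting.rank_le (hn : 0 < n) (hX : HasSimplyConnectedNhds M)
    [PathConnectedSpace M] [Nonempty (S.ball₁.BallIndex f)] :
    ∃ g : ℕ, g + Nat.card (S.ball₁.BallIndex f) = Nat.card (S.ball₁.HandleIndex f) + 1 ∧
      Module.rank ℤ (firstHomology M) ≤ g := by
  have := S.ball₁.finite_ballIndex hf
  have := S.ball₁.finite_handleIndex hf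
  have := Fintype.ofFinite (S.ball₁.BallIndex f)
  have := Fintype.ofFinite (S.ball₁.HandleIndex f)
  set hT := S.ball₁ with hT_def
  let T := graphCoboundary (hT.endBall hf)
  have hker : ∀ q, T q = 0 → ∃ r, (∀ b, q.1 b = r) ∧ ∀ a, q.2 a = r := by
    intro q hq
    obtain ⟨u, h1, h2⟩ := hT.exists_glued hf hX (PathCocycle.zero M ℚ)
      (P := fun b _ => q.1 b) (fun b _ _ _ => (sub_self _).symm) (Q := fun a _ => q.2 a)
      (fun a _ _ _ => (sub_self _).symm) (fun a s => by
        have := congrFun hq (a, s)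
        simp only [T, graphCoboundary, LinearMap.coe_mk, AddHom.coe_mk, Pi.zero_apply] at this
        linarith)
    obtain ⟨b₀⟩ := ‹Nonempty (hT.BallIndex f)›
    have h3 (i w) : u (hT.pieceMap hf i w) = q.1 b₀ := by
      rw [← h1 b₀ 0]
      refine S.eq_of_const_on_pieces hf hn hX (fun i w w' => ?_)
        ⟨_, (hT.apply_pieceMap hf i w).symm⟩ ⟨_, (hT.apply_ballMap hf b₀ 0).symm⟩
      rcases i with b | a
      · exact (h1 b w).trans (h1 b w').symm
      · exact (h2 a w).trans (h2 a w').symm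
    exact ⟨q.1 b₀, fun b => (h1 b 0).symm.trans (h3 (Sum.inl b) 0),
      fun a => (h2 a 0).symm.trans (h3 (Sum.inr a) 0)⟩
  have hdim := finrank_quotient_graphCoboundary (hT.endBall hf) hker
  rw [← Nat.card_eq_fintype_card, ← Nat.card_eq_fintype_card] at hdim
  refine ⟨_, hdim, ?_⟩
  -- The differences, at the ends of the handles, of the normalised primitives on balls and handles.
  let D : rationalCocycles M →ₗ[ℚ] (hT.HandleIndex f × Bool → ℚ) :=
    { toFun := fun φ e =>
        ((cocycleOnPaths φ).comap (hT.ballMap hf (hT.endBall hf e.1 e.2))).primitive 0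
          (hT.endCoord hf e.1 e.2) -
        ((cocycleOnPaths φ).comap (hT.handleMap e.1)).primitive 0 (fun _ => endPoint e.2)
      map_add' := fun φ ψ => by
        ext e
        simp only [PathCocycle.primitive, PathCocycle.val_comap, cocycleOnPaths_val, Pi.add_apply,
          Submodule.coe_add, LinearMap.add_apply]
        ring
      map_smul' := fun r φ => by
        ext e
        simp only [PathCocycle.primitive, PathCocycle.val_comap, cocycleOnPaths_val, Pi.smul_apply,
          Submodule.coe_smul, LinearMap.smul_apply, RingHom.id_apply, smul_eq_mul]
        ring }
  refine rank_firstHomology_le ((LinearMap.range T).mkQ ∘ₗ D) fun φ hφ => ?_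
  rw [LinearMap.comp_apply, Submodule.mkQ_apply, Submodule.Quotient.mk_eq_zero] at hφ
  obtain ⟨q, hq⟩ := hφ
  exact S.exists_isPrimitive hf hn hX _ q fun e => (congrFun hq e).symm

end Rank

/-! ### The Heegaard splitting of the branched cover -/

section Heegaard

variable {Y : Type*} [TopologicalSpace Y] {n : ℕ} {K : Set Y} {h₁ h₂ : Cube3 → Y}
  {M : Type*} [TopologicalSpace M] [T2Space M] [T2Space Y] [CompactSpace M] {f : M → Y}
  (hf : IsBranchedCover f K) (S : IsBridgeSplitting n K h₁ h₂)

include hf S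

theorem IsBridgeSplitting.isHandlebody (hn : 0 < n) (hX : HasSimplyConnectedNhds M)
    [PathConnectedSpace M] [hne : Nonempty (S.ball₁.BallIndex f)] {g : ℕ}
    (hg : g + Nat.card (S.ball₁.BallIndex f) = Nat.card (S.ball₁.HandleIndex f) + 1) :
    IsHandlebody (f ⁻¹' range h₁) g := by
  have := S.ball₁.finite_ballIndex hf
  have := S.ball₁.finite_handleIndex hf
  set hT := S.ball₁ with hT_def
  let eB := (Finite.equivFin (hT.BallIndex f)).symm
  let eJ := (Finite.equivFin (hT.HandleIndex f)).symm
  obtain ⟨b₀⟩ := hne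
  refine ⟨S.isConnected_preimage hf hn hX ⟨hT.ballMap hf b₀ 0, _, (hT.apply_ballMap hf b₀ 0).symm⟩,
    _, _, fun i => hT.ballMap hf (eB i), fun j => hT.handleMap (eJ j), hg,
    fun i => hT.isClosedEmbedding_pieceMap hf (Sum.inl (eB i)),
    fun j => hT.isClosedEmbedding_pieceMap hf (Sum.inr (eJ j)), ?_, ?_, ?_, ?_, ?_⟩
  · rw [← hT.iUnion_range_pieceMap hf hn, iUnion_sum]
    exact congrArg₂ _ (eB.surjective.iUnion_comp fun b => range (hT.ballMap hf b))
      (eJ.surjective.iUnion_comp fun a => range (hT.handleMap a))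
  · intro i i' hi
    rw [disjoint_iff_forall_ne]
    rintro _ ⟨w, rfl⟩ _ ⟨w', rfl⟩ h
    exact hi (eB.injective (hT.ballMap_eq hf h).1)
  · intro j j' hj
    rw [disjoint_iff_forall_ne]
    rintro _ ⟨w, rfl⟩ _ ⟨w', rfl⟩ h
    exact hj (eJ.injective (hT.handleMap_eq hf h).1)
  · intro j w
    rw [eB.surjective.iUnion_comp fun b => range (hT.ballMap hf b)]
    exact hT.handleMap_mem_iff hf _ w
  · intro j w i w' h
    exact hT.mem_boundary_of_handleMap_eq hf h

theorem IsBridgeSplitting.hasHeegaardSplitting (hn : 0 < n) (hX : HasSimplyConnectedNhds M)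
    [PathConnectedSpace M] [Nonempty (S.ball₁.BallIndex f)] [Nonempty (S.symm.ball₁.BallIndex f)]
    {g : ℕ} (hg : g + Nat.card (S.ball₁.BallIndex f) = Nat.card (S.ball₁.HandleIndex f) + 1)
    (hg' : g + Nat.card (S.symm.ball₁.BallIndex f) =
      Nat.card (S.symm.ball₁.HandleIndex f) + 1) : HasHeegaardSplitting M g := by
  refine ⟨f ⁻¹' range h₁, f ⁻¹' range h₂, S.isHandlebody hf hn hX hg,
    S.symm.isHandlebody hf hn hX hg', ?_, S.frontier_preimage hf hn, ?_⟩
  · rw [← preimage_union, S.union_eq, preimage_univ]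
  · rw [inter_comm]
    exact S.symm.frontier_preimage hf hn

end Heegaard

/-! ### Paths in the complement of a trivial tangle -/

section CubePaths

/-- Moving one coordinate of a point of the cube to a prescribed value. -/
theorem joinedIn_update {S : Set Cube3} {w : Cube3} {i : Fin 3} {s : I}
    (h : ∀ r ∈ uIcc (w i) s, Function.update w i r ∈ S) : JoinedIn S w (Function.update w i s) := by
  have hmem (t : I) : (1 - (t : ℝ)) * w i + t * s ∈ Icc (0 : ℝ) 1 :=
    convex_Icc (0 : ℝ) 1 (w i).2 s.2 (by linarith [t.2.2]) t.2.1 (by ring)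
  let c : C(I, I) := ⟨fun t => ⟨(1 - (t : ℝ)) * w i + t * s, hmem t⟩, by fun_prop⟩
  refine ⟨⟨⟨fun t => Function.update w i (c t), by fun_prop⟩, ?_, ?_⟩, fun t => h _ ?_⟩
  · have : c 0 = w i := Subtype.ext (by simp [c])
    simp only [this, Function.update_eq_self]
  · have : c 1 = s := Subtype.ext (by simp [c])
    simp only [this]
  · rw [mem_uIcc]
    have h0 := t.2.1
    have h1 := t.2.2
    rcases le_total (w i) s with hs | hs
    · have hs' : (w i : ℝ) ≤ s := hs
      refine Or.inl ⟨?_, ?_⟩ <;> rw [← Subtype.coe_le_coe] <;>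
        simp only [c, ContinuousMap.coe_mk] <;> nlinarith
    · have hs' : (s : ℝ) ≤ w i := hs
      refine Or.inr ⟨?_, ?_⟩ <;> rw [← Subtype.coe_le_coe] <;>
        simp only [c, ContinuousMap.coe_mk] <;> nlinarith

theorem zero_of_mem_trivialTangle {n : ℕ} {w : Cube3} (hw : w ∈ trivialTangle n) :
    w 0 ≠ 0 ∧ w 0 ≠ 1 := by
  obtain ⟨⟨k, hk⟩, -⟩ := hw
  have h : (w 0 : ℝ) = arcPos n k := hk
  have h1 := arcPos_mem k.2
  rw [← h] at h1
  exact ⟨fun h0 => h1.1.ne' (by simp [h0]), fun h0 => h1.2.ne (by simp [h0])⟩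

theorem one_of_mem_trivialTangle {n : ℕ} {w : Cube3} (hw : w ∈ trivialTangle n) :
    w 1 ≠ 0 ∧ w 1 ≠ 1 := by
  have h : (w 1 : ℝ) = 1 / 2 := hw.2
  constructor <;> rintro h0 <;> rw [h0] at h <;> norm_num at h

/-- The bridge sphere minus the end points of the arcs is path connected. -/
theorem joinedIn_boundary_diff {n : ℕ} {w : Cube3} (hw : w ∈ Cube.boundary (Fin 3))
    (hw' : w ∉ trivialTangle n) :
    JoinedIn (Cube.boundary (Fin 3) \ trivialTangle n) w 0 := by
  set S := Cube.boundary (Fin 3) \ trivialTangle n with hS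
  have h0 (w : Cube3) (h : w 0 = 0 ∨ w 0 = 1) : w ∈ S :=
    ⟨⟨0, h⟩, fun ht => h.elim (zero_of_mem_trivialTangle ht).1 (zero_of_mem_trivialTangle ht).2⟩
  have h1 (w : Cube3) (h : w 1 = 0 ∨ w 1 = 1) : w ∈ S :=
    ⟨⟨1, h⟩, fun ht => h.elim (one_of_mem_trivialTangle ht).1 (one_of_mem_trivialTangle ht).2⟩
  have step1 (w : Cube3) (h : w 1 = 0 ∨ w 1 = 1) : JoinedIn S w 0 := by
    have j1 : JoinedIn S w (Function.update w 0 0) :=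
      joinedIn_update fun r _ => h1 _ (by simpa using h)
    have j2 : JoinedIn S (Function.update w 0 0) (Function.update (Function.update w 0 0) 1 0) :=
      joinedIn_update fun r _ => h0 _ (by simp)
    have j3 : JoinedIn S (Function.update (Function.update w 0 0) 1 0)
        (Function.update (Function.update (Function.update w 0 0) 1 0) 2 0) :=
      joinedIn_update fun r _ => h0 _ (by simp)
    have he : Function.update (Function.update (Function.update w 0 0) 1 0) 2 0 = 0 := by
      ext i; fin_cases i <;> simp
    exact he ▸ (j1.trans j2).trans j3
  obtain ⟨i, hi⟩ := hw
  fin_cases i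
  · refine JoinedIn.trans (y := Function.update w 1 0) ?_ (step1 _ (by simp))
    exact joinedIn_update fun r _ => h0 _ (by simpa using hi)
  · exact step1 w hi
  · have h2 (r : I) (hr : (r : ℝ) = 1 / 2 → r = w 1) : Function.update w 1 r ∈ S := by
      refine ⟨⟨2, by simpa using hi⟩, fun ht => hw' ?_⟩
      have := hr (by simpa using ht.2)
      rwa [this, Function.update_eq_self] at ht
    rcases le_total (1 / 2 : ℝ) (w 1) with h | h
    · refine JoinedIn.trans (y := Function.update w 1 1) ?_ (step1 _ (by simp))
      refine joinedIn_update fun r hr => h2 r fun hr2 => le_antisymm ?_ ?_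
      · rw [← Subtype.coe_le_coe, hr2]; exact h
      · rw [uIcc_of_le unitInterval.le_one'] at hr
        exact hr.1
    · refine JoinedIn.trans (y := Function.update w 1 0) ?_ (step1 _ (by simp))
      refine joinedIn_update fun r hr => h2 r fun hr2 => le_antisymm ?_ ?_
      · rw [uIcc_of_ge unitInterval.nonneg'] at hr
        exact hr.2
      · rw [← Subtype.coe_le_coe, hr2]; exact h

end CubePaths

section Complement

variable {Y : Type*} [TopologicalSpace Y] {n : ℕ} {K : Set Y} {h₁ h₂ : Cube3 → Y}

theorem IsTangleBall.joinedIn_zero (hT : IsTangleBall n K h₁) {y : Y} (hy : y ∈ range h₁)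
    (hyK : y ∈ Kᶜ) : JoinedIn Kᶜ y (h₁ 0) := by
  obtain ⟨w, rfl⟩ := hy
  have hw : w ∉ trivialTangle n := by rwa [← hT.mem_iff]
  have h2 (r : I) : Function.update w 2 r ∉ trivialTangle n := by
    intro h
    refine hw ⟨?_, ?_⟩
    · simpa using h.1
    · simpa using h.2
  have j1 : JoinedIn (trivialTangle n)ᶜ w (Function.update w 2 0) :=
    joinedIn_update fun r _ => h2 r
  have j2 : JoinedIn (trivialTangle n)ᶜ (Function.update w 2 0) 0 :=
    (joinedIn_boundary_diff ⟨2, by simp⟩ (h2 0)).mono fun _ h => h.2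
  obtain ⟨γ, hγ⟩ := j1.trans j2
  refine ⟨γ.map hT.isEmbedding.continuous, fun t => ?_⟩
  rw [Path.map_coe, Function.comp, mem_compl_iff, hT.mem_iff]
  exact hγ t

/-- The complement of `K` is path connected. -/
theorem IsBridgeSplitting.isPathConnected_compl (S : IsBridgeSplitting n K h₁ h₂) :
    IsPathConnected Kᶜ := by
  have h0 : (0 : Cube3) ∉ trivialTangle n := fun h => (zero_of_mem_trivialTangle h).1 rfl
  have h2 : JoinedIn Kᶜ (h₂ 0) (h₁ 0) := by
    refine S.ball₁.joinedIn_zero ((S.mem_range_iff 0).2 ⟨0, Or.inl rfl⟩) ?_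
    rwa [mem_compl_iff, S.ball₂.mem_iff]
  refine ⟨h₁ 0, by rwa [mem_compl_iff, S.ball₁.mem_iff], fun {y} hy => ?_⟩
  have hcov : y ∈ range h₁ ∪ range h₂ := S.union_eq ▸ mem_univ y
  rcases hcov with h | h
  · exact (S.ball₁.joinedIn_zero h hy).symm
  · exact ((S.ball₂.joinedIn_zero h hy).trans h2).symm

end Complement

/-! ### Cocycles that vanish on the meridians -/

section Meridian

variable {Y A : Type*} [TopologicalSpace Y] {K : Set Y} [AddCommGroup A]

/-- The polar coordinates of a column, as a map to the complement of `K`. -/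
noncomputable def TangleColumn.polarCompl (H : TangleColumn K) : C(ℝ × ℝ × ℝ, (Kᶜ : Set Y)) :=
  ⟨fun q => ⟨H.polar q, H.polar_notMem q⟩, by fun_prop⟩

/-- The loop around the core of a column. -/
noncomputable def TangleColumn.meridian (H : TangleColumn K) :
    Path (H.polarCompl 0) (H.polarCompl 0) where
  toFun s := H.polarCompl (0, 2 * Real.pi * s, 0)
  continuous_toFun := by fun_prop
  source' := by simp; rfl
  target' := by
    refine Subtype.ext ?_
    have := H.polar_add 0 0 0 1
    simp only [Int.cast_one, mul_one, zero_add] at this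
    have h0 : H.polar (0, 0, 0) = H.polar 0 := rfl
    rw [h0] at this
    simpa [TangleColumn.polarCompl] using this

/-- The value on a meridian is the difference of the values on the two half turns. -/
theorem TangleColumn.val_meridian (H : TangleColumn K) (c : PathCocycle (Kᶜ : Set Y) A)
    {x y x' y' : (Kᶜ : Set Y)} {p : Path x y} {q : Path x' y'}
    (hp : ∀ s : I, p s = H.polarCompl (0, Real.pi * s, 0))
    (hq : ∀ s : I, q s = H.polarCompl (0, -(Real.pi * s), 0)) :
    c.val H.meridian = c.val p - c.val q := by
  set G := (c.comap H.polarCompl).primitive 0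
  have hG : (c.comap H.polarCompl).IsPrimitive G := PathCocycle.isPrimitive_primitive _ _
  have key (g : C(I, ℝ)) {x y : (Kᶜ : Set Y)} (r : Path x y)
      (hr : ∀ s, r s = H.polarCompl (0, g s, 0)) :
      c.val r = G (0, g 1, 0) - G (0, g 0, 0) := by
    let r' : Path (((0 : ℝ), g 0, (0 : ℝ))) (0, g 1, 0) :=
      ⟨⟨fun s => (0, g s, 0), by fun_prop⟩, rfl, rfl⟩
    rw [← hG r', PathCocycle.val_comap]
    exact c.val_congr hr
  have hq' (s : I) : q s = H.polarCompl (0, 2 * Real.pi - Real.pi * s, 0) := by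
    rw [hq]
    refine Subtype.ext ?_
    have := H.polar_add 0 (-(Real.pi * s)) 0 1
    rw [show -(Real.pi * s) + 2 * Real.pi * ((1 : ℤ) : ℝ) = 2 * Real.pi - Real.pi * s by
      push_cast; ring] at this
    exact this.symm
  rw [key ⟨fun s => 2 * Real.pi * s, by fun_prop⟩ H.meridian fun s => rfl,
    key ⟨fun s => Real.pi * s, by fun_prop⟩ p hp,
    key ⟨fun s => 2 * Real.pi - Real.pi * s, by fun_prop⟩ q hq']
  simp only [ContinuousMap.coe_mk, Icc.coe_one, Icc.coe_zero, mul_one, mul_zero, sub_zero]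
  rw [show 2 * Real.pi - Real.pi = Real.pi by ring]
  abel

end Meridian

section Slit

/-- The trivial tangle in the coordinates of a half of the ball: the vertical segments at the
positions of the arcs in the front wall of the cube. -/
def slits (n : ℕ) : Set Cube3 := {w | w 1 = 0 ∧ ∃ k < n, (w 0 : ℝ) = arcPos n k}

variable {n : ℕ}

theorem isClosed_slits (n : ℕ) : IsClosed (slits n) := by
  have h : slits n = {w | w 1 = 0} ∩
      ⋃ k ∈ Finset.range n, {w : Cube3 | (w 0 : ℝ) = arcPos n k} := by
    ext w; simp [slits]
  rw [h]
  refine (isClosed_eq (continuous_apply 1) continuous_const).inter ?_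
  exact (Finset.range n).finite_toSet.isClosed_biUnion fun k _ =>
    isClosed_eq (by fun_prop) continuous_const

instance : LocallyPathConnectedSpace ((slits n)ᶜ : Set Cube3) :=
  (isClosed_slits n).isOpen_compl.locallyPathConnectedSpace

/-- A half of the ball minus the arcs is star-shaped about the corner `1`, which lies in the back
wall. -/
instance : ContractibleSpace ((slits n)ᶜ : Set Cube3) := by
  rw [contractible_iff_id_nullhomotopic]
  have hmem (q : I × ((slits n)ᶜ : Set Cube3)) :
      (fun i => σ (σ q.1 * σ (q.2.1 i))) ∈ (slits n)ᶜ := by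
    rintro ⟨h1, k, hk, h2⟩
    have h3 : (σ q.1 : I) * σ (q.2.1 1) = 1 := by
      simpa using congrArg σ h1
    have h4 : σ q.1 = 1 := le_antisymm unitInterval.le_one' (h3 ▸ unitInterval.mul_le_left)
    rw [h4, one_mul] at h3
    simp only [h4, one_mul, unitInterval.symm_symm] at h2
    exact q.2.2 ⟨by simpa using congrArg σ h3, k, hk, h2⟩
  refine ⟨⟨1, fun h => by simpa using h.1⟩,
    ⟨⟨fun q => ⟨fun i => σ (σ q.1 * σ (q.2.1 i)), hmem q⟩,
      Continuous.subtype_mk (continuous_pi fun i => unitInterval.continuous_symm.comp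
        ((unitInterval.continuous_symm.comp continuous_fst).mul
        (unitInterval.continuous_symm.comp ((continuous_apply i).comp
          (continuous_subtype_val.comp continuous_snd))))) _⟩, fun w => ?_, fun w => ?_⟩⟩
  · ext; simp
  · ext; simp

end Slit

section Halves

variable {Y A : Type*} [TopologicalSpace Y] {n : ℕ} {K : Set Y} {h : Cube3 → Y} [AddCommGroup A]

/-- The height of a point of a half of the ball over the plane of the arcs, as a coordinate of the
ball: the upper half is `ε = true`. -/
noncomputable def halfHeight (ε : Bool) (s : ℝ) : ℝ := if ε then (1 + s) / 2 else (1 - s) / 2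

theorem halfHeight_mem (ε : Bool) (s : I) : halfHeight ε s ∈ Icc (0 : ℝ) 1 := by
  have h0 := s.2.1
  have h1 := s.2.2
  cases ε <;> simp only [halfHeight] <;> constructor <;> simp <;> linarith

theorem halfHeight_eq_half_iff (ε : Bool) (s : ℝ) : halfHeight ε s = 1 / 2 ↔ s = 0 := by
  cases ε <;> simp only [halfHeight] <;> constructor <;> intro h <;> simp at h ⊢ <;> linarith

namespace IsTangleBall

variable (hT : IsTangleBall n K h)

/-- The two halves of the ball, above and below the plane of the arcs, as cubes; the plane of the
arcs is the front wall of both cubes. -/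
noncomputable def halfMap (ε : Bool) : C(Cube3, Y) :=
  ⟨fun w => h (cubePoint (w 0) (halfHeight ε (w 1)) (w 2)), by
    have h1 := hT.isEmbedding.continuous
    have h2 : Continuous (halfHeight ε) := by
      cases ε <;> unfold halfHeight <;> simp <;> fun_prop
    fun_prop⟩

theorem halfMap_mem_iff (ε : Bool) (w : Cube3) : hT.halfMap ε w ∈ Kᶜ ↔ w ∈ (slits n)ᶜ := by
  rw [mem_compl_iff, mem_compl_iff, not_iff_not]
  change h _ ∈ K ↔ _
  rw [hT.mem_iff, mem_trivialTangle_cubePoint _ (w 0).2 (halfHeight_mem ε _),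
    halfHeight_eq_half_iff, and_comm]
  exact and_congr_left fun _ => ⟨fun h => Subtype.ext h, fun h => congrArg Subtype.val h⟩

/-- The two halves of the ball minus the arcs. -/
noncomputable def halfCompl (ε : Bool) : C(((slits n)ᶜ : Set Cube3), (Kᶜ : Set Y)) :=
  ⟨fun w => ⟨hT.halfMap ε w, (hT.halfMap_mem_iff ε w).2 w.2⟩, by fun_prop⟩

theorem isClosedMap_halfCompl [T2Space Y] (ε : Bool) : IsClosedMap (hT.halfCompl ε) := by
  have h1 : IsClosedMap (hT.halfMap ε) := (hT.halfMap ε).continuous.isClosedMap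
  have h2 := h1.restrictPreimage (Kᶜ : Set Y)
  have h3 : (slits n)ᶜ = hT.halfMap ε ⁻¹' Kᶜ := by
    ext w; exact (hT.halfMap_mem_iff ε w).symm
  exact h2.comp (Homeomorph.setCongr h3).isClosedMap

theorem halfMap_eq_iff {ε ε' : Bool} {w w' : Cube3} : hT.halfMap ε w = hT.halfMap ε' w' ↔
    w 0 = w' 0 ∧ halfHeight ε (w 1) = halfHeight ε' (w' 1) ∧ w 2 = w' 2 := by
  constructor
  · intro heq
    have := cubePoint_injOn (x₁ := ((w 0, halfHeight ε (w 1)), w 2))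
      (x₂ := ((w' 0, halfHeight ε' (w' 1)), w' 2)) ⟨⟨(w 0).2, halfHeight_mem _ _⟩, (w 2).2⟩
      ⟨⟨(w' 0).2, halfHeight_mem _ _⟩, (w' 2).2⟩ (hT.isEmbedding.injective heq)
    simp only [Prod.mk.injEq] at this
    exact ⟨Subtype.ext this.1.1, this.1.2, Subtype.ext this.2⟩
  · rintro ⟨h0, h1, h2⟩
    change h _ = h _
    rw [h0, h1, h2]

/-- The parametrisation of each half of the ball is injective. -/
theorem eq_of_halfMap_eq {ε : Bool} {w w' : Cube3} (heq : hT.halfMap ε w = hT.halfMap ε w') :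
    w = w' := by
  obtain ⟨h0, h1, h2⟩ := hT.halfMap_eq_iff.1 heq
  ext i
  fin_cases i
  · exact congrArg Subtype.val h0
  · change (w 1 : ℝ) = w' 1
    cases ε <;> simp [halfHeight] at h1 <;> exact h1
  · exact congrArg Subtype.val h2

/-- The two halves meet in the plane of the arcs. -/
theorem eq_of_halfMap_true_eq {w w' : Cube3} (heq : hT.halfMap true w = hT.halfMap false w') :
    w = w' ∧ w 1 = 0 := by
  obtain ⟨h0, h1, h2⟩ := hT.halfMap_eq_iff.1 heq
  have h3 := (w 1).2.1
  have h4 := (w' 1).2.1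
  simp only [halfHeight, if_true, Bool.false_eq_true, if_false] at h1
  have h5 : (w 1 : ℝ) = 0 := by linarith
  have h6 : (w' 1 : ℝ) = 0 := by linarith
  refine ⟨?_, Subtype.ext h5⟩
  ext i
  fin_cases i
  · exact congrArg Subtype.val h0
  · exact h5.trans h6.symm
  · exact congrArg Subtype.val h2

theorem halfMap_true_eq_false {w : Cube3} (hw : w 1 = 0) :
    hT.halfMap true w = hT.halfMap false w := by
  rw [hT.halfMap_eq_iff]
  simp [hw, halfHeight]

theorem exists_halfCompl_eq {y : (Kᶜ : Set Y)} (hy : (y : Y) ∈ range h) :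
    ∃ ε w, hT.halfCompl ε w = y := by
  obtain ⟨v, hv⟩ := hy
  have key (ε : Bool) (s : I) (hs : halfHeight ε s = v 1) : ∃ ε w, hT.halfCompl ε w = y := by
    have h1 : hT.halfMap ε ![v 0, s, v 2] = y := by
      change h (cubePoint (v 0) (halfHeight ε s) (v 2)) = y
      rw [hs, cubePoint_coe, hv]
    exact ⟨ε, ⟨_, (hT.halfMap_mem_iff ε _).1 (h1 ▸ y.2)⟩, Subtype.ext h1⟩
  have h0 := (v 1).2.1
  have h1 := (v 1).2.2
  rcases le_total (1 / 2 : ℝ) (v 1) with hv1 | hv1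
  · exact key true ⟨2 * v 1 - 1, by linarith, by linarith⟩ (by simp [halfHeight])
  · exact key false ⟨1 - 2 * v 1, by linarith, by linarith⟩ (by simp [halfHeight])

variable (c : PathCocycle (Kᶜ : Set Y) A)

/-- The jump, in the plane of the arcs, between the primitives on the two halves of the ball. -/
noncomputable def jump (w : ((slits n)ᶜ : Set Cube3)) : A :=
  (c.comap (hT.halfCompl true)).primitive ⟨1, fun h => by simpa using h.1⟩ w -
    (c.comap (hT.halfCompl false)).primitive ⟨1, fun h => by simpa using h.1⟩ w

/-- The variation of the jump along a path is the difference of the values of the cocycle on the two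
copies of the path. -/
theorem jump_sub_jump {w w' : ((slits n)ᶜ : Set Cube3)} (p : Path w w') :
    hT.jump c w' - hT.jump c w =
      c.val (p.map (hT.halfCompl true).continuous) -
        c.val (p.map (hT.halfCompl false).continuous) := by
  have h1 := PathCocycle.isPrimitive_primitive (c.comap (hT.halfCompl true))
    ⟨1, fun h => by simpa using h.1⟩ p
  have h2 := PathCocycle.isPrimitive_primitive (c.comap (hT.halfCompl false))
    ⟨1, fun h => by simpa using h.1⟩ p
  rw [PathCocycle.val_comap] at h1 h2
  rw [h1, h2, jump, jump]
  abel

/-- The jump does not vary along segments in the plane of the arcs. -/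
theorem jump_eq_of_no_arc {w w' : ((slits n)ᶜ : Set Cube3)} (hw : w.1 1 = 0) (hw' : w'.1 1 = 0)
    (hx : ∀ r ∈ uIcc (w.1 0 : ℝ) (w'.1 0), ∀ k < n, r ≠ arcPos n k) :
    hT.jump c w = hT.jump c w' := by
  have hmem (a b s : I) : (1 - (s : ℝ)) * a + s * b ∈ Icc (0 : ℝ) 1 :=
    convex_Icc (0 : ℝ) 1 a.2 b.2 (by linarith [s.2.2]) s.2.1 (by ring)
  have hcoord (s : I) : (1 - (s : ℝ)) * w.1 0 + s * w'.1 0 ∈ uIcc (w.1 0 : ℝ) (w'.1 0) :=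
    convex_uIcc _ _ left_mem_uIcc right_mem_uIcc (by linarith [s.2.2]) s.2.1 (by ring)
  let g : I → Cube3 := fun s i => ⟨(1 - (s : ℝ)) * w.1 i + s * w'.1 i, hmem _ _ s⟩
  have hg : Continuous g := continuous_pi fun i => Continuous.subtype_mk (by fun_prop) _
  let p : Path w w' :=
    { toFun := fun s => ⟨g s, fun ⟨_, k, hk, h⟩ => hx _ (hcoord s) k hk h⟩
      continuous_toFun := by fun_prop
      source' := by ext; simp [g]
      target' := by ext; simp [g] }
  have h1 := hT.jump_sub_jump c p
  rw [c.val_congr (p := p.map (hT.halfCompl true).continuous)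
    (q := p.map (hT.halfCompl false).continuous), sub_self, sub_eq_zero] at h1
  · exact h1.symm
  · intro s
    refine Subtype.ext (hT.halfMap_true_eq_false (Subtype.ext ?_))
    change (1 - (s : ℝ)) * w.1 1 + s * w'.1 1 = 0
    simp [hw, hw']

theorem squareDir_neg (θ : ℝ) : squareDir (-θ) = ((squareDir θ).1, -(squareDir θ).2) := by
  have h : ‖(Real.cos θ, -Real.sin θ)‖ = ‖(Real.cos θ, Real.sin θ)‖ := by
    simp [Prod.norm_def]
  rw [squareDir, squareDir, Real.cos_neg, Real.sin_neg, h]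
  ext <;> simp

theorem squareDir_snd_nonneg (s : I) : 0 ≤ (squareDir (Real.pi * s)).2 := by
  rw [squareDir]
  refine mul_nonneg (inv_nonneg.2 (norm_nonneg _)) (Real.sin_nonneg_of_nonneg_of_le_pi ?_ ?_)
  · exact mul_nonneg Real.pi_pos.le s.2.1
  · exact mul_le_of_le_one_right Real.pi_pos.le s.2.2

/-- A half turn around an arc, in the coordinates of the halves of the ball. -/
noncomputable def halfTurn (n k : ℕ) (s : ℝ) : Cube3 :=
  cubePoint (columnPos n k (squareDir (Real.pi * s))).1 (squareDir (Real.pi * s)).2 0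

theorem halfTurn_coords {k : ℕ} (hk : k < n) (s : I) :
    (halfTurn n k s 0 : ℝ) = (columnPos n k (squareDir (Real.pi * s))).1 ∧
      (halfTurn n k s 1 : ℝ) = (squareDir (Real.pi * s)).2 ∧ (halfTurn n k s 2 : ℝ) = 0 := by
  refine ⟨cubePoint_zero _ _ (columnPos_mem hk (norm_squareDir _).le).1, cubePoint_one _ _
    ⟨squareDir_snd_nonneg s, (le_abs_self _).trans ((norm_snd_le _).trans (norm_squareDir _).le)⟩,
    cubePoint_two _ _ (by simp)⟩

theorem halfTurn_notMem {k : ℕ} (hk : k < n) (s : I) : halfTurn n k s ∈ (slits n)ᶜ := by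
  obtain ⟨h0, h1, -⟩ := halfTurn_coords hk s
  rintro ⟨h2, k', hk', h3⟩
  rw [h2, Icc.coe_zero] at h1
  rw [h0, columnPos_fst_eq_arcPos_iff hk hk' (norm_squareDir _).le] at h3
  · have := norm_squareDir (Real.pi * s)
    rw [h3.2, norm_zero] at this
    norm_num at this
  · simp [columnPos, ← h1]

theorem halfMap_halfTurn (k : Fin n) (ε : Bool) (s : I) : hT.halfMap ε (halfTurn n k s) =
    (hT.column k).polar (0, if ε then Real.pi * s else -(Real.pi * s), 0) := by
  obtain ⟨h0, h1, h2⟩ := halfTurn_coords k.2 s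
  change h (cubePoint _ _ _) = h (cubePoint _ _ _)
  simp only [TangleColumn.clamp_of_mem (t := 0) (by simp), min_self, Real.exp_zero, one_smul]
  rw [h0, h1, h2]
  cases ε
  · simp only [Bool.false_eq_true, if_false, squareDir_neg, columnPos, halfHeight]
    congr 2
    ring
  · simp only [if_true, columnPos, halfHeight]
    congr 2
    ring

/-- The jump does not change across an arc whose meridian has value zero. -/
theorem jump_halfTurn {k : Fin n} (hc : c.val (hT.column k).meridian = 0) :
    hT.jump c ⟨_, halfTurn_notMem k.2 1⟩ = hT.jump c ⟨_, halfTurn_notMem k.2 0⟩ := by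
  have hcont : Continuous fun s : I => halfTurn n k s := by
    have h1 := continuous_columnPos n k
    have h2 : Continuous fun s : I => squareDir (Real.pi * s) := by fun_prop
    exact continuous_cubePoint (h1.comp h2).fst h2.snd continuous_const
  let p : Path (⟨_, halfTurn_notMem k.2 0⟩ : ((slits n)ᶜ : Set Cube3))
      ⟨_, halfTurn_notMem k.2 1⟩ :=
    { toFun := fun s => ⟨halfTurn n k s, halfTurn_notMem k.2 s⟩
      continuous_toFun := by fun_prop
      source' := rfl
      target' := rfl }
  have h1 := hT.jump_sub_jump c p
  rw [← (hT.column k).val_meridian c (p := p.map (hT.halfCompl true).continuous)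
    (q := p.map (hT.halfCompl false).continuous)
    (fun s => Subtype.ext (hT.halfMap_halfTurn k true s))
    (fun s => Subtype.ext (hT.halfMap_halfTurn k false s)), hc, sub_eq_zero] at h1
  exact h1

theorem halfTurn_zero {k : ℕ} (hk : k < n) :
    (halfTurn n k 0 0 : ℝ) = colRight n k ∧ halfTurn n k 0 1 = 0 := by
  have h := halfTurn_coords hk 0
  simp only [Icc.coe_zero, mul_zero, squareDir_zero, columnPos, stretch_one] at h
  exact ⟨h.1, Subtype.ext h.2.1⟩

theorem halfTurn_one {k : ℕ} (hk : k < n) :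
    (halfTurn n k 1 0 : ℝ) = colLeft n k ∧ halfTurn n k 1 1 = 0 := by
  have h := halfTurn_coords hk 1
  have h1 : squareDir Real.pi = (-1, 0) := by
    have := squareDir_add_pi 0
    rw [zero_add, squareDir_zero] at this
    simpa using this
  simp only [Icc.coe_one, mul_one, h1, columnPos, stretch_neg_one] at h
  exact ⟨h.1, Subtype.ext h.2.1⟩

theorem ne_arcPos_of_mem_gap {j k : ℕ} {r : ℝ} (hn : 0 < n) (h1 : 4 * j + 3 ≤ 4 * n * r)
    (h2 : 4 * n * r ≤ 4 * j + 5) : r ≠ arcPos n k := by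
  have hn' : (0 : ℝ) < n := by exact_mod_cast hn
  have h : r = gapPos n j ((4 * n * r - (4 * j + 3)) / 2) := by
    rw [gapPos]; field_simp; ring
  rw [h]
  exact gapPos_ne_arcPos hn ⟨by linarith, by linarith⟩

theorem zero_mem_compl_slits : (0 : Cube3) ∈ (slits n)ᶜ := by
  rintro ⟨-, k, hk, h⟩
  exact (arcPos_mem hk).1.ne h

/-- If the meridians have value zero, the jump is constant. -/
theorem jump_eq (hn : 0 < n) (hc : ∀ k, c.val (hT.column k).meridian = 0)
    {w : ((slits n)ᶜ : Set Cube3)} (hw : w.1 1 = 0) :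
    hT.jump c w = hT.jump c ⟨0, zero_mem_compl_slits⟩ := by
  have hn' : (0 : ℝ) < n := by exact_mod_cast hn
  -- Induction over the arcs from the left wall, moving past each arc by a half turn.
  have hR (k : ℕ) (hk : k < n) : hT.jump c ⟨_, halfTurn_notMem hk 0⟩ =
      hT.jump c ⟨0, zero_mem_compl_slits⟩ := by
    induction k with
    | zero =>
      rw [← hT.jump_halfTurn c (hc ⟨0, hk⟩)]
      refine hT.jump_eq_of_no_arc c (halfTurn_one hk).2 rfl fun r hr k' hk' => ?_
      have h0 : (halfTurn n 0 1 0 : ℝ) = 0 := by rw [(halfTurn_one hk).1, colLeft, if_pos rfl]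
      change r ∈ uIcc (halfTurn n 0 ((1 : I) : ℝ) 0 : ℝ) 0 at hr
      rw [Icc.coe_one, h0, uIcc_self, mem_singleton_iff] at hr
      rw [hr]
      exact (arcPos_mem hk').1.ne
    | succ k ih =>
      rw [← ih (by omega), ← hT.jump_halfTurn c (hc ⟨k + 1, hk⟩)]
      refine hT.jump_eq_of_no_arc c (halfTurn_one hk).2 (halfTurn_zero (by omega)).2
        fun r hr k' hk' => ?_
      change r ∈ uIcc (halfTurn n (k + 1) ((1 : I) : ℝ) 0 : ℝ) (halfTurn n k ((0 : I) : ℝ) 0) at hr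
      rw [Icc.coe_one, Icc.coe_zero, (halfTurn_one hk).1, (halfTurn_zero (by omega)).1, uIcc_comm,
        uIcc_of_le] at hr
      · have h1 := mul_colRight (n := n) (k := k) hn (by omega)
        have h2 := le_mul_colLeft (n := n) (k := k + 1) hn (by omega)
        have h3 : 4 * n * colRight n k ≤ 4 * n * r := mul_le_mul_of_nonneg_left hr.1 (by positivity)
        have h4 : 4 * n * r ≤ 4 * n * colLeft n (k + 1) :=
          mul_le_mul_of_nonneg_left hr.2 (by positivity)
        push_cast at h2
        exact ne_arcPos_of_mem_gap (j := k) hn (by linarith) (by linarith)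
      · refine le_of_mul_le_mul_left (a := (4 * n : ℝ)) ?_ (by positivity)
        rw [mul_colRight hn (by omega), le_mul_colLeft hn (by omega)]
        push_cast; linarith
  rcases exists_column hn (w.1 0).2 with ⟨k, hk, hkw⟩ | ⟨j, s, hj, hs, hjs⟩
  · have hne : (w.1 0 : ℝ) ≠ arcPos n k := fun h => w.2 ⟨hw, k, hk, h⟩
    have hcol (r : ℝ) (hr : r ∈ Icc (colLeft n k) (colRight n k)) (hr' : r ≠ arcPos n k) :
        ∀ k' < n, r ≠ arcPos n k' := by
      rintro k' hk' rfl
      obtain rfl := eq_of_mem_column hk hk' hr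
        ⟨(colLeft_lt_arcPos hk').le, (arcPos_lt_colRight hk').le⟩
      exact hr' rfl
    rcases hne.lt_or_gt with hlt | hlt
    · rw [← hR k hk, ← hT.jump_halfTurn c (hc ⟨k, hk⟩)]
      refine hT.jump_eq_of_no_arc c hw (halfTurn_one hk).2 fun r hr => ?_
      change r ∈ uIcc (w.1 0 : ℝ) (halfTurn n k ((1 : I) : ℝ) 0) at hr
      rw [Icc.coe_one, (halfTurn_one hk).1, uIcc_comm, uIcc_of_le hkw.1] at hr
      exact hcol r ⟨hr.1, hr.2.trans hkw.2⟩ (hr.2.trans_lt hlt).ne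
    · rw [← hR k hk]
      refine hT.jump_eq_of_no_arc c hw (halfTurn_zero hk).2 fun r hr => ?_
      change r ∈ uIcc (w.1 0 : ℝ) (halfTurn n k ((0 : I) : ℝ) 0) at hr
      rw [Icc.coe_zero, (halfTurn_zero hk).1, uIcc_of_le hkw.2] at hr
      exact hcol r ⟨hkw.1.trans hr.1, hr.2⟩ (hlt.trans_le hr.1).ne'
  · rw [← hR j (by omega)]
    refine hT.jump_eq_of_no_arc c hw (halfTurn_zero (by omega)).2 fun r hr k' hk' => ?_
    change r ∈ uIcc (w.1 0 : ℝ) (halfTurn n j ((0 : I) : ℝ) 0) at hr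
    have h1 := mul_gapPos hn j s
    have h2 := mul_colRight (n := n) (k := j) hn (by omega)
    rw [← hjs] at h1
    rw [Icc.coe_zero, (halfTurn_zero (by omega)).1, uIcc_comm, uIcc_of_le] at hr
    · have h3 : 4 * n * colRight n j ≤ 4 * n * r := mul_le_mul_of_nonneg_left hr.1 (by positivity)
      have h4 : 4 * n * r ≤ 4 * n * (w.1 0 : ℝ) := mul_le_mul_of_nonneg_left hr.2 (by positivity)
      exact ne_arcPos_of_mem_gap (j := j) hn (by linarith) (by linarith [hs.2])
    · refine le_of_mul_le_mul_left (a := (4 * n : ℝ)) ?_ (by positivity)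
      linarith [hs.1]

/-- A cocycle that vanishes on the meridians of a ball has a primitive on the ball minus `K`. -/
theorem exists_isPrimitive_half (hn : 0 < n) (hc : ∀ k, c.val (hT.column k).meridian = 0) :
    ∃ u : (Kᶜ : Set Y) → A, ∀ ε, (c.comap (hT.halfCompl ε)).IsPrimitive (u ∘ hT.halfCompl ε) := by
  let b : ((slits n)ᶜ : Set Cube3) := ⟨1, fun h => by simpa using h.1⟩
  let J := hT.jump c ⟨0, zero_mem_compl_slits⟩
  let P (ε : Bool) (w : ((slits n)ᶜ : Set Cube3)) : A :=
    (c.comap (hT.halfCompl ε)).primitive b w + if ε then 0 else J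
  have hP (ε : Bool) : (c.comap (hT.halfCompl ε)).IsPrimitive (P ε) :=
    (PathCocycle.isPrimitive_primitive _ _).add_const _
  have htf (w w') (heq : hT.halfCompl true w = hT.halfCompl false w') : P true w = P false w' := by
    obtain ⟨h1, h2⟩ := hT.eq_of_halfMap_true_eq (congrArg Subtype.val heq)
    obtain rfl : w = w' := Subtype.ext h1
    have h3 := hT.jump_eq c hn hc h2
    simp only [P, if_true, Bool.false_eq_true, if_false, add_zero]
    rw [← sub_eq_iff_eq_add']
    exact h3
  have hcompat (ε ε' w w') (heq : hT.halfCompl ε w = hT.halfCompl ε' w') : P ε w = P ε' w' := by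
    have h0 (ε w w') (heq : hT.halfCompl ε w = hT.halfCompl ε w') : P ε w = P ε w' := by
      rw [Subtype.ext (hT.eq_of_halfMap_eq (congrArg Subtype.val heq))]
    cases ε <;> cases ε'
    exacts [h0 _ _ _ heq, (htf _ _ heq.symm).symm, htf _ _ heq, h0 _ _ _ heq]
  have (y : (Kᶜ : Set Y)) : ∃ a : A, ∀ ε w, hT.halfCompl ε w = y → P ε w = a := by
    by_cases hy : ∃ ε w, hT.halfCompl ε w = y
    · obtain ⟨ε, w, hw⟩ := hy
      exact ⟨P ε w, fun ε' w' h => hcompat _ _ _ _ (h.trans hw.symm)⟩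
    · exact ⟨0, fun ε w h => absurd ⟨ε, w, h⟩ hy⟩
  choose u hu using this
  refine ⟨u, fun ε => ?_⟩
  rw [show u ∘ hT.halfCompl ε = P ε from funext fun w => (hu _ ε w rfl).symm]
  exact hP ε

end IsTangleBall

/-- A cocycle on the complement of `K` that vanishes on all meridians has a primitive. -/
theorem IsBridgeSplitting.exists_isPrimitive_compl [T2Space Y] {h₁ h₂ : Cube3 → Y}
    (S : IsBridgeSplitting n K h₁ h₂) (hn : 0 < n) (hX : HasSimplyConnectedNhds (Kᶜ : Set Y))
    (c : PathCocycle (Kᶜ : Set Y) A) (hc₁ : ∀ k, c.val (S.ball₁.column k).meridian = 0)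
    (hc₂ : ∀ k, c.val (S.ball₂.column k).meridian = 0) : ∃ u, c.IsPrimitive u := by
  classical
  obtain ⟨u₁, h1⟩ := S.ball₁.exists_isPrimitive_half c hn hc₁
  obtain ⟨u₂, h2⟩ := S.ball₂.exists_isPrimitive_half c hn hc₂
  have hpath {h : Cube3 → Y} (hT : IsTangleBall n K h) {u : (Kᶜ : Set Y) → A}
      (hu : ∀ ε, (c.comap (hT.halfCompl ε)).IsPrimitive (u ∘ hT.halfCompl ε))
      {x y : (Kᶜ : Set Y)} (γ : Path x y) (hγ : ∀ t, (γ t : Y) ∈ range h) :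
      c.val γ = u y - u x := by
    have := PathCocycle.isPrimitive_comap_of_closed_cover hX hT.halfCompl
      (fun ε => hT.isClosedMap_halfCompl ε) hu γ.toContinuousMap
      (fun t => hT.exists_halfCompl_eq (hγ t))
    let r : Path (0 : I) 1 := ⟨ContinuousMap.id I, rfl, rfl⟩
    have h3 := this r
    rw [PathCocycle.val_comap] at h3
    have h4 : c.val (r.map γ.toContinuousMap.continuous) = c.val γ := c.val_congr fun t => rfl
    have h5 : u (γ 1) = u y := by rw [γ.target]
    have h6 : u (γ 0) = u x := by rw [γ.source]
    rw [← h5, ← h6]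
    exact h4.symm.trans h3
  have h0 : h₁ 0 ∈ Kᶜ := by
    rw [mem_compl_iff, S.ball₁.mem_iff]
    exact fun h => (zero_of_mem_trivialTangle h).1 rfl
  -- The two primitives differ by a constant, since the punctured bridge sphere is connected.
  have hdiff (y : (Kᶜ : Set Y)) (hy1 : (y : Y) ∈ range h₁) (hy2 : (y : Y) ∈ range h₂) :
      u₁ y - u₂ y = u₁ ⟨h₁ 0, h0⟩ - u₂ ⟨h₁ 0, h0⟩ := by
    obtain ⟨w, hw⟩ := hy1
    have hwb : w ∈ Cube.boundary (Fin 3) := (S.symm.mem_range_iff w).1 (hw ▸ hy2)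
    have hwt : w ∉ trivialTangle n := by
      rw [← S.ball₁.mem_iff, hw]; exact y.2
    obtain ⟨γ, hγ⟩ := joinedIn_boundary_diff hwb hwt
    let γ' : Path y ⟨h₁ 0, h0⟩ :=
      { toFun := fun t => ⟨h₁ (γ t), by
          rw [mem_compl_iff, S.ball₁.mem_iff]; exact (hγ t).2⟩
        continuous_toFun := by
          have := S.ball₁.isEmbedding.continuous
          fun_prop
        source' := Subtype.ext (by simpa using hw)
        target' := Subtype.ext (by simp) }
    have e1 := hpath S.ball₁ h1 γ' fun t => ⟨γ t, rfl⟩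
    have e2 := hpath S.ball₂ h2 γ' fun t => (S.symm.mem_range_iff _).2 (hγ t).1
    rw [e1, sub_eq_sub_iff_add_eq_add] at e2
    rw [sub_eq_sub_iff_add_eq_add, add_comm, add_comm (u₁ _), ← e2, add_comm]
  set k := u₁ ⟨h₁ 0, h0⟩ - u₂ ⟨h₁ 0, h0⟩
  let u (y : (Kᶜ : Set Y)) : A := if (y : Y) ∈ range h₁ then u₁ y else u₂ y + k
  have hu1 (y : (Kᶜ : Set Y)) (hy : (y : Y) ∈ range h₁) : u y = u₁ y := if_pos hy
  have hu2 (y : (Kᶜ : Set Y)) (hy : (y : Y) ∈ range h₂) : u y = u₂ y + k := by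
    by_cases hy1 : (y : Y) ∈ range h₁
    · rw [hu1 y hy1, ← hdiff y hy1 hy]; abel
    · exact if_neg hy1
  refine ⟨u, PathCocycle.isPrimitive_of_closed_cover hX (ι := Bool ⊕ Bool)
    (W := fun _ => ((slits n)ᶜ : Set Cube3)) (Sum.elim S.ball₁.halfCompl S.ball₂.halfCompl)
    (fun i => ?_) (fun y => ?_) fun i => ?_⟩
  · rcases i with ε | ε
    exacts [S.ball₁.isClosedMap_halfCompl ε, S.ball₂.isClosedMap_halfCompl ε]
  · have : (y : Y) ∈ range h₁ ∪ range h₂ := S.union_eq ▸ mem_univ _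
    rcases this with hy | hy
    · obtain ⟨ε, w, hw⟩ := S.ball₁.exists_halfCompl_eq hy
      exact ⟨Sum.inl ε, w, hw⟩
    · obtain ⟨ε, w, hw⟩ := S.ball₂.exists_halfCompl_eq hy
      exact ⟨Sum.inr ε, w, hw⟩
  · rcases i with ε | ε
    · simp only [Sum.elim_inl]
      rw [show u ∘ S.ball₁.halfCompl ε = u₁ ∘ S.ball₁.halfCompl ε from
        funext fun w => hu1 _ ⟨_, rfl⟩]
      exact h1 ε
    · simp only [Sum.elim_inr]
      rw [show u ∘ S.ball₂.halfCompl ε = fun w => (u₂ ∘ S.ball₂.halfCompl ε) w + k from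
        funext fun w => hu2 _ ⟨_, rfl⟩]
      exact (h2 ε).add_const k

end Halves

/-! ### Some meridian is mapped to a reflection -/

section Reflection

/-- The homomorphism of the dihedral group onto the group of order two with the rotations as its
kernel. -/
def DihedralGroup.reflectionSign (p : ℕ) : DihedralGroup p →* Multiplicative (ZMod 2) :=
  MonoidHom.mk' (fun g => match g with
    | .r _ => .ofAdd 0
    | .sr _ => .ofAdd 1) <| by
      rintro (i | i) (j | j)
      exacts [rfl, rfl, rfl, show Multiplicative.ofAdd (0 : ZMod 2) = .ofAdd 1 * .ofAdd 1 by decide]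

open Path.Homotopic.Quotient in
/-- The additive path cocycle of a homomorphism from the fundamental group to an abelian group:
paths are closed up by chosen paths to the base point. -/
noncomputable def PathCocycle.ofHom {X A : Type*} [TopologicalSpace X] [AddCommGroup A]
    [PathConnectedSpace X] {x₀ : X} (φ : FundamentalGroup X x₀ →* Multiplicative A) :
    PathCocycle X A where
  val {x y} γ := (φ (((Path.Homotopic.Quotient.mk (PathConnectedSpace.somePath x₀ x)).trans
    (.mk γ)).trans (Path.Homotopic.Quotient.mk (PathConnectedSpace.somePath x₀ y)).symm)).toAdd
  val_eq_of_homotopic h := by rw [Path.Homotopic.Quotient.eq.2 h]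
  val_trans {x y z} γ γ' := by
    have h (α β : FundamentalGroup X x₀) : (φ α).toAdd + (φ β).toAdd =
        (φ (Path.Homotopic.Quotient.trans α β)).toAdd := by
      rw [add_comm, ← toAdd_mul]
      exact congrArg Multiplicative.toAdd (map_mul φ β α).symm
    rw [h, mk_trans]
    congr 2
    simp only [trans_assoc]
    congr 2
    rw [← trans_assoc (symm _), symm_trans, refl_trans]

open Path.Homotopic.Quotient in
/-- A homomorphism whose path cocycle has a primitive is trivial: the cocycle vanishes on loops. -/
theorem PathCocycle.IsPrimitive.eq_one_of_ofHom {X A : Type*} [TopologicalSpace X]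
    [AddCommGroup A] [PathConnectedSpace X] {x₀ : X}
    {φ : FundamentalGroup X x₀ →* Multiplicative A} {u : X → A}
    (hu : (PathCocycle.ofHom φ).IsPrimitive u) (g : FundamentalGroup X x₀) : φ g = 1 := by
  let δ : Path.Homotopic.Quotient x₀ x₀ := .mk (PathConnectedSpace.somePath x₀ x₀)
  obtain ⟨γ, hγ⟩ : ∃ γ, Path.Homotopic.Quotient.mk γ =
      (δ.symm.trans (show Path.Homotopic.Quotient x₀ x₀ from g)).trans δ :=
    Path.Homotopic.Quotient.mk_surjective _
  have h : (φ ((δ.trans (.mk γ)).trans δ.symm)).toAdd = 0 := (hu γ).trans (sub_self _)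
  rw [hγ] at h
  have h2 : (δ.trans ((δ.symm.trans (show Path.Homotopic.Quotient x₀ x₀ from g)).trans δ)).trans
      δ.symm = g := by
    simp only [trans_assoc, trans_symm, trans_refl]
    rw [← trans_assoc, trans_symm, refl_trans]
  rw [h2] at h
  exact h

variable {Y : Type*} [TopologicalSpace Y] [T2Space Y] {n : ℕ} {K : Set Y} {h₁ h₂ : Cube3 → Y}

/-- A surjection of the knot group onto the dihedral group maps the meridian of some arc to a
reflection: otherwise it would take values in the rotations only. -/
theorem IsBridgeSplitting.exists_meridian_eq_sr (S : IsBridgeSplitting n K h₁ h₂) (hn : 0 < n)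
    (hX : HasSimplyConnectedNhds (Kᶜ : Set Y)) {p : ℕ} {x₀ : (Kᶜ : Set Y)}
    {ρ : FundamentalGroup (Kᶜ : Set Y) x₀ →* DihedralGroup p} (hρ : Function.Surjective ρ) :
    ∃ H : TangleColumn K,
      ((∃ k, H = S.ball₁.column k) ∨ ∃ k, H = S.ball₂.column k) ∧
      ∃ (δ : Path.Homotopic.Quotient x₀ (H.polarCompl 0)) (l : ZMod p),
        ρ ((δ.trans (.mk H.meridian)).trans δ.symm) = .sr l := by
  have := isPathConnected_iff_pathConnectedSpace.1 S.isPathConnected_compl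
  by_contra! hcon
  -- The cocycle that tells reflections from rotations would vanish on all meridians.
  let c := PathCocycle.ofHom ((DihedralGroup.reflectionSign p).comp ρ)
  have hc (H : TangleColumn K)
      (hH : (∃ k, H = S.ball₁.column k) ∨ ∃ k, H = S.ball₂.column k) : c.val H.meridian = 0 := by
    let δ : Path.Homotopic.Quotient x₀ (H.polarCompl 0) := .mk (PathConnectedSpace.somePath _ _)
    change (DihedralGroup.reflectionSign p
      (ρ ((δ.trans (.mk H.meridian)).trans δ.symm))).toAdd = 0
    cases h : ρ ((δ.trans (.mk H.meridian)).trans δ.symm) with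
    | r i => rfl
    | sr l => exact absurd h (hcon H hH δ l)
  obtain ⟨u, hu⟩ := S.exists_isPrimitive_compl hn hX c (fun k => hc _ (.inl ⟨k, rfl⟩))
    fun k => hc _ (.inr ⟨k, rfl⟩)
  obtain ⟨g, hg⟩ := hρ (.sr 0)
  have h1 := hu.eq_one_of_ofHom g
  rw [MonoidHom.comp_apply, hg] at h1
  exact one_ne_zero (α := ZMod 2) (congrArg Multiplicative.toAdd h1)

end Reflection

/-! ### Counting the points of the fibres -/

section Fibres

variable {Y : Type*} [TopologicalSpace Y] {n : ℕ} {K : Set Y}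
  {M : Type*} [TopologicalSpace M] {f : M → Y}

theorem IsTangleBall.exists_column_eq {h : Cube3 → Y} (hT : IsTangleBall n K h) {w : Cube3}
    (hw : h w ∈ K) : ∃ (k : Fin n) (t : I), (hT.column k).toFun (0, (t : ℝ)) = h w := by
  rw [hT.mem_iff] at hw
  obtain ⟨⟨k, hk⟩, h1⟩ := hw
  refine ⟨k, w 2, ?_⟩
  rw [hT.column_apply, columnPos_zero]
  congr 1
  have h0 : (w 0 : ℝ) = arcPos n k := hk
  rw [← h0, ← h1, cubePoint_coe]

theorem TangleColumn.toFun_zero_mem (H : TangleColumn K) (t : I) : H.toFun (0, (t : ℝ)) ∈ K :=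
  (H.mem_iff 0 t (by simp) t.2).2 rfl

variable [T2Space M] [T2Space Y] [CompactSpace M] (hf : IsBranchedCover f K)

include hf in
/-- All fibres over a connected branch set in bridge position have the same number of points: this
number is constant along each of the finitely many arcs, which are closed. -/
theorem IsBridgeSplitting.card_fiber_eq {h₁ h₂ : Cube3 → Y} (S : IsBridgeSplitting n K h₁ h₂)
    (hK : _root_.IsPreconnected K) {y y' : Y} (hy : y ∈ K) (hy' : y' ∈ K) :
    Nat.card (f ⁻¹' {y}) = Nat.card (f ⁻¹' {y'}) := by
  have := isPreconnected_iff_preconnectedSpace.1 hK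
  let col : Fin n ⊕ Fin n → TangleColumn K := Sum.elim S.ball₁.column S.ball₂.column
  have hcov (y : Y) (hy : y ∈ K) : ∃ i, ∃ t : I, (col i).toFun (0, (t : ℝ)) = y := by
    have : y ∈ range h₁ ∪ range h₂ := S.union_eq ▸ mem_univ _
    obtain ⟨w, rfl⟩ | ⟨w, rfl⟩ := this
    · obtain ⟨k, t, h⟩ := S.ball₁.exists_column_eq hy
      exact ⟨.inl k, t, h⟩
    · obtain ⟨k, t, h⟩ := S.ball₂.exists_column_eq hy
      exact ⟨.inr k, t, h⟩
  let m (y : K) : ℕ := Nat.card (f ⁻¹' {(y : Y)})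
  let core (i : Fin n ⊕ Fin n) (t : I) : K := ⟨_, (col i).toFun_zero_mem t⟩
  have hm (i t) : m (core i t) = m (core i 0) :=
    (TangleColumn.PolarLift.card_orbits hf t.2).symm.trans
      (TangleColumn.PolarLift.card_orbits hf (0 : I).2)
  have hcont : Continuous m := by
    refine continuous_iff_isClosed.2 fun s _ => ?_
    have h : m ⁻¹' s = ⋃ i ∈ {i | m (core i 0) ∈ s}, range (core i) := by
      ext z
      simp only [mem_preimage, mem_iUnion, mem_range, exists_prop, mem_ofPred_eq]
      constructor
      · intro hz
        obtain ⟨i, t, h⟩ := hcov z z.2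
        obtain rfl : core i t = z := Subtype.ext h
        exact ⟨i, by rwa [← hm i t], t, rfl⟩
      · rintro ⟨i, hi, t, rfl⟩
        rwa [hm]
    rw [h]
    refine (Set.toFinite _).isClosed_biUnion fun i _ => (isCompact_range ?_).isClosed
    fun_prop
  exact PreconnectedSpace.constant this hcont (x := ⟨y, hy⟩) (y := ⟨y', hy'⟩)

omit [T2Space M] [T2Space Y] [CompactSpace M] in
/-- The monodromy around a column is the turn of the lifts of its polar coordinates. -/
theorem IsBranchedCover.monodromy_meridian (H : TangleColumn K) :
    ∃ Φ : TangleColumn.PolarLift f H ≃ (Kᶜ.restrictPreimage f) ⁻¹' {H.polarCompl 0},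
      ∀ E, hf.isCoveringMap.monodromy (.mk H.meridian) (Φ E) = Φ ((1 : ℤ) +ᵥ E) := by
  let lift (E : TangleColumn.PolarLift f H) : C(ℝ × ℝ × ℝ, f ⁻¹' Kᶜ) :=
    ⟨fun q => ⟨E.1 q, by rw [mem_preimage, E.2]; exact H.polar_notMem q⟩, by fun_prop⟩
  have hlift (E q) : Kᶜ.restrictPreimage f (lift E q) = H.polarCompl q := Subtype.ext (E.2 q)
  let Φ (E : TangleColumn.PolarLift f H) : (Kᶜ.restrictPreimage f) ⁻¹' {H.polarCompl 0} :=
    ⟨lift E 0, hlift E 0⟩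
  have hΦ : Function.Bijective Φ := by
    refine ⟨fun E E' h => TangleColumn.PolarLift.ext_of_apply_eq hf
      (congrArg (fun z => (z.1 : M)) h), fun ⟨x, hx⟩ => ?_⟩
    obtain ⟨E, hE⟩ := TangleColumn.PolarLift.exists_apply_eq hf (congrArg Subtype.val hx)
    exact ⟨E, Subtype.ext (Subtype.ext hE)⟩
  refine ⟨.ofBijective Φ hΦ, fun E => ?_⟩
  have hend : lift E (0, 2 * Real.pi, 0) = lift ((1 : ℤ) +ᵥ E) 0 := by
    refine Subtype.ext ?_
    have := TangleColumn.PolarLift.vadd_apply 1 E 0 0 0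
    simp only [Int.cast_one, mul_one, zero_add] at this
    exact this.symm
  let Γ : Path (lift E 0) (lift ((1 : ℤ) +ᵥ E) 0) :=
    { toFun := fun s => lift E (0, 2 * Real.pi * s, 0)
      continuous_toFun := by fun_prop
      source' := by simp; rfl
      target' := by rw [← hend]; simp }
  refine hf.isCoveringMap.monodromy_eq_of_map_eq (ex := Φ E) (ey := Φ ((1 : ℤ) +ᵥ E)) (.mk Γ) ?_
  exact congrArg Path.Homotopic.Quotient.mk
    (Path.ext (funext fun s => hlift E (0, 2 * Real.pi * s, 0)))

end Fibres

/-! ### The genus of the Heegaard splitting -/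

section Genus

variable {Y : Type*} [TopologicalSpace Y] {n : ℕ} {K : Set Y}
  {M : Type*} [TopologicalSpace M] {f : M → Y}

omit [TopologicalSpace Y] [TopologicalSpace M] in
theorem card_fiber_restrictPreimage (f : M → Y) {s : Set Y} (y : s) :
    Nat.card (s.restrictPreimage f ⁻¹' {y}) = Nat.card (f ⁻¹' {(y : Y)}) :=
  Nat.card_congr
    { toFun := fun x => ⟨x.1.1, congrArg Subtype.val x.2⟩
      invFun := fun x => ⟨⟨x.1, by rw [mem_preimage, show f x = y from x.2]; exact y.2⟩,
        Subtype.ext x.2⟩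
      left_inv := fun _ => rfl
      right_inv := fun _ => rfl }

theorem IsBridgeSplitting.pos {h₁ h₂ : Cube3 → Y} (S : IsBridgeSplitting n K h₁ h₂)
    (hK : K.Nonempty) : 0 < n := by
  have key {h : Cube3 → Y} (hT : IsTangleBall n K h) {w : Cube3} (hw : h w ∈ K) : 0 < n := by
    obtain ⟨⟨k, -⟩, -⟩ := (hT.mem_iff w).1 hw
    exact k.pos
  obtain ⟨y, hy⟩ := hK
  have : y ∈ range h₁ ∪ range h₂ := S.union_eq ▸ mem_univ _
  obtain ⟨w, rfl⟩ | ⟨w, rfl⟩ := this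
  · exact key S.ball₁ hy
  · exact key S.ball₂ hy

variable [T2Space M] [T2Space Y] [CompactSpace M] (hf : IsBranchedCover f K)

include hf in
/-- If all fibres over the branch set have `N` points and all others have `p` points, then the
handlebody over a tangle ball has `n * N` balls and `(n - 1) * p` handles. -/
theorem IsTangleBall.card_index {h : Cube3 → Y} (hT : IsTangleBall n K h) {N p : ℕ}
    (hN : ∀ y ∈ K, Nat.card (f ⁻¹' {y}) = N) (hp : ∀ y ∈ Kᶜ, Nat.card (f ⁻¹' {y}) = p) :
    Nat.card (hT.BallIndex f) = n * N ∧ Nat.card (hT.HandleIndex f) = (n - 1) * p := by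
  have (k : Fin n) : Finite (TangleColumn.PolarLift.Orbits f (hT.column k)) :=
    TangleColumn.PolarLift.finite_orbits hf
  have (j : Fin (n - 1)) : Finite (hT.GapLift f j) := hT.finite_gapLift hf j
  constructor
  · rw [Nat.card_sigma]
    simp only [TangleColumn.PolarLift.card_orbits hf (0 : I).2,
      hN _ (TangleColumn.toFun_zero_mem _ _)]
    simp
  · rw [Nat.card_sigma]
    simp only [Nat.card_congr (hT.gapLiftEquivFiber hf _ 0), hp _ (hT.gapMap_notMem _ _)]
    simp

end Genus

section Dihedral

variable {p n : ℕ} {K : Set ThreeSphere} {x₀ : ↥Kᶜ}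
  {ρ : FundamentalGroup ↥Kᶜ x₀ →* DihedralGroup p} {M : Type*} [TopologicalSpace M] [T2Space M]
  {f : C(M, ThreeSphere)}

theorem ThreeSphere.hasSimplyConnectedNhds_compl (hK : IsClosed K) :
    HasSimplyConnectedNhds (Kᶜ : Set ThreeSphere) :=
  have : Fact (Module.finrank ℝ (EuclideanSpace ℝ (Fin 4)) = 3 + 1) := ⟨by simp⟩
  hK.isOpen_compl.hasSimplyConnectedNhds (E := EuclideanSpace ℝ (Fin 3))

/-- The fibres of the irregular dihedral cover have `p` points over the complement of the knot and
`(p + 1) / 2` points over the knot. -/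
theorem IsIrregularDihedralCover.card_fiber (hf : IsIrregularDihedralCover ρ f) (hp : Odd p)
    (hρ : IsColoring ρ) (hK : IsKnot K) {h₁ h₂ : Cube3 → ThreeSphere}
    (S : IsBridgeSplitting n K h₁ h₂) :
    (∀ y ∈ Kᶜ, Nat.card (f ⁻¹' {y}) = p) ∧ ∀ y ∈ K, 2 * Nat.card (f ⁻¹' {y}) = p + 1 := by
  have := hf.branched.compactSpace
  obtain ⟨γ, hγ, hγK⟩ := hK
  have hKpre : _root_.IsPreconnected K := hγK ▸ isPreconnected_range hγ.continuous
  have hKcl : IsClosed K := hγK ▸ (isCompact_range hγ.continuous).isClosed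
  have hn := S.pos ⟨γ 1, hγK ▸ mem_range_self _⟩
  have := isPathConnected_iff_pathConnectedSpace.1 S.isPathConnected_compl
  have := isPathConnected_iff_pathConnectedSpace.1 hf.connected
  obtain ⟨C, hC, x, hx, hrange⟩ := hf.subgroup
  have cov := hf.branched.isCoveringMap
  have hmon {b : ↥Kᶜ} (δ : Path.Homotopic.Quotient x₀ b) :=
    cov.dihedral_monodromy_of_path (hx := hx) hp hρ hC hrange δ
  refine ⟨fun y hy => ?_, fun y hy => ?_⟩
  · rw [← card_fiber_restrictPreimage f (⟨y, hy⟩ : ↥Kᶜ)]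
    exact (hmon (.mk (PathConnectedSpace.somePath _ _))).1
  · obtain ⟨H, -, δ, l, hl⟩ :=
      S.exists_meridian_eq_sr hn (ThreeSphere.hasSimplyConnectedNhds_compl hKcl) hρ
    obtain ⟨hcard, h2⟩ := hmon δ
    obtain ⟨hinv, e, he, hu⟩ := h2 _ l hl
    obtain ⟨Φ, hΦ⟩ := hf.branched.monodromy_meridian H
    have h3 := TangleColumn.PolarLift.two_mul_card_orbits (H := H) hf.branched
      (fun E => Φ.injective (by rw [← hΦ, ← hΦ, hinv]))
      ⟨Φ.symm e, Φ.injective (by rw [← hΦ, Φ.apply_symm_apply]; exact he), fun E hE =>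
        Φ.injective (by rw [Φ.apply_symm_apply]; exact hu _ ((hΦ E).trans (congrArg Φ hE)))⟩
    rw [TangleColumn.PolarLift.card_orbits hf.branched (0 : I).2, Nat.card_congr Φ, hcard,
      S.card_fiber_eq hf.branched hKpre (H.toFun_zero_mem 0) hy] at h3
    exact h3

end Dihedral

theorem lemma4p8 (p n : ℕ) (hp : Odd p) (K : Set ThreeSphere) (hK : IsKnot K)
    (hn : HasBridgePosition n K)
    (x₀ : ↥Kᶜ) (ρ : FundamentalGroup ↥Kᶜ x₀ →* DihedralGroup p) (hρ : IsColoring ρ)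
    (M : Type u) [TopologicalSpace M] [T2Space M]
    (f : C(M, ThreeSphere)) (hf : IsIrregularDihedralCover ρ f) :
    (∃ g : ℕ, heegaardGenus M = g ∧ (g : ℚ) ≤ 1 / 2 * ((p : ℚ) - 1) * ((n : ℚ) - 2)) ∧
    (∃ r : ℕ, Module.rank ℤ (firstHomology M) = r ∧
      (r : ℚ) ≤ 1 / 2 * ((p : ℚ) - 1) * ((n : ℚ) - 2)) := by
  have : Fact (Module.finrank ℝ (EuclideanSpace ℝ (Fin 4)) = 3 + 1) := ⟨by simp⟩
  obtain ⟨h₁, h₂, S⟩ := hn.exists_isBridgeSplitting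
  have hne : K.Nonempty := by
    obtain ⟨γ, -, rfl⟩ := hK
    exact range_nonempty γ
  have hn := S.pos hne
  have := hf.branched.compactSpace
  have hX : HasSimplyConnectedNhds M :=
    hf.branched.hasSimplyConnectedNhds (E := EuclideanSpace ℝ (Fin 3))
  have := S.pathConnectedSpace hf.branched hn hf.connected
  obtain ⟨hc, hc'⟩ := hf.card_fiber hp hρ hK S
  obtain ⟨N, hN⟩ : ∃ N, 2 * N = p + 1 := ⟨_, hc' _ hne.some_mem⟩
  have hcN (y) (hy : y ∈ K) : Nat.card (f ⁻¹' {y}) = N := by have := hc' y hy; omega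
  obtain ⟨hb, hh⟩ := S.ball₁.card_index hf.branched hcN hc
  obtain ⟨hb', hh'⟩ := S.symm.ball₁.card_index hf.branched hcN hc
  have hpos : 0 < n * N := Nat.mul_pos hn (by omega)
  have := (Nat.card_pos_iff.1 (hb ▸ hpos)).1
  have := (Nat.card_pos_iff.1 (hb' ▸ hpos)).1
  obtain ⟨g, hg, hr⟩ := S.rank_le hf.branched hn hX
  have hspl := S.hasHeegaardSplitting hf.branched hn hX hg (by rw [hb', hh', ← hb, ← hh, hg])
  -- Here `2 * N = p + 1` and `g + n * N = (n - 1) * p + 1`.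
  have hgQ : (g : ℚ) = 1 / 2 * ((p : ℚ) - 1) * ((n : ℚ) - 2) := by
    rw [hb, hh] at hg
    have h1 := congrArg (Nat.cast (R := ℚ)) hg
    have h2 := congrArg (Nat.cast (R := ℚ)) hN
    push_cast [Nat.cast_sub (show 1 ≤ n from hn)] at h1 h2
    linear_combination h1 - (n : ℚ) / 2 * h2
  rw [← hgQ]
  constructor
  · have hle : heegaardGenus M ≤ g := iInf₂_le g hspl
    lift heegaardGenus M to ℕ using ne_top_of_le_ne_top (ENat.natCast_ne_top g) hle with g' hg'
    exact ⟨g', rfl, by exact_mod_cast hle⟩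
  · obtain ⟨r, hr'⟩ := Cardinal.lt_aleph0.1 (hr.trans_lt (Cardinal.natCast_lt_aleph0 (n := g)))
    rw [hr'] at hr ⊢
    exact ⟨r, rfl, by exact_mod_cast hr⟩
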